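/- A configuration is a finite set $C\subset\mathbb R^3$ with a mass function $m:C\to(0,\infty)$. Put $U(C)=\sum_{\{x,y\}\subset C}\frac{m(x)m(y)}{\|x-y\|}$ and $I(C)=\sum_{x\in C}m(x)\|x\|^2$. The configuration is central if its centre of mass is $0$ and it is a critical point of $U$ (as a function of the positions of the particles) restricted to a level set of $I$. For a finite group $G<\mathsf O(3)$, it is $G$-symmetric if $gC=C$ and $m\circ g=m$ for all $g\in G$. The orbit type of $x$ is the conjugacy class in $G$ of its isotropy group $G_x$; the topological orbit type of $x$ is the connected component containing the orbit of $x$ in the set of all orbits of the same orbit type (a subset of $\mathbb R^3/G$). A topological Burnside type $\Gamma$ prescribes finitely many orbits, a given number of each topological orbit type, with at most one orbit of the type of the origin. Let $\mathbb T_d,\mathbb O_h,\mathbb I_h$ be the full symmetry groups in $\mathsf O(3)$ of a regular tetrahedron, a cube and a regular icosahedron centred at $0$. Polyhedra are identified with their vertex sets. 1. Let $G$ be $\mathbb T_d$, $\mathbb O_h$ or $\mathbb I_h$, let $\Gamma$ be a topological Burnside type for $G$, and prescribe a positive mass for each of its orbits. Then the space of $G$-symmetric configurations of type $\Gamma$ with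 these masses is non-empty and each of its connected components contains a central configuration. 2. $\mathbb T_d$ has order $24$ and exactly five orbit types, with isotropy groups $\mathbb T_d$, $S_3$, $\mathbb Z_2\times\mathbb Z_2$, $\mathbb Z_2$, $\mathbb 1$; points with isomorphic isotropy groups have the same orbit type. Type $(\mathbb T_d)$ is the origin only. Type $(S_3)$ splits into exactly two topological types, $(S_3)$ and $(S_3)'$, whose orbits are exactly the positive multiples of the tetrahedron and of the dual tetrahedron respectively. The orbits of type $(\mathbb Z_2\times\mathbb Z_2)$ are exactly the positive multiples of the octahedron formed by the mid-points of the $6$ edges of the tetrahedron. The orbits of types $(\mathbb Z_2)$ and $(\mathbb 1)$ have $12$ and $24$ points. 3. For all $\varepsilon\in\{0,1\}$, $a,b,c,d,e\in\mathbb N$ and any positive masses of the orbits there is a $\mathbb T_d$-symmetric central configuration with these masses which is a disjoint union of orbits of type $$\varepsilon(\mathbb T_d)+a(S_3)+b(S_3)'+c(\mathbb Z_2\times\mathbb Z_2)+d(\mathbb Z_2)+e(\mathbb 1).$$ 4. Let $(G,F)$ be one of: $\mathbb T_d$ with $F=\{$tetrahedron, dual tetrahedron, octahedron$\}$; $\mathbb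 O_h$ with $F=\{$octahedron, cube, cuboctahedron$\}$; $\mathbb I_h$ with $F=\{$icosahedron, dodecahedron, icosidodecahedron$\}$, the polyhedra of each $F$ being placed in dual position with common centre $0$, and the cuboctahedron (icosidodecahedron) having as vertices the mid-points of the edges of the cube (icosahedron). For all $n$, all $P_1,\dots,P_n\in F$ and all $\mu_1,\dots,\mu_n>0$ there are $r_1,\dots,r_n>0$, with $r_i<r_j$ whenever $i<j$ and $P_i=P_j$, such that the sets $r_jP_j$ are pairwise disjoint and their union, with mass $\mu_j$ at each point of $r_jP_j$, is a $G$-symmetric central configuration. (Nested Platonic solids and their duals, nested cuboctahedra and nested icosidodecahedra.) 5. Each of these polyhedra $P$, at any scale $r>0$ and with equal masses at its vertices, is a central configuration. 6. The isotropy group of a point $x$ in $\mathbb O_h$ is generated by the reflections in two orthogonal planes if and only if the orbit of $x$ is a positive multiple of the cuboctahedron. The same holds with $\mathbb I_h$ and the icosidodecahedron. -/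

import Mathlib

open scoped Pointwise Topology

/-- Euclidean three-space. -/
abbrev E3 : Type := EuclideanSpace ℝ (Fin 3)

/-- The orthogonal group `O(3)`, as the group of linear isometries of `E3`. -/
abbrev O3 : Type := E3 ≃ₗᵢ[ℝ] E3

/-- The natural action of `O(3)` on `E3`. -/
noncomputable instance instMulActionO3 : MulAction O3 E3 where
  smul g x := g x
  one_smul _ := rfl
  mul_smul _ _ _ := rfl

/-! ### Configurations and central configurations -/

/-- A configuration `(C, m)`: a finite set of points and a positive mass at each of them
(the mass function is extended by zero off the set, so that equality is the right one). -/
@[ext]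
structure Configuration where
  points : Finset E3
  mass : E3 → ℝ
  mass_pos : ∀ x ∈ points, 0 < mass x
  mass_eq_zero : ∀ x ∉ points, mass x = 0

open Classical in
/-- Newtonian potential of particles of masses `m i` at the points `y i`
(half the sum over ordered pairs is the sum over unordered pairs). -/
noncomputable def potential {ι : Type} [Fintype ι] (m : ι → ℝ) (y : ι → E3) : ℝ :=
  (1 / 2) * ∑ p ∈ (Finset.univ : Finset ι).offDiag, m p.1 * m p.2 / ‖y p.1 - y p.2‖

/-- Total moment of inertia about the origin. -/
noncomputable def inertia {ι : Type} [Fintype ι] (m : ι → ℝ) (y : ι → E3) : ℝ :=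
  ∑ i, m i * ‖y i‖ ^ 2

/-- `C` is a central configuration: its centre of mass is the origin and it is a critical point
of the restriction of the potential to its level set of the moment of inertia, i.e. the potential
has derivative zero along every motion `γ` of the particles through `C` on that level set. -/
def Configuration.IsCentral (C : Configuration) : Prop :=
  ∑ x ∈ C.points, C.mass x • x = 0 ∧
  ∀ γ : ℝ → (C.points → E3), DifferentiableAt ℝ γ 0 → (γ 0 = fun x : C.points => (x : E3)) →
    (∀ᶠ t in 𝓝 (0 : ℝ), inertia (fun x : C.points => C.mass x) (γ t) =
      inertia (fun x : C.points => C.mass x) (γ 0)) →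
    HasDerivAt (fun t => potential (fun x : C.points => C.mass x) (γ t)) 0 0

/-- `(C, m)` is invariant under `G`: `g · C = C` and `m` takes the same value at `x` and `g x`. -/
def Configuration.IsSymmetric (C : Configuration) (G : Subgroup O3) : Prop :=
  ∀ g ∈ G, (fun x => g x) '' (C.points : Set E3) = (C.points : Set E3) ∧
    ∀ x ∈ C.points, C.mass (g x) = C.mass x

/-- `C` and `C'` are joined by a continuous path of configurations satisfying `P`: the particles
`x` of `C` move along continuous paths `t ↦ φ t x` without collisions and with constant masses. -/
def Configuration.JoinedThrough (P : Configuration → Prop) (C C' : Configuration) : Prop :=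
  ∃ (Φ : unitInterval → Configuration) (φ : unitInterval → C.points → E3),
    Continuous φ ∧ (∀ t, Function.Injective (φ t)) ∧
    (∀ t, ((Φ t).points : Set E3) = Set.range (φ t)) ∧
    (∀ t x, (Φ t).mass (φ t x) = C.mass x) ∧
    (∀ t, P (Φ t)) ∧ Φ 0 = C ∧ Φ 1 = C'

/-! ### Orbit types and topological orbit types -/

/-- The orbit type of `x`: the conjugacy class in `G` of its isotropy subgroup. -/
def orbitType (G : Subgroup O3) (x : E3) : Set (Subgroup G) :=
  {H | ∃ g : G, H = (MulAction.stabilizer G x).map (MulAut.conj g).toMonoidHom}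

/-- The orbit space `E3 / G`, with the quotient topology. -/
abbrev OrbitSpace (G : Subgroup O3) : Type := Quotient (MulAction.orbitRel G E3)

/-- The orbit of `x` as a point of the orbit space. -/
noncomputable def orbitClass (G : Subgroup O3) (x : E3) : OrbitSpace G :=
  Quotient.mk (MulAction.orbitRel G E3) x

/-- The set of all orbits with the same orbit type as the orbit of `x`. -/
def stratum (G : Subgroup O3) (x : E3) : Set (OrbitSpace G) :=
  {q | ∃ y, orbitClass G y = q ∧ orbitType G y = orbitType G x}

/-- The topological orbit type of `x`: the connected component of its orbit in the set of all
orbits with the same orbit type. -/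
def topOrbitType (G : Subgroup O3) (x : E3) : Set (OrbitSpace G) :=
  connectedComponentIn (stratum G x) (orbitClass G x)

/-- The set of all topological orbit types of `G`. -/
def TopOrbitType (G : Subgroup O3) : Type := {s : Set (OrbitSpace G) // ∃ x, topOrbitType G x = s}

/-- The topological orbit type of `x`, as an element of the set of topological orbit types. -/
def TopOrbitType.mk (G : Subgroup O3) (x : E3) : TopOrbitType G := ⟨topOrbitType G x, x, rfl⟩

/-- `C` is the disjoint union of `G`-orbits, `n t` of which are orbits of points of kind `t`
(`R t` being the property of being of kind `t`); the `j`-th orbit of kind `t` consists of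
particles of mass `μ t j`. -/
def Configuration.IsUnionOfOrbits (C : Configuration) (G : Subgroup O3) {T : Type}
    (R : T → E3 → Prop) (n : T → ℕ) (μ : ∀ t, Fin (n t) → ℝ) : Prop :=
  ∃ p : ∀ t, Fin (n t) → E3,
    (∀ t j, R t (p t j)) ∧
    (∀ t j s k, p s k ∈ MulAction.orbit G (p t j) →
      (⟨t, j⟩ : Σ t, Fin (n t)) = ⟨s, k⟩) ∧
    (C.points : Set E3) = ⋃ t, ⋃ j, MulAction.orbit G (p t j) ∧
    ∀ t j, ∀ y ∈ MulAction.orbit G (p t j), C.mass y = μ t j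

/-- `C` is a `G`-symmetric configuration of topological Burnside type `∑ Γ t · t`, in which the
`j`-th orbit of topological type `t` consists of particles of mass `μ t j`. -/
def Configuration.HasBurnsideType (C : Configuration) (G : Subgroup O3)
    (Γ : TopOrbitType G →₀ ℕ) (μ : ∀ t, Fin (Γ t) → ℝ) : Prop :=
  C.IsSymmetric G ∧ C.IsUnionOfOrbits G (fun t x => TopOrbitType.mk G x = t) Γ μ

/-- `C` is the disjoint union of the sets `S j`, with all particles in `S j` of mass `μ j`. -/
def Configuration.IsDisjointUnion (C : Configuration) {n : ℕ} (S : Fin n → Set E3)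
    (μ : Fin n → ℝ) : Prop :=
  Pairwise (fun i j => Disjoint (S i) (S j)) ∧ (C.points : Set E3) = ⋃ j, S j ∧
    ∀ j, ∀ x ∈ S j, C.mass x = μ j

/-! ### Polyhedra (given by their vertex sets) and their symmetry groups -/

/-- The midpoints of the pairs of points of `P` at distance `ℓ`; these are the midpoints of the
edges if `P` is the vertex set of a Platonic solid of edge length `ℓ`. -/
def edgeMidpoints (P : Set E3) (ℓ : ℝ) : Set E3 :=
  {z | ∃ x ∈ P, ∃ y ∈ P, dist x y = ℓ ∧ z = midpoint ℝ x y}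

/-- `(1,1,1), (1,-1,-1), (-1,1,-1), (-1,-1,1)`. -/
def tetrahedron : Set E3 := {x | (∀ i, |x i| = 1) ∧ x 0 * x 1 * x 2 = 1}

/-- The dual (opposite) tetrahedron. -/
def dualTetrahedron : Set E3 := {x | (∀ i, |x i| = 1) ∧ x 0 * x 1 * x 2 = -1}

/-- `(±1,0,0), (0,±1,0), (0,0,±1)`. -/
def octahedron : Set E3 := {x | ∃ i, |x i| = 1 ∧ ∀ j, j ≠ i → x j = 0}

/-- `(±1,±1,±1)`; the edges have length 2. -/
def cube : Set E3 := {x | ∀ i, |x i| = 1}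

/-- `(0,±1,±φ)` and its cyclic permutations; the edges have length 2. -/
def icosahedron : Set E3 := {x | ∃ k : Fin 3, x k = 0 ∧ |x (k + 1)| = 1 ∧ |x (k + 2)| = Real.goldenRatio}

/-- `(±1,±1,±1)`, `(0,±φ,±φ⁻¹)` and its cyclic permutations: the dual of the icosahedron above. -/
def dodecahedron : Set E3 :=
  {x | (∀ i, |x i| = 1) ∨ ∃ k : Fin 3, x k = 0 ∧ |x (k + 1)| = Real.goldenRatio ∧ |x (k + 2)| = Real.goldenRatio⁻¹}

/-- The midpoints of the edges of the cube. -/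
def cuboctahedron : Set E3 := edgeMidpoints cube 2

/-- The midpoints of the edges of the icosahedron. -/
def icosidodecahedron : Set E3 := edgeMidpoints icosahedron 2

/-- The group of all orthogonal transformations that preserve `P`. -/
noncomputable def symmetryGroup (P : Set E3) : Subgroup O3 where
  carrier := {g | (fun x => g x) '' P = P}
  one_mem' := by
    change (fun x : E3 => x) '' P = P
    simp
  mul_mem' := by
    intro a b ha hb
    change (fun x => a (b x)) '' P = P
    have h : (fun x => a (b x)) '' P = (fun x => a x) '' ((fun x => b x) '' P) := by
      rw [Set.image_image]
    rw [h, hb, ha]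
  inv_mem' := by
    intro a ha
    change (fun x => a.symm x) '' P = P
    have ha' : (fun x => a x) '' P = P := ha
    conv_lhs => rw [← ha']
    rw [Set.image_image]
    simp

/-- The tetrahedral group. -/
noncomputable def Td : Subgroup O3 := symmetryGroup tetrahedron

/-- The octahedral group. -/
noncomputable def Oh : Subgroup O3 := symmetryGroup cube

/-- The icosahedral group. -/
noncomputable def Ih : Subgroup O3 := symmetryGroup icosahedron

/-- The isotropy subgroup of `x` in `G` is generated by the reflections in two orthogonal planes
(with normal vectors `u` and `v`); in particular it is isomorphic to `ℤ₂ × ℤ₂`. -/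
def IsotropyIsTwoOrthogonalMirrors (G : Subgroup O3) (x : E3) : Prop :=
  ∃ u v : E3, u ≠ 0 ∧ v ≠ 0 ∧ inner ℝ u v = 0 ∧
    (MulAction.stabilizer G x).map G.subtype =
      Subgroup.closure {(ℝ ∙ u)ᗮ.reflection, (ℝ ∙ v)ᗮ.reflection}

/-- The six kinds of orbits of the tetrahedral group. -/
inductive TdKind : Type
  | origin | tetrahedral | dualTetrahedral | octahedral | mirror | generic

/-- `k.Has x`: the point `x` is of kind `k`, i.e. it is of (topological) orbit type
`(Td)`, `(S₃)`, `(S₃)'`, `(ℤ₂ × ℤ₂)`, `(ℤ₂)`, `(1)` respectively. -/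
noncomputable def TdKind.Has : TdKind → E3 → Prop
  | origin, x => MulAction.stabilizer Td x = ⊤
  | tetrahedral, x => topOrbitType Td x = topOrbitType Td !₂[1, 1, 1]
  | dualTetrahedral, x => topOrbitType Td x = topOrbitType Td !₂[-1, -1, -1]
  | octahedral, x => Nonempty (MulAction.stabilizer Td x ≃*
      Multiplicative (ZMod 2) × Multiplicative (ZMod 2))
  | mirror, x => Nonempty (MulAction.stabilizer Td x ≃* Multiplicative (ZMod 2))
  | generic, x => MulAction.stabilizer Td x = ⊥

/-!
# Symmetric central configurations

Let `G` be a finite subgroup of `O(3)` without nonzero fixed vectors. On the linear space of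
`G`-equivariant motions of a symmetric configuration the function `U + I` tends to infinity at
collisions and at infinity, so that it attains a minimum on each path component of the collision-free
motions (`exists_joinedIn_critical`). The gradient of `U + I` at an equivariant motion is itself an
equivariant motion; being orthogonal to all of them at the minimum, it vanishes there, and the
minimum is a central configuration. Its centre of mass is `0` because it is fixed by `G`. So every
symmetric configuration can be moved to a central one, equivariantly and without collisions
(`Configuration.IsSymmetric.exists_motion_isCentral`). Along such a motion the isotropy group of
each particle is constant, hence so is its topological orbit type. This gives central configurations
of each topological Burnside type (`exists_isCentral_of_burnsideType`); configurations of a given type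
exist because types are invariant under positive scaling, so that the orbits can be put on spheres of
different radii.

If the isotropy group of a particle fixes only the line through it, an equivariant motion moves the
particle on this line. It does not reach the origin, nor another particle moving on the same line,
which preserves the order of the radii of nested polyhedra (`exists_isCentral_nested`). For a single
orbit of this kind the gradient of `U` is automatically proportional to the position, so that the
orbit is central (`IsLinearOrbit.isCentral`). The polyhedra in question are orbits of this kind; for
the tetrahedron, the cube, the octahedron and the cuboctahedron this follows from the sign changes
and the permutations of the coordinates, and for the icosahedral group from one further reflection
(`icoReflection`).

The tetrahedral group acts on the four inner products of a point with the vertices by all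
permutations (`tetraEquiv`), so that orbit types correspond to the five patterns of equality of four
numbers, and are distinguished by the order of the isotropy group. A cubic invariant that does not
vanish on the orbit type of the tetrahedron tells its topological type from that of the dual.

If the isotropy group of `x` in the octahedral or the icosahedral group is generated by two
orthogonal reflections, then the negative of their product is the reflection with axis `x`, as `-1`
belongs to the group. The axis of a reflection is spanned by the difference between a vertex and its
image, which leaves only the axes through the vertices of the cuboctahedron, or of the
icosidodecahedron, and for the cube the coordinate axes, whose isotropy groups are larger.
-/

/-! ### The gradient of the potential and a criterion for centrality -/

/-- The gradient of the potential with respect to the position of the `i`-th particle.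
The summand with `j = i` vanishes. -/
noncomputable def potentialGrad {ι : Type} [Fintype ι] (m : ι → ℝ) (y : ι → E3) (i : ι) : E3 :=
  ∑ j, (m i * m j / ‖y j - y i‖ ^ 3) • (y j - y i)

lemma hasDerivAt_inv_norm {z : ℝ → E3} {z' : E3} {t : ℝ} (hz : HasDerivAt z z' t)
    (h0 : z t ≠ 0) :
    HasDerivAt (fun s => ‖z s‖⁻¹) (-(inner ℝ (z t) z' / ‖z t‖ ^ 3)) t := by
  have hn : ‖z t‖ ≠ 0 := norm_ne_zero_iff.2 h0
  have h1 : HasDerivAt (fun s => ‖z s‖ ^ 2) (2 * inner ℝ (z t) z') t := hz.norm_sq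
  have h2 := (h1.sqrt (by positivity)).inv (by rw [Real.sqrt_sq (norm_nonneg _)]; exact hn)
  have h3 : (fun s => ‖z s‖⁻¹) = (fun s => √(‖z s‖ ^ 2))⁻¹ := by
    funext s
    simp [Real.sqrt_sq (norm_nonneg _)]
  rw [h3]
  refine h2.congr_deriv ?_
  rw [Real.sqrt_sq (norm_nonneg _)]
  field_simp

lemma hasDerivAt_potential {ι : Type} [Fintype ι] (m : ι → ℝ) {γ : ℝ → ι → E3} {v : ι → E3}
    {t : ℝ} (hγ : HasDerivAt γ v t) (hinj : Function.Injective (γ t)) :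
    HasDerivAt (fun s => potential m (γ s))
      (∑ i, inner ℝ (potentialGrad m (γ t) i) (v i)) t := by
  classical
  have hγ' := hasDerivAt_pi.1 hγ
  have key : HasDerivAt (fun s => potential m (γ s))
      ((1 / 2) * ∑ p ∈ (Finset.univ : Finset ι).offDiag,
        m p.1 * m p.2 *
          (-(inner ℝ (γ t p.1 - γ t p.2) (v p.1 - v p.2) / ‖γ t p.1 - γ t p.2‖ ^ 3))) t := by
    unfold potential
    refine HasDerivAt.const_mul _ ?_
    have : ∀ p ∈ (Finset.univ : Finset ι).offDiag,
        HasDerivAt (fun s => m p.1 * m p.2 / ‖γ s p.1 - γ s p.2‖) (m p.1 * m p.2 *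
          (-(inner ℝ (γ t p.1 - γ t p.2) (v p.1 - v p.2) / ‖γ t p.1 - γ t p.2‖ ^ 3))) t := by
      intro p hp
      simp only [div_eq_mul_inv (m p.1 * m p.2)]
      refine HasDerivAt.const_mul _ (hasDerivAt_inv_norm ((hγ' _).sub (hγ' _)) ?_)
      rw [Finset.mem_offDiag] at hp
      exact sub_ne_zero.2 (hinj.ne hp.2.2)
    convert HasDerivAt.fun_sum this using 3
  convert key using 1
  set y := γ t
  have e1 : ∑ p ∈ (Finset.univ : Finset ι).offDiag, m p.1 * m p.2 *
        (-(inner ℝ (y p.1 - y p.2) (v p.1 - v p.2) / ‖y p.1 - y p.2‖ ^ 3))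
      = ∑ i, ∑ j, m i * m j * (-(inner ℝ (y i - y j) (v i - v j) / ‖y i - y j‖ ^ 3)) := by
    rw [← Finset.sum_product', ← Finset.diag_union_offDiag,
      Finset.sum_union (Finset.disjoint_diag_offDiag _)]
    rw [Finset.sum_eq_zero (s := Finset.diag _), zero_add]
    intro p hp
    rw [Finset.mem_diag] at hp
    simp [hp.2]
  have e2 : ∑ i, inner ℝ (potentialGrad m y i) (v i)
      = ∑ i, ∑ j, m i * m j / ‖y i - y j‖ ^ 3 * inner ℝ (y j - y i) (v i) := by
    refine Finset.sum_congr rfl fun i _ => ?_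
    rw [potentialGrad, sum_inner]
    refine Finset.sum_congr rfl fun j _ => ?_
    rw [real_inner_smul_left, norm_sub_rev]
  have e3 : ∑ i, ∑ j, m i * m j / ‖y i - y j‖ ^ 3 * inner ℝ (y j - y i) (v i)
      = ∑ i, ∑ j, m i * m j / ‖y i - y j‖ ^ 3 * inner ℝ (y i - y j) (v j) := by
    rw [Finset.sum_comm]
    refine Finset.sum_congr rfl fun i _ => Finset.sum_congr rfl fun j _ => ?_
    rw [norm_sub_rev, mul_comm (m j)]
  have e4 : (∑ i, ∑ j, m i * m j / ‖y i - y j‖ ^ 3 * inner ℝ (y j - y i) (v i))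
      + ∑ i, ∑ j, m i * m j / ‖y i - y j‖ ^ 3 * inner ℝ (y i - y j) (v j)
      = ∑ i, ∑ j, m i * m j * (-(inner ℝ (y i - y j) (v i - v j) / ‖y i - y j‖ ^ 3)) := by
    rw [← Finset.sum_add_distrib]
    refine Finset.sum_congr rfl fun i _ => ?_
    rw [← Finset.sum_add_distrib]
    refine Finset.sum_congr rfl fun j _ => ?_
    rw [← neg_sub (y i) (y j), inner_neg_left, inner_sub_right (y i - y j)]
    ring
  rw [e1, e2, ← e4, ← e3]
  ring

lemma hasDerivAt_inertia {ι : Type} [Fintype ι] (m : ι → ℝ) {γ : ℝ → ι → E3} {v : ι → E3}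
    {t : ℝ} (hγ : HasDerivAt γ v t) :
    HasDerivAt (fun s => inertia m (γ s)) (∑ i, inner ℝ ((2 * m i) • γ t i) (v i)) t := by
  have hγ' := hasDerivAt_pi.1 hγ
  unfold inertia
  have h1 : ∀ i ∈ (Finset.univ : Finset ι), HasDerivAt (fun s => m i * ‖γ s i‖ ^ 2)
      (m i * (2 * inner ℝ (γ t i) (v i))) t := fun i _ => ((hγ' i).norm_sq).const_mul (m i)
  refine (HasDerivAt.fun_sum h1).congr_deriv ?_
  refine Finset.sum_congr rfl fun i _ => ?_
  rw [real_inner_smul_left]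
  ring

/-- A configuration with centre of mass `0` is central if the gradient of the potential is
proportional to that of the moment of inertia. -/
lemma Configuration.isCentral_of_grad (C : Configuration)
    (h0 : ∑ x ∈ C.points, C.mass x • x = 0) (c : ℝ)
    (hc : ∀ x : C.points, potentialGrad (fun x : C.points => C.mass x) (fun x => (x : E3)) x
      = (c * C.mass x) • (x : E3)) : C.IsCentral := by
  refine ⟨h0, fun γ hγ hγ0 hI => ?_⟩
  have h1 := hasDerivAt_potential (fun x : C.points => C.mass x) hγ.hasDerivAt
    (by rw [hγ0]; exact Subtype.val_injective)
  have h2 := hasDerivAt_inertia (fun x : C.points => C.mass x) hγ.hasDerivAt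
  have h3 := (h2.congr_of_eventuallyEq (hI.mono fun t ht => ht.symm)).unique
    (hasDerivAt_const (0 : ℝ) _)
  convert h1 using 1
  simp only [hγ0] at h3 ⊢
  have h4 : ∑ x : C.points, inner ℝ (potentialGrad (fun x : C.points => C.mass x)
      (fun x => (x : E3)) x) (deriv γ 0 x)
      = (c / 2) * ∑ x : C.points, inner ℝ ((2 * C.mass x) • (x : E3)) (deriv γ 0 x) := by
    rw [Finset.mul_sum]
    refine Finset.sum_congr rfl fun x _ => ?_
    rw [hc, real_inner_smul_left, real_inner_smul_left]
    ring
  rw [h4, h3, mul_zero]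

/-! ### Minima of the potential plus the moment of inertia -/

lemma isOpen_setOf_injective {ι : Type} [Finite ι] :
    IsOpen {f : ι → E3 | Function.Injective f} := by
  have : {f : ι → E3 | Function.Injective f}
      = ⋂ i, ⋂ j, {f : ι → E3 | i ≠ j → f i ≠ f j} := by
    ext f
    simp only [Set.mem_ofPred_eq, Set.mem_iInter]
    exact ⟨fun h i j => h.ne, fun h i j hij => by_contra fun hne => h i j hne hij⟩
  rw [this]
  refine isOpen_iInter_of_finite fun i => isOpen_iInter_of_finite fun j => ?_
  by_cases hij : i = j
  · simp [hij]
  · simpa [hij] using isOpen_ne_fun (continuous_apply i) (continuous_apply j)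

/-- The function `U + I`, whose critical points are central configurations. -/
noncomputable def augmentedPotential {ι : Type} [Fintype ι] (m : ι → ℝ) (y : ι → E3) : ℝ :=
  potential m y + inertia m y

lemma continuousAt_augmentedPotential {ι : Type} [Fintype ι] (m : ι → ℝ) {y : ι → E3}
    (hy : Function.Injective y) : ContinuousAt (augmentedPotential m) y := by
  classical
  unfold augmentedPotential potential inertia
  refine ContinuousAt.add (ContinuousAt.mul continuousAt_const ?_)
    (tendsto_finsetSum _ fun i _ =>
      (continuous_const.mul ((continuous_apply i).norm.pow 2)).tendsto y)
  refine tendsto_finsetSum _ fun p hp => ?_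
  rw [Finset.mem_offDiag] at hp
  refine ContinuousAt.div continuousAt_const (by fun_prop) ?_
  exact norm_ne_zero_iff.2 (sub_ne_zero.2 (hy.ne hp.2.2))

lemma inertia_term_le {ι : Type} [Fintype ι] {m : ι → ℝ} (hm : ∀ i, 0 < m i) (y : ι → E3)
    (i : ι) : m i * ‖y i‖ ^ 2 ≤ augmentedPotential m y := by
  classical
  have h1 : 0 ≤ potential m y := by
    refine mul_nonneg (by norm_num) (Finset.sum_nonneg fun p _ => ?_)
    have := hm p.1
    have := hm p.2
    positivity
  have h2 : m i * ‖y i‖ ^ 2 ≤ inertia m y :=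
    Finset.single_le_sum (f := fun i => m i * ‖y i‖ ^ 2)
      (fun j _ => by have := hm j; positivity) (Finset.mem_univ i)
  unfold augmentedPotential
  linarith

/-- A bound on the potential keeps the particles apart. -/
lemma mul_le_augmentedPotential_mul_norm {ι : Type} [Fintype ι] {m : ι → ℝ} (hm : ∀ i, 0 < m i)
    {y : ι → E3} (hy : Function.Injective y) {i j : ι} (hij : i ≠ j) :
    m i * m j ≤ 2 * augmentedPotential m y * ‖y i - y j‖ := by
  classical
  have h0 : 0 < ‖y i - y j‖ := norm_pos_iff.2 (sub_ne_zero.2 (hy.ne hij))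
  have h1 : 0 ≤ inertia m y :=
    Finset.sum_nonneg fun j _ => by have := hm j; positivity
  have h2 : (1 / 2) * (m i * m j / ‖y i - y j‖) ≤ potential m y := by
    unfold potential
    refine mul_le_mul_of_nonneg_left ?_ (by norm_num)
    refine Finset.single_le_sum (f := fun p : ι × ι => m p.1 * m p.2 / ‖y p.1 - y p.2‖)
      (fun p _ => ?_) (a := (i, j)) (by simp [hij])
    have := hm p.1
    have := hm p.2
    positivity
  have h3 : m i * m j / ‖y i - y j‖ ≤ 2 * augmentedPotential m y := by
    unfold augmentedPotential
    linarith
  exact (div_le_iff₀ h0).1 h3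

/-- On each path component of the space of collision-free motions in a linear space `W` of motions,
the function `U + I` has a critical point: it tends to infinity at collisions and at infinity, so
it attains its minimum. -/
theorem exists_joinedIn_critical {ι : Type} [Fintype ι] {m : ι → ℝ} (hm : ∀ i, 0 < m i)
    (W : Submodule ℝ (ι → E3)) {f₀ : ι → E3} (hW : f₀ ∈ W) (hf₀ : Function.Injective f₀) :
    ∃ f, JoinedIn {f | f ∈ W ∧ Function.Injective f} f₀ f ∧
      ∀ w ∈ W, ∑ i, inner ℝ (potentialGrad m f i + (2 * m i) • f i) (w i) = 0 := by
  set S : Set (ι → E3) := {f | f ∈ W ∧ Function.Injective f} with hS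
  set h := augmentedPotential m with hh
  set c := h f₀ with hc
  set K : Set (ι → E3) := {f | JoinedIn S f₀ f ∧ h f ≤ c} with hK
  -- points of `W` close to an injective `f ∈ W` lie in the same path component of `S`
  have hloc : ∀ f ∈ S, ∃ ε > 0, ∀ g ∈ W, dist g f < ε → JoinedIn S f g := by
    intro f hf
    obtain ⟨ε, hε, hball⟩ := Metric.isOpen_iff.1 (isOpen_setOf_injective (ι := ι)) f hf.2
    refine ⟨ε, hε, fun g hg hgf => ?_⟩
    have hconv : Convex ℝ ((W : Set (ι → E3)) ∩ Metric.ball f ε) :=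
      W.convex.inter (convex_ball f ε)
    refine (JoinedIn.of_segment_subset (hconv.segment_subset ⟨hf.1, Metric.mem_ball_self hε⟩
      ⟨hg, hgf⟩)).mono ?_
    exact fun k hk => ⟨hk.1, hball hk.2⟩
  have hclosed : IsClosed K := by
    refine isClosed_of_closure_subset fun f hf => ?_
    have hfW : f ∈ W := by
      have : closure K ⊆ (W : Set (ι → E3)) :=
        closure_minimal (fun k hk => (hk.1.target_mem).1) W.closed_of_finiteDimensional
      exact this hf
    have hfinj : Function.Injective f := by
      intro i j hij
      by_contra hne
      have : closure K ⊆ {k : ι → E3 | m i * m j ≤ 2 * c * ‖k i - k j‖} := by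
        refine closure_minimal (fun k hk => ?_) (isClosed_le (by fun_prop) (by fun_prop))
        refine (mul_le_augmentedPotential_mul_norm hm hk.1.target_mem.2 hne).trans ?_
        have := hk.2
        gcongr
      have h1 := this hf
      simp only [Set.mem_ofPred_eq, hij, sub_self, norm_zero, mul_zero] at h1
      exact absurd (mul_pos (hm i) (hm j)) (not_lt.2 h1)
    obtain ⟨ε, hε, hj⟩ := hloc f ⟨hfW, hfinj⟩
    obtain ⟨k, hk, hkf⟩ := Metric.mem_closure_iff.1 hf ε hε
    refine ⟨hk.1.trans (hj k hk.1.target_mem.1 (by rwa [dist_comm])).symm, ?_⟩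
    have h1 := ((continuousAt_augmentedPotential m hfinj).continuousWithinAt
      (s := K)).mem_closure hf (t := Set.Iic c) (fun k hk => hk.2)
    rwa [isClosed_Iic.closure_eq] at h1
  have hcompact : IsCompact K := by
    refine IsCompact.of_isClosed_subset
      (isCompact_univ_pi fun i => isCompact_closedBall (0 : E3) (√(c / m i))) hclosed ?_
    intro k hk i _
    rw [mem_closedBall_zero_iff]
    refine Real.le_sqrt_of_sq_le ?_
    rw [le_div_iff₀ (hm i), mul_comm]
    exact (inertia_term_le hm k i).trans hk.2
  obtain ⟨f, hfK, hmin⟩ := hcompact.exists_isMinOn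
    ⟨f₀, JoinedIn.refl ⟨hW, hf₀⟩, le_rfl⟩
    (fun k hk => (continuousAt_augmentedPotential m hk.1.target_mem.2).continuousWithinAt)
  refine ⟨f, hfK.1, fun w hw => ?_⟩
  obtain ⟨ε, hε, hj⟩ := hloc f hfK.1.target_mem
  have hγ : HasDerivAt (fun t : ℝ => f + t • w) w 0 := by
    simpa using ((hasDerivAt_id (0 : ℝ)).smul_const w).const_add f
  have hd := (hasDerivAt_potential m hγ (by simpa using hfK.1.target_mem.2)).add
    (hasDerivAt_inertia m hγ)
  have hlm : IsLocalMin (fun t : ℝ => h (f + t • w)) 0 := by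
    have hev : ∀ᶠ t : ℝ in 𝓝 0, dist (f + t • w) f < ε := by
      have := hγ.continuousAt.eventually (Metric.ball_mem_nhds _ hε)
      simpa using this
    filter_upwards [hev] with t ht
    simp only [zero_smul, add_zero]
    have hjt := hfK.1.trans (hj _ (W.add_mem hfK.1.target_mem.1 (W.smul_mem t hw)) ht)
    by_cases hle : h (f + t • w) ≤ c
    · exact hmin ⟨hjt, hle⟩
    · exact hfK.2.trans (not_le.1 hle).le
  have := hlm.hasDerivAt_eq_zero hd
  simpa [inner_add_left, Finset.sum_add_distrib] using this

/-! ### Equivariant motions of a configuration -/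

namespace Configuration

/-- The configuration obtained by moving the particle `x` of `C` to `f x`. -/
noncomputable def move (C : Configuration) (f : C.points → E3) (hf : Function.Injective f) :
    Configuration where
  points := Finset.univ.map ⟨f, hf⟩
  mass := Function.extend f (fun x => C.mass x) 0
  mass_pos z hz := by
    obtain ⟨x, -, rfl⟩ := Finset.mem_map.1 hz
    exact (hf.extend_apply (fun x : C.points => C.mass x) 0 x).symm ▸ C.mass_pos x x.2
  mass_eq_zero z hz := by
    have h : ¬ ∃ x, f x = z := fun ⟨x, hx⟩ => hz (Finset.mem_map.2 ⟨x, by simp, hx⟩)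
    rw [Function.extend_apply' _ _ _ h]
    rfl

variable {C : Configuration} {f : C.points → E3} {G : Subgroup O3}

lemma coe_points_move (hf : Function.Injective f) :
    ((C.move f hf).points : Set E3) = Set.range f := by
  ext z
  simp [move]

lemma mass_move (hf : Function.Injective f) (x : C.points) :
    (C.move f hf).mass (f x) = C.mass x :=
  hf.extend_apply (fun x : C.points => C.mass x) 0 x

lemma move_val : C.move Subtype.val Subtype.val_injective = C := by
  have h1 : ((C.move Subtype.val Subtype.val_injective).points : Set E3) = C.points := by
    rw [coe_points_move]
    simp
  ext z
  · exact Set.ext_iff.1 h1 z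
  · by_cases hz : z ∈ C.points
    · exact mass_move Subtype.val_injective ⟨z, hz⟩
    · rw [C.mass_eq_zero z hz, mass_eq_zero]
      rwa [← Finset.mem_coe, h1]

lemma isCentral_move (hf : Function.Injective f) (h0 : ∑ x : C.points, C.mass x • f x = 0)
    (c : ℝ) (hc : ∀ x : C.points,
      potentialGrad (fun x : C.points => C.mass x) f x = (c * C.mass x) • f x) :
    (C.move f hf).IsCentral := by
  have hmem : ∀ x, f x ∈ (C.move f hf).points := fun x => by
    rw [← Finset.mem_coe, coe_points_move]
    exact ⟨x, rfl⟩
  let e : C.points ≃ (C.move f hf).points := Equiv.ofBijective (fun x => ⟨f x, hmem x⟩)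
    ⟨fun x y hxy => hf (Subtype.ext_iff.1 hxy), fun z => by
      have := z.2
      rw [← Finset.mem_coe, coe_points_move] at this
      obtain ⟨x, hx⟩ := this
      exact ⟨x, Subtype.ext hx⟩⟩
  refine isCentral_of_grad _ ?_ c fun z => ?_
  · rw [← h0, ← Finset.sum_coe_sort, ← e.sum_comp]
    refine Finset.sum_congr rfl fun x _ => ?_
    change (C.move f hf).mass (f x) • f x = _
    rw [mass_move]
  · obtain ⟨x, rfl⟩ := e.surjective z
    change _ = (c * (C.move f hf).mass (f x)) • f x
    rw [mass_move, ← hc x, potentialGrad, ← e.sum_comp, potentialGrad]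
    refine Finset.sum_congr rfl fun y _ => ?_
    change ((C.move f hf).mass (f x) * (C.move f hf).mass (f y) / ‖f y - f x‖ ^ 3)
      • (f y - f x) = _
    rw [mass_move, mass_move]

/-- The motion `f` of the particles of `C` commutes with the action of `G`. -/
def IsEquivariant (C : Configuration) (G : Subgroup O3) (f : C.points → E3) : Prop :=
  ∀ g ∈ G, ∀ x y : C.points, (y : E3) = g x → f y = g (f x)

lemma IsSymmetric.map_mem (hC : C.IsSymmetric G) {g : O3} (hg : g ∈ G) {x : E3}
    (hx : x ∈ C.points) : g x ∈ C.points := by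
  rw [← Finset.mem_coe, ← (hC g hg).1]
  exact ⟨x, hx, rfl⟩

/-- The permutation of the particles of a symmetric configuration induced by a symmetry. -/
noncomputable def IsSymmetric.perm (hC : C.IsSymmetric G) {g : O3} (hg : g ∈ G) :
    C.points ≃ C.points :=
  Equiv.ofBijective (fun x => ⟨g x, hC.map_mem hg x.2⟩)
    (Finite.injective_iff_bijective.1 fun _ _ hxy =>
      Subtype.ext (g.injective (Subtype.ext_iff.1 hxy)))

lemma IsSymmetric.coe_perm (hC : C.IsSymmetric G) {g : O3} (hg : g ∈ G) (x : C.points) :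
    (hC.perm hg x : E3) = g x := rfl

lemma isEquivariant_val : C.IsEquivariant G Subtype.val := fun _ _ _ _ h => h

lemma IsEquivariant.isSymmetric_move (hC : C.IsSymmetric G) (hf : C.IsEquivariant G f)
    (hinj : Function.Injective f) : (C.move f hinj).IsSymmetric G := by
  intro g hg
  have h1 : ∀ x, g (f x) = f (hC.perm hg x) := fun x => (hf g hg _ _ rfl).symm
  refine ⟨?_, fun z hz => ?_⟩
  · rw [coe_points_move]
    ext z
    constructor
    · rintro ⟨_, ⟨x, rfl⟩, rfl⟩
      exact ⟨_, (h1 x).symm⟩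
    · rintro ⟨x, rfl⟩
      refine ⟨_, ⟨(hC.perm hg).symm x, rfl⟩, ?_⟩
      simp [h1]
  · rw [← Finset.mem_coe, coe_points_move] at hz
    obtain ⟨x, rfl⟩ := hz
    rw [h1, mass_move, mass_move, hC.coe_perm hg, (hC g hg).2 x x.2]

/-- The gradient of the potential at an equivariant motion is equivariant. -/
lemma IsEquivariant.potentialGrad (hC : C.IsSymmetric G) (hf : C.IsEquivariant G f) :
    C.IsEquivariant G (potentialGrad (fun x : C.points => C.mass x) f) := by
  intro g hg x y hxy
  have hy : y = hC.perm hg x := Subtype.ext hxy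
  have hm : ∀ z, C.mass (hC.perm hg z) = C.mass z := fun z => (hC g hg).2 z z.2
  have h1 : ∀ z, f (hC.perm hg z) = g (f z) := fun z => hf g hg _ _ rfl
  subst hy
  rw [_root_.potentialGrad, ← (hC.perm hg).sum_comp, _root_.potentialGrad, map_sum]
  refine Finset.sum_congr rfl fun z _ => ?_
  simp only [hm, h1, ← map_sub, LinearIsometryEquiv.norm_map, map_smul]

lemma IsEquivariant.centerOfMass_eq_zero (hG : ∀ v : E3, (∀ g ∈ G, g v = v) → v = 0)
    (hC : C.IsSymmetric G) (hf : C.IsEquivariant G f) : ∑ x : C.points, C.mass x • f x = 0 := by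
  refine hG _ fun g hg => ?_
  rw [map_sum]
  conv_rhs => rw [← (hC.perm hg).sum_comp]
  refine Finset.sum_congr rfl fun x _ => ?_
  rw [map_smul, ← hf g hg x _ (hC.coe_perm hg x), hC.coe_perm hg, (hC g hg).2 x x.2]

/-- The linear space of equivariant motions. -/
def equivariantMotions (C : Configuration) (G : Subgroup O3) : Submodule ℝ (C.points → E3) where
  carrier := {f | C.IsEquivariant G f}
  zero_mem' g _ _ _ _ := by simp
  add_mem' hf hf' g hg x y h := by simp [hf g hg x y h, hf' g hg x y h]
  smul_mem' c f hf g hg x y h := by simp [hf g hg x y h]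

/-- A symmetric configuration can be moved equivariantly and without collisions to a central
one. A minimum of `U + I` on the equivariant motions is a critical point among all motions: the
gradient is itself an equivariant motion, so it vanishes as soon as it is orthogonal to all of
them. -/
theorem IsSymmetric.exists_motion_isCentral
    (hG : ∀ v : E3, (∀ g ∈ G, g v = v) → v = 0) (hC : C.IsSymmetric G) :
    ∃ (φ : unitInterval → C.points → E3) (hφ : ∀ t, Function.Injective (φ t)),
      Continuous φ ∧ (∀ t, C.IsEquivariant G (φ t)) ∧ φ 0 = Subtype.val ∧
      (C.move (φ 1) (hφ 1)).IsCentral := by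
  have hm : ∀ x : C.points, 0 < C.mass x := fun x => C.mass_pos x x.2
  obtain ⟨f, hf, hcrit⟩ := exists_joinedIn_critical hm (C.equivariantMotions G)
    (f₀ := Subtype.val) isEquivariant_val Subtype.val_injective
  have hfe : C.IsEquivariant G f := hf.target_mem.1
  obtain ⟨p, hp⟩ := hf
  refine ⟨p, fun t => (hp t).2, p.continuous, fun t => (hp t).1, p.source, ?_⟩
  have hval : (p : unitInterval → C.points → E3) 1 = f := p.target
  have hgrad : (fun x => _root_.potentialGrad (fun x : C.points => C.mass x) f x +
      (2 * C.mass x) • f x) ∈ C.equivariantMotions G := by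
    intro g hg x y hxy
    have h1 := (hfe.potentialGrad hC) g hg x y hxy
    have h2 := hfe g hg x y hxy
    have h3 : C.mass y = C.mass x := by rw [hxy, (hC g hg).2 x x.2]
    simp only [h1, h2, h3, map_add, map_smul]
  have hzero := hcrit _ hgrad
  refine isCentral_move _ ?_ (-2) fun x => ?_
  · rw [hval]
    exact hfe.centerOfMass_eq_zero hG hC
  · rw [hval]
    have h1 := (Finset.sum_eq_zero_iff_of_nonneg fun i _ => real_inner_self_nonneg).1 hzero x
      (Finset.mem_univ x)
    rw [inner_self_eq_zero] at h1
    rw [eq_neg_of_add_eq_zero_left h1, ← neg_smul, neg_mul]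

/-- A configuration consisting of a single orbit, of points whose isotropy group fixes only the
line through the point, is central. -/
theorem IsSymmetric.isCentral_of_orbit
    (hG : ∀ v : E3, (∀ g ∈ G, g v = v) → v = 0) (hC : C.IsSymmetric G) {p : E3}
    (hp : (C.points : Set E3) = MulAction.orbit G p)
    (hline : ∀ w : E3, (∀ g ∈ G, g p = p → g w = w) → ∃ c : ℝ, w = c • p) : C.IsCentral := by
  have hpC : p ∈ C.points := by
    rw [← Finset.mem_coe, hp]
    exact MulAction.mem_orbit_self p
  have hmass : ∀ x ∈ C.points, C.mass x = C.mass p := by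
    intro x hx
    rw [← Finset.mem_coe, hp] at hx
    obtain ⟨g, rfl⟩ := hx
    exact (hC g g.2).2 p hpC
  have hgrad := (isEquivariant_val (C := C) (G := G)).potentialGrad hC
  obtain ⟨c, hc⟩ := hline
    (potentialGrad (fun x : C.points => C.mass x) Subtype.val ⟨p, hpC⟩)
    (fun g hg hgp => (hgrad g hg ⟨p, hpC⟩ ⟨p, hpC⟩ hgp.symm).symm)
  refine isCentral_of_grad C ?_ (c / C.mass p) fun x => ?_
  · rw [← Finset.sum_coe_sort]
    exact isEquivariant_val.centerOfMass_eq_zero hG hC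
  · have hx := x.2
    rw [← Finset.mem_coe, hp] at hx
    obtain ⟨g, hgx⟩ := hx
    have hgx' : (x : E3) = (g : O3) p := hgx.symm
    rw [hgrad g g.2 ⟨p, hpC⟩ x hgx', hc, map_smul, ← hgx', hmass x x.2,
      div_mul_cancel₀ _ (C.mass_pos p hpC).ne']

end Configuration

/-! ### Orbit types -/

section OrbitTypes

variable {G : Subgroup O3}

lemma mem_stabilizer_iff_apply {x : E3} {g : G} :
    g ∈ MulAction.stabilizer G x ↔ (g : O3) x = x := Iff.rfl

lemma mem_orbit_iff_apply {x y : E3} :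
    y ∈ MulAction.orbit G x ↔ ∃ g ∈ G, g x = y :=
  ⟨fun ⟨g, hg⟩ => ⟨g, g.2, hg⟩, fun ⟨g, hg, h⟩ => ⟨⟨g, hg⟩, h⟩⟩

lemma norm_eq_of_mem_orbit {x y : E3} (h : y ∈ MulAction.orbit G x) : ‖y‖ = ‖x‖ := by
  obtain ⟨g, -, rfl⟩ := mem_orbit_iff_apply.1 h
  exact g.norm_map x

lemma orbit_smul (r : ℝ) (x : E3) : MulAction.orbit G (r • x) = r • MulAction.orbit G x := by
  ext y
  simp only [mem_orbit_iff_apply, Set.mem_smul_set, map_smul]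
  constructor
  · rintro ⟨g, hg, rfl⟩
    exact ⟨g x, ⟨g, hg, rfl⟩, rfl⟩
  · rintro ⟨_, ⟨g, hg, rfl⟩, rfl⟩
    exact ⟨g, hg, rfl⟩

lemma stabilizer_smul_eq {r : ℝ} (hr : r ≠ 0) (x : E3) :
    MulAction.stabilizer G (r • x) = MulAction.stabilizer G x := by
  ext g
  rw [mem_stabilizer_iff_apply, mem_stabilizer_iff_apply, map_smul]
  exact (smul_right_injective E3 hr).eq_iff

lemma orbitType_eq_of_stabilizer_eq {x y : E3}
    (h : MulAction.stabilizer G x = MulAction.stabilizer G y) : orbitType G x = orbitType G y := by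
  rw [orbitType, orbitType, h]

lemma stabilizer_mem_orbitType (x : E3) : MulAction.stabilizer G x ∈ orbitType G x :=
  ⟨1, by ext; simp⟩

lemma orbitType_eq_of_mem {x y : E3} (h : MulAction.stabilizer G x ∈ orbitType G y) :
    orbitType G x = orbitType G y := by
  obtain ⟨g, hg⟩ := h
  ext H
  simp only [orbitType, Set.mem_ofPred_eq]
  rw [hg]
  constructor
  · rintro ⟨k, rfl⟩
    refine ⟨k * g, ?_⟩
    rw [Subgroup.map_map]
    congr 1
  · rintro ⟨k, rfl⟩
    refine ⟨k * g⁻¹, ?_⟩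
    rw [Subgroup.map_map]
    congr 1
    ext u
    simp [mul_assoc]

lemma orbitType_eq_of_mem_orbit {x y : E3} (h : y ∈ MulAction.orbit G x) :
    orbitType G y = orbitType G x := by
  obtain ⟨g, rfl⟩ := h
  exact orbitType_eq_of_mem ⟨g, MulAction.stabilizer_smul_eq_stabilizer_map_conj g x⟩

lemma topOrbitType_eq_of_mem_orbit {x y : E3} (h : y ∈ MulAction.orbit G x) :
    topOrbitType G y = topOrbitType G x := by
  have h1 : orbitClass G y = orbitClass G x := Quotient.sound h
  rw [topOrbitType, topOrbitType, stratum, stratum, orbitType_eq_of_mem_orbit h, h1]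

lemma orbitClass_mem_stratum (x : E3) : orbitClass G x ∈ stratum G x := ⟨x, rfl, rfl⟩

lemma orbitClass_mem_topOrbitType (x : E3) : orbitClass G x ∈ topOrbitType G x :=
  mem_connectedComponentIn (orbitClass_mem_stratum x)

lemma continuous_orbitClass : Continuous (orbitClass G) := continuous_quotient_mk'

lemma orbitType_eq_of_orbitClass_mem_stratum {x y : E3} (h : orbitClass G x ∈ stratum G y) :
    orbitType G x = orbitType G y := by
  obtain ⟨z, hz, hzy⟩ := h
  have : z ∈ MulAction.orbit G x := Quotient.exact hz
  rw [← hzy, orbitType_eq_of_mem_orbit this]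

lemma orbitType_eq_of_topOrbitType_eq {x y : E3} (h : topOrbitType G x = topOrbitType G y) :
    orbitType G x = orbitType G y :=
  orbitType_eq_of_orbitClass_mem_stratum
    (connectedComponentIn_subset _ _ (h ▸ orbitClass_mem_topOrbitType x))

/-- Points joined by a path along which the isotropy group is constant have the same topological
orbit type. -/
lemma topOrbitType_eq_of_path {c : unitInterval → E3} (hc : Continuous c)
    (h : ∀ t, MulAction.stabilizer G (c t) = MulAction.stabilizer G (c 0)) (t : unitInterval) :
    topOrbitType G (c t) = topOrbitType G (c 0) := by
  have hs : stratum G (c t) = stratum G (c 0) := by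
    rw [stratum, stratum, orbitType_eq_of_stabilizer_eq (h t)]
  have hsub : Set.range (fun t => orbitClass G (c t)) ⊆ topOrbitType G (c 0) := by
    refine (isPreconnected_range (continuous_orbitClass.comp hc)).subset_connectedComponentIn
      ⟨0, rfl⟩ ?_
    rintro _ ⟨s, rfl⟩
    exact ⟨c s, rfl, orbitType_eq_of_stabilizer_eq (h s)⟩
  have := connectedComponentIn_eq (hsub ⟨t, rfl⟩)
  rw [topOrbitType, topOrbitType, hs, this]

lemma topOrbitType_smul {r : ℝ} (hr : 0 < r) (x : E3) :
    topOrbitType G (r • x) = topOrbitType G x := by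
  have hpos : ∀ t : unitInterval, 0 < 1 + (t : ℝ) * (r - 1) := fun t => by
    nlinarith [t.2.1, t.2.2, mul_nonneg t.2.1 hr.le]
  have := topOrbitType_eq_of_path (G := G)
    (c := fun t : unitInterval => (1 + (t : ℝ) * (r - 1)) • x) (by fun_prop)
    (fun t => by
      rw [stabilizer_smul_eq (hpos t).ne', stabilizer_smul_eq (hpos 0).ne']) 1
  simpa using this

/-- A continuous invariant function without zeros on the points of a given orbit type has constant
sign on each topological orbit type. -/
lemma pos_of_topOrbitType_eq {F : E3 → ℝ} (hF : Continuous F) (hinv : ∀ g ∈ G, ∀ x, F (g x) = F x)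
    {x y : E3} (hne : ∀ z, orbitType G z = orbitType G x → F z ≠ 0)
    (h : topOrbitType G x = topOrbitType G y) (hx : 0 < F x) : 0 < F y := by
  let Fq : OrbitSpace G → ℝ := Quotient.lift F (by
    rintro a b ⟨g, rfl⟩
    exact hinv g g.2 b)
  have hFq : Continuous Fq := hF.quotient_lift _
  have hpre : IsPreconnected (Fq '' topOrbitType G x) :=
    isPreconnected_connectedComponentIn.image _ hFq.continuousOn
  have hFx : F x ∈ Fq '' topOrbitType G x := ⟨_, orbitClass_mem_topOrbitType x, rfl⟩
  have hFy : F y ∈ Fq '' topOrbitType G x := ⟨_, h ▸ orbitClass_mem_topOrbitType y, rfl⟩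
  by_contra hy
  obtain ⟨q, hq, hq0⟩ := hpre.Icc_subset hFy hFx ⟨not_lt.1 hy, hx.le⟩
  obtain ⟨z, rfl, hz⟩ := connectedComponentIn_subset _ _ hq
  exact hne z hz hq0

end OrbitTypes

/-! ### Configurations with prescribed orbits -/

namespace Configuration

variable {C : Configuration} {f : C.points → E3} {G : Subgroup O3}

lemma IsEquivariant.stabilizer_eq (hC : C.IsSymmetric G) (hf : C.IsEquivariant G f)
    (hinj : Function.Injective f) (x : C.points) :
    MulAction.stabilizer G (f x) = MulAction.stabilizer G (x : E3) := by
  ext g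
  rw [mem_stabilizer_iff_apply, mem_stabilizer_iff_apply]
  rw [← hf g g.2 x _ (hC.coe_perm g.2 x), hinj.eq_iff, ← hC.coe_perm g.2 x, Subtype.ext_iff]

lemma IsEquivariant.orbit_eq (hC : C.IsSymmetric G) (hf : C.IsEquivariant G f) (x : C.points) :
    MulAction.orbit G (f x) = f '' {y | (y : E3) ∈ MulAction.orbit G (x : E3)} := by
  ext z
  simp only [mem_orbit_iff_apply, Set.mem_image, Set.mem_ofPred_eq]
  constructor
  · rintro ⟨g, hg, rfl⟩
    exact ⟨hC.perm hg x, ⟨g, hg, rfl⟩, hf g hg _ _ rfl⟩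
  · rintro ⟨y, ⟨g, hg, hy⟩, rfl⟩
    exact ⟨g, hg, (hf g hg x y hy.symm).symm⟩

lemma IsUnionOfOrbits.mem_points {T : Type} {n : T → ℕ}
    {p : ∀ t, Fin (n t) → E3}
    (h : (C.points : Set E3) = ⋃ t, ⋃ j, MulAction.orbit G (p t j)) (t : T) (j : Fin (n t)) :
    p t j ∈ C.points := by
  rw [← Finset.mem_coe, h]
  exact Set.mem_iUnion₂.2 ⟨t, j, MulAction.mem_orbit_self _⟩

lemma IsUnionOfOrbits.move {T : Type} {R : T → E3 → Prop} {n : T → ℕ}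
    {μ : ∀ t, Fin (n t) → ℝ} (h : C.IsUnionOfOrbits G R n μ) (hC : C.IsSymmetric G)
    (hf : C.IsEquivariant G f) (hinj : Function.Injective f)
    (hR : ∀ t (x : C.points), R t x → R t (f x)) :
    (C.move f hinj).IsUnionOfOrbits G R n μ := by
  obtain ⟨p, hpR, hdisj, hpts, hmass⟩ := h
  have hp := IsUnionOfOrbits.mem_points hpts
  refine ⟨fun t j => f ⟨p t j, hp t j⟩, fun t j => hR t ⟨_, hp t j⟩ (hpR t j), ?_, ?_, ?_⟩
  · intro t j s k hmem
    rw [hf.orbit_eq hC] at hmem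
    obtain ⟨y, hy, hyk⟩ := hmem
    rw [hinj hyk] at hy
    exact hdisj t j s k hy
  · rw [coe_points_move]
    ext z
    simp only [hf.orbit_eq hC, Set.mem_range, Set.mem_iUnion, Set.mem_image, Set.mem_ofPred_eq]
    constructor
    · rintro ⟨x, rfl⟩
      have hx := x.2
      rw [← Finset.mem_coe, hpts, Set.mem_iUnion₂] at hx
      obtain ⟨t, j, hx⟩ := hx
      exact ⟨t, j, x, hx, rfl⟩
    · rintro ⟨t, j, x, -, rfl⟩
      exact ⟨x, rfl⟩
  · intro t j y hy
    rw [hf.orbit_eq hC] at hy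
    obtain ⟨x, hx, rfl⟩ := hy
    rw [mass_move]
    exact hmass t j x hx

/-- A symmetric configuration can be joined to a central one through symmetric configurations with
orbits of the same kinds, for all notions of kind that depend on the isotropy group and on the
topological orbit type only. -/
theorem IsSymmetric.exists_joinedThrough_isCentral
    (hG : ∀ v : E3, (∀ g ∈ G, g v = v) → v = 0) (hC : C.IsSymmetric G)
    {T : Type} {R : T → E3 → Prop} {n : T → ℕ} {μ : ∀ t, Fin (n t) → ℝ}
    (h : C.IsUnionOfOrbits G R n μ)
    (hR : ∀ t x y, MulAction.stabilizer G x = MulAction.stabilizer G y →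
      topOrbitType G x = topOrbitType G y → R t x → R t y) :
    ∃ C' : Configuration, (C'.IsSymmetric G ∧ C'.IsUnionOfOrbits G R n μ) ∧ C'.IsCentral ∧
      JoinedThrough (fun D => D.IsSymmetric G ∧ D.IsUnionOfOrbits G R n μ) C C' := by
  obtain ⟨φ, hinj, hcont, hequiv, h0, hcentral⟩ := hC.exists_motion_isCentral hG
  have hP : ∀ t, (C.move (φ t) (hinj t)).IsSymmetric G ∧
      (C.move (φ t) (hinj t)).IsUnionOfOrbits G R n μ := by
    intro t
    refine ⟨(hequiv t).isSymmetric_move hC (hinj t), h.move hC (hequiv t) (hinj t) ?_⟩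
    intro k x hx
    have hstab := fun s => (hequiv s).stabilizer_eq hC (hinj s) x
    refine hR k x _ (hstab t).symm ?_ hx
    have h1 := topOrbitType_eq_of_path (c := fun s => φ s x) (by fun_prop)
      (fun s => (hstab s).trans (hstab 0).symm) t
    rw [h1, h0]
  refine ⟨_, hP 1, hcentral, fun t => C.move (φ t) (hinj t), φ, hcont, hinj,
    fun t => coe_points_move _, fun t x => mass_move _ x, hP, ?_, rfl⟩
  have : ∀ (g : C.points → E3) (hg : Function.Injective g), g = Subtype.val → C.move g hg = C := by
    rintro g hg rfl
    exact move_val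
  exact this _ _ h0

/-- There is a symmetric configuration consisting of any finite number of given orbits. -/
lemma exists_isSymmetric [Finite G] {J : Type} [Finite J] (p : J → E3) {m : J → ℝ}
    (hm : ∀ j, 0 < m j) (hdisj : ∀ i j, p j ∈ MulAction.orbit G (p i) → i = j) :
    ∃ C : Configuration, C.IsSymmetric G ∧
      (C.points : Set E3) = ⋃ j, MulAction.orbit G (p j) ∧
      ∀ j, ∀ y ∈ MulAction.orbit G (p j), C.mass y = m j := by
  classical
  have hfin : (⋃ j, MulAction.orbit G (p j)).Finite :=
    Set.finite_iUnion fun j => Set.finite_range _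
  have huniq : ∀ i j y, y ∈ MulAction.orbit G (p i) → y ∈ MulAction.orbit G (p j) → i = j := by
    intro i j y hi hj
    refine hdisj i j ?_
    rw [← MulAction.orbit_eq_iff.2 hi, MulAction.orbit_eq_iff.2 hj]
    exact MulAction.mem_orbit_self _
  let mass : E3 → ℝ := fun y => if h : ∃ j, y ∈ MulAction.orbit G (p j) then m h.choose else 0
  have hmass : ∀ j, ∀ y ∈ MulAction.orbit G (p j), mass y = m j := by
    intro j y hy
    have h : ∃ j, y ∈ MulAction.orbit G (p j) := ⟨j, hy⟩
    simp only [mass, dif_pos h]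
    rw [huniq _ _ _ h.choose_spec hy]
  have hmem : ∀ y, y ∈ hfin.toFinset ↔ ∃ j, y ∈ MulAction.orbit G (p j) := by simp
  refine ⟨⟨hfin.toFinset, mass, ?_, ?_⟩, ?_, by simp, hmass⟩
  · intro y hy
    obtain ⟨j, hj⟩ := (hmem y).1 hy
    rw [hmass j y hj]
    exact hm j
  · intro y hy
    exact dif_neg fun h => hy ((hmem y).2 h)
  · intro g hg
    have hg' : ∀ j y, g y ∈ MulAction.orbit G (p j) ↔ y ∈ MulAction.orbit G (p j) := fun j y => by
      rw [← MulAction.orbit_eq_iff, ← MulAction.orbit_eq_iff,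
        ← MulAction.orbit_smul (⟨g, hg⟩ : G) y]
      rfl
    refine ⟨?_, fun y hy => ?_⟩
    · ext y
      simp only [Set.mem_image, Set.Finite.coe_toFinset, Set.mem_iUnion]
      constructor
      · rintro ⟨x, ⟨j, hj⟩, rfl⟩
        exact ⟨j, (hg' j x).2 hj⟩
      · rintro ⟨j, hj⟩
        refine ⟨g.symm y, ⟨j, (hg' j _).1 ?_⟩, g.apply_symm_apply y⟩
        rwa [g.apply_symm_apply]
    · obtain ⟨j, hj⟩ := (hmem y).1 hy
      change mass (g y) = mass y
      rw [hmass j _ ((hg' j y).2 hj), hmass j y hj]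

/-- If every kind of orbit but one, that of the origin, is represented by a point of any given
norm, then any numbers of orbits of each kind can be realised, with at most one orbit of the kind
of the origin: the other orbits are put on spheres of different radii. -/
lemma exists_isUnionOfOrbits [Finite G] {T : Type} {R : T → E3 → Prop} {n : T → ℕ}
    [Finite (Σ t, Fin (n t))] {μ : ∀ t, Fin (n t) → ℝ} (hμ : ∀ t j, 0 < μ t j) {z : T}
    (hz : n z ≤ 1) (hRz : R z 0) (hR : ∀ t ≠ z, ∃ x ≠ 0, ∀ r : ℝ, 0 < r → R t (r • x)) :
    ∃ C : Configuration, C.IsSymmetric G ∧ C.IsUnionOfOrbits G R n μ := by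
  classical
  obtain ⟨N, ⟨e⟩⟩ := Finite.exists_equiv_fin (Σ t, Fin (n t))
  choose! x hx0 hx using hR
  -- the orbit with index `e ⟨t, j⟩` is put on the sphere of radius `e ⟨t, j⟩ + 1`
  let p : (Σ t, Fin (n t)) → E3 := fun a =>
    if a.1 = z then 0 else (((e a : ℕ) + 1 : ℝ) / ‖x a.1‖) • x a.1
  have hnorm : ∀ a, a.1 ≠ z → ‖p a‖ = (e a : ℕ) + 1 := by
    intro a ha
    have : ‖x a.1‖ ≠ 0 := norm_ne_zero_iff.2 (hx0 _ ha)
    simp only [p, if_neg ha, norm_smul, norm_div, norm_norm]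
    rw [div_mul_cancel₀ _ this, Real.norm_of_nonneg (by positivity)]
  have hnorm' : ∀ a, a.1 = z → ‖p a‖ = 0 := by
    intro a ha
    simp only [p, if_pos ha, norm_zero]
  have hinj : ∀ a b, ‖p a‖ = ‖p b‖ → a = b := by
    intro a b hab
    by_cases ha : a.1 = z <;> by_cases hb : b.1 = z
    · obtain ⟨t, j⟩ := a
      obtain ⟨s, k⟩ := b
      subst ha
      obtain rfl : s = t := hb
      have : j = k := Fin.ext (by have := j.2; have := k.2; dsimp only at *; omega)
      rw [this]
    · rw [hnorm' a ha, hnorm b hb] at hab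
      linarith [(Nat.cast_nonneg (e b : ℕ) : (0 : ℝ) ≤ _)]
    · rw [hnorm a ha, hnorm' b hb] at hab
      linarith [(Nat.cast_nonneg (e a : ℕ) : (0 : ℝ) ≤ _)]
    · rw [hnorm a ha, hnorm b hb] at hab
      have : (e a : ℕ) = e b := by exact_mod_cast add_right_cancel hab
      exact e.injective (Fin.ext this)
  obtain ⟨C, hC, hpts, hmass⟩ := exists_isSymmetric (G := G) p (m := fun a => μ a.1 a.2)
    (fun a => hμ _ _) (fun a b hab => (hinj _ _ (norm_eq_of_mem_orbit hab)).symm)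
  refine ⟨C, hC, fun t j => p ⟨t, j⟩, fun t j => ?_, fun t j s k hmem => ?_, ?_,
    fun t j => hmass ⟨t, j⟩⟩
  · by_cases ht : t = z
    · subst ht
      simpa [p] using hRz
    · simp only [p, if_neg ht]
      have := norm_pos_iff.2 (hx0 t ht)
      exact hx t ht _ (by positivity)
  · exact (hinj _ _ (norm_eq_of_mem_orbit hmem)).symm
  · rw [hpts, Set.iUnion_sigma]

end Configuration

/-- If no nonzero vector is fixed by the finite group `G`, every topological Burnside type is
realised, and each component of the space of configurations of that type contains a central
configuration. -/
theorem exists_isCentral_of_burnsideType {G : Subgroup O3} [Finite G]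
    (hG : ∀ v : E3, (∀ g ∈ G, g v = v) → v = 0) (Γ : TopOrbitType G →₀ ℕ)
    (μ : ∀ t, Fin (Γ t) → ℝ) (hΓ : Γ (TopOrbitType.mk G 0) ≤ 1) (hμ : ∀ t j, 0 < μ t j) :
    (∃ C : Configuration, C.HasBurnsideType G Γ μ ∧ C.IsCentral) ∧
      ∀ C₀ : Configuration, C₀.HasBurnsideType G Γ μ →
        ∃ C : Configuration, C.HasBurnsideType G Γ μ ∧ C.IsCentral ∧
          Configuration.JoinedThrough (fun D => D.HasBurnsideType G Γ μ) C₀ C := by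
  have hcomp : ∀ C₀ : Configuration, C₀.HasBurnsideType G Γ μ →
      ∃ C : Configuration, C.HasBurnsideType G Γ μ ∧ C.IsCentral ∧
        Configuration.JoinedThrough (fun D => D.HasBurnsideType G Γ μ) C₀ C := by
    intro C₀ hC₀
    refine hC₀.1.exists_joinedThrough_isCentral hG hC₀.2 ?_
    rintro t x y - htop rfl
    exact Subtype.ext htop.symm
  have : Finite (Σ t, Fin (Γ t)) := by
    refine Finite.of_injective (β := Σ t : Γ.support, Fin (Γ t))
      (fun a => ⟨⟨a.1, Finsupp.mem_support_iff.2 (Fin.pos a.2).ne'⟩, a.2⟩) ?_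
    rintro ⟨t, j⟩ ⟨s, k⟩ h
    simp only [Sigma.mk.injEq, Subtype.mk.injEq] at h
    obtain ⟨rfl, h⟩ := h
    simpa using h
  obtain ⟨C₀, hC₀⟩ : ∃ C : Configuration, C.HasBurnsideType G Γ μ := by
    refine Configuration.exists_isUnionOfOrbits (z := TopOrbitType.mk G 0) hμ hΓ rfl ?_
    rintro ⟨_, x, rfl⟩ hx
    refine ⟨x, ?_, fun r hr => Subtype.ext (topOrbitType_smul hr x)⟩
    rintro rfl
    exact hx rfl
  obtain ⟨C, hC, hCc, -⟩ := hcomp C₀ hC₀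
  exact ⟨⟨C, hC, hCc⟩, hcomp⟩

/-! ### Coordinates, sign changes and permutations of the coordinates -/

lemma E3.ext3 {x y : E3} (h0 : x 0 = y 0) (h1 : x 1 = y 1) (h2 : x 2 = y 2) : x = y := by
  ext i
  fin_cases i <;> assumption

lemma E3.inner_eq (x y : E3) : inner ℝ x y = x 0 * y 0 + x 1 * y 1 + x 2 * y 2 := by
  simp [PiLp.inner_apply, Fin.sum_univ_three, mul_comm]

lemma E3.norm_sq_eq (x : E3) : ‖x‖ ^ 2 = x 0 ^ 2 + x 1 ^ 2 + x 2 ^ 2 := by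
  rw [← real_inner_self_eq_norm_sq, E3.inner_eq]
  ring

lemma E3.dist_eq_iff {x y : E3} {ℓ : ℝ} (hℓ : 0 ≤ ℓ) :
    dist x y = ℓ ↔ (x 0 - y 0) ^ 2 + (x 1 - y 1) ^ 2 + (x 2 - y 2) ^ 2 = ℓ ^ 2 := by
  rw [dist_eq_norm, ← sq_eq_sq₀ (norm_nonneg _) hℓ, E3.norm_sq_eq]
  simp

lemma E3.midpoint_apply (x y : E3) (i : Fin 3) : midpoint ℝ x y i = (x i + y i) / 2 := by
  simp [midpoint_eq_smul_add]
  ring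

/-- The change of the signs of the coordinates with index in `{i | s i}`. -/
noncomputable def signIso (s : Fin 3 → Bool) : O3 :=
  LinearIsometryEquiv.piLpCongrRight 2
    fun i => if s i then LinearIsometryEquiv.neg ℝ else LinearIsometryEquiv.refl ℝ ℝ

@[simp]
lemma signIso_apply (s : Fin 3 → Bool) (x : E3) (i : Fin 3) :
    signIso s x i = if s i then -x i else x i := by
  by_cases h : s i <;> simp [signIso, h]

/-- The permutation of the coordinates by `e`. -/
noncomputable def permIso (e : Equiv.Perm (Fin 3)) : O3 :=
  LinearIsometryEquiv.piLpCongrLeft 2 ℝ ℝ e.symm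

@[simp]
lemma permIso_apply (e : Equiv.Perm (Fin 3)) (x : E3) (i : Fin 3) : permIso e x i = x (e i) := rfl

lemma exists_signIso {x y : E3} (h : ∀ i, |x i| = |y i|) : ∃ s, signIso s x = y := by
  refine ⟨fun i => decide (x i ≠ y i), ?_⟩
  ext i
  rw [signIso_apply]
  by_cases h0 : x i = y i
  · simp [h0]
  · rw [if_pos (by simpa using h0)]
    rcases abs_eq_abs.1 (h i) with h' | h'
    · exact absurd h' h0
    · rw [h', neg_neg]

lemma exists_signIso_of_abs {x : E3} {a b c : ℝ} (h0 : |x 0| = a) (h1 : |x 1| = b)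
    (h2 : |x 2| = c) : ∃ s, signIso s !₂[a, b, c] = x := by
  refine exists_signIso fun i => ?_
  fin_cases i
  · simpa using congrArg abs h0.symm
  · simpa using congrArg abs h1.symm
  · simpa using congrArg abs h2.symm

lemma reflection_orthogonal_singleton_apply (u x : E3) :
    (ℝ ∙ u)ᗮ.reflection x = x - (2 * inner ℝ u x / ‖u‖ ^ 2) • u := by
  rw [Submodule.reflection_orthogonal_apply, Submodule.reflection_singleton_apply]
  simp only [RCLike.ofReal_real_eq_id, id, neg_sub]
  rw [two_smul, ← add_smul]
  congr 2
  ring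

/-! ### Symmetry groups of finite sets of points -/

lemma mem_symmetryGroup_iff {P : Set E3} {g : O3} :
    g ∈ symmetryGroup P ↔ (fun x => g x) '' P = P := Iff.rfl

lemma apply_mem_of_mem_symmetryGroup {P : Set E3} {g : O3} (hg : g ∈ symmetryGroup P) {x : E3}
    (hx : x ∈ P) : g x ∈ P := by
  rw [← mem_symmetryGroup_iff.1 hg]
  exact ⟨x, hx, rfl⟩

lemma mem_symmetryGroup_of_mapsTo {P : Set E3} (hP : P.Finite) {g : O3}
    (h : ∀ x ∈ P, g x ∈ P) : g ∈ symmetryGroup P := by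
  refine mem_symmetryGroup_iff.2 (Set.eq_of_subset_of_ncard_le ?_ ?_ hP)
  · rintro _ ⟨x, hx, rfl⟩
    exact h x hx
  · rw [Set.ncard_image_of_injective _ g.injective]

/-- The symmetry group of a finite set is finite if twice each vector of the standard basis is a
sum of two points of the set. -/
lemma finite_symmetryGroup {P : Set E3} (hP : P.Finite)
    (h0 : ∃ x ∈ P, ∃ y ∈ P, x + y = !₂[2, 0, 0]) (h1 : ∃ x ∈ P, ∃ y ∈ P, x + y = !₂[0, 2, 0])
    (h2 : ∃ x ∈ P, ∃ y ∈ P, x + y = !₂[0, 0, 2]) : Finite (symmetryGroup P) := by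
  have : Finite P := hP
  refine Finite.of_injective (β := P → P)
    (fun g x => ⟨(g : O3) x, apply_mem_of_mem_symmetryGroup g.2 x.2⟩) fun g g' hgg' => ?_
  have hP' : ∀ x ∈ P, (g : O3) x = (g' : O3) x := fun x hx =>
    Subtype.ext_iff.1 (congrFun hgg' ⟨x, hx⟩)
  have hsum : ∀ z, (∃ x ∈ P, ∃ y ∈ P, x + y = z) → (g : O3) z = (g' : O3) z := by
    rintro _ ⟨x, hx, y, hy, rfl⟩
    rw [map_add, map_add, hP' x hx, hP' y hy]
  refine Subtype.ext (LinearIsometryEquiv.ext fun z => ?_)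
  have hz : z = (z 0 / 2) • !₂[2, 0, 0] + (z 1 / 2) • !₂[0, 2, 0] + (z 2 / 2) • !₂[0, 0, 2] := by
    apply E3.ext3 <;> simp
  rw [hz]
  simp only [map_add, map_smul, hsum _ h0, hsum _ h1, hsum _ h2]

lemma finite_of_abs_mem {P : Set E3} {S : Set ℝ} (hS : S.Finite)
    (h : ∀ x ∈ P, ∀ i, |x i| ∈ S) : P.Finite := by
  have hS' : {a : ℝ | |a| ∈ S}.Finite := by
    refine (hS.union (hS.image Neg.neg)).subset fun a ha => ?_
    rcases abs_choice a with h' | h'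
    · exact Or.inl (h' ▸ ha)
    · exact Or.inr ⟨_, ha, by rw [h', neg_neg]⟩
  refine Set.Finite.of_finite_image (f := fun x : E3 => fun i => x i)
    ((Set.Finite.pi' fun _ : Fin 3 => hS').subset ?_) ?_
  · rintro _ ⟨x, hx, rfl⟩ i
    exact h x hx i
  · intro x _ y _ hxy
    ext i
    exact congrFun hxy i

lemma apply_mem_edgeMidpoints {P : Set E3} {g : O3} (hg : g ∈ symmetryGroup P) {ℓ : ℝ} {z : E3}
    (hz : z ∈ edgeMidpoints P ℓ) : g z ∈ edgeMidpoints P ℓ := by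
  obtain ⟨x, hx, y, hy, hd, rfl⟩ := hz
  refine ⟨g x, apply_mem_of_mem_symmetryGroup hg hx, g y, apply_mem_of_mem_symmetryGroup hg hy,
    by rwa [g.dist_map], ?_⟩
  simp [midpoint_eq_smul_add]

/-- `P` is an orbit of `G`, and the vectors fixed by the isotropy group of a point `p` of `P` are
the multiples of `p`. -/
def IsLinearOrbit (G : Subgroup O3) (P : Set E3) : Prop :=
  ∃ p : E3, p ≠ 0 ∧ P = MulAction.orbit G p ∧
    ∀ w : E3, (∀ g ∈ G, g p = p → g w = w) → ∃ c : ℝ, w = c • p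

lemma IsLinearOrbit.smul {G : Subgroup O3} {P : Set E3} (h : IsLinearOrbit G P) {r : ℝ}
    (hr : r ≠ 0) : IsLinearOrbit G (r • P) := by
  obtain ⟨p, hp0, hp, hline⟩ := h
  refine ⟨r • p, smul_ne_zero hr hp0, by rw [orbit_smul, hp], fun w hw => ?_⟩
  obtain ⟨c, rfl⟩ := hline w fun g hg hgp => hw g hg (by rw [map_smul, hgp])
  exact ⟨c / r, by rw [smul_smul, div_mul_cancel₀ _ hr]⟩

lemma eq_orbit_of_forall {G : Subgroup O3} {P : Set E3} {p : E3} (hinv : ∀ g ∈ G, g p ∈ P)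
    (htrans : ∀ x ∈ P, ∃ g ∈ G, g p = x) : P = MulAction.orbit G p := by
  ext x
  rw [mem_orbit_iff_apply]
  refine ⟨htrans x, ?_⟩
  rintro ⟨g, hg, rfl⟩
  exact hinv g hg

/-- The half-turn about the `i`-th coordinate axis. -/
noncomputable def halfTurn (i : Fin 3) : O3 := signIso fun j => decide (j ≠ i)

lemma eq_zero_of_halfTurn {G : Subgroup O3} (hG : ∀ i, halfTurn i ∈ G) (v : E3)
    (hv : ∀ g ∈ G, g v = v) : v = 0 := by
  have h : ∀ i j, j ≠ i → v j = 0 := by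
    intro i j hij
    have := congrArg (fun x : E3 => x j) (hv _ (hG i))
    simp [halfTurn, hij] at this
    linarith
  exact E3.ext3 (h 1 0 (by decide)) (h 0 1 (by decide)) (h 0 2 (by decide))

/-! ### The tetrahedron and the octahedron -/

lemma finite_tetrahedron : tetrahedron.Finite :=
  finite_of_abs_mem (Set.finite_singleton 1) fun _ hx i => hx.1 i

lemma finite_cube : cube.Finite :=
  finite_of_abs_mem (Set.finite_singleton 1) fun _ hx i => hx i

instance finite_Td : Finite Td := by
  refine finite_symmetryGroup finite_tetrahedron
    ⟨!₂[1, 1, 1], ?_, !₂[1, -1, -1], ?_, ?_⟩ ⟨!₂[1, 1, 1], ?_, !₂[-1, 1, -1], ?_, ?_⟩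
    ⟨!₂[1, 1, 1], ?_, !₂[-1, -1, 1], ?_, ?_⟩
  all_goals first
    | (apply E3.ext3 <;> simp <;> norm_num)
    | exact ⟨fun i => by fin_cases i <;> simp, by simp⟩

instance finite_Oh : Finite Oh := by
  refine finite_symmetryGroup finite_cube
    ⟨!₂[1, 1, 1], ?_, !₂[1, -1, -1], ?_, ?_⟩ ⟨!₂[1, 1, 1], ?_, !₂[-1, 1, -1], ?_, ?_⟩
    ⟨!₂[1, 1, 1], ?_, !₂[-1, -1, 1], ?_, ?_⟩
  all_goals first
    | (apply E3.ext3 <;> simp <;> norm_num)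
    | exact fun i => by fin_cases i <;> simp

lemma signIso_mem_Oh (s : Fin 3 → Bool) : signIso s ∈ Oh := by
  refine mem_symmetryGroup_of_mapsTo finite_cube fun x hx i => ?_
  rw [signIso_apply, apply_ite abs, abs_neg, ite_self]
  exact hx i

lemma permIso_mem_Oh (e : Equiv.Perm (Fin 3)) : permIso e ∈ Oh := by
  refine mem_symmetryGroup_of_mapsTo finite_cube fun x hx i => ?_
  rw [permIso_apply]
  exact hx _

lemma permIso_mem_Td (e : Equiv.Perm (Fin 3)) : permIso e ∈ Td := by
  refine mem_symmetryGroup_of_mapsTo finite_tetrahedron fun x hx => ⟨fun i => ?_, ?_⟩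
  · rw [permIso_apply]
    exact hx.1 _
  · have h := hx.2
    rw [← Fin.prod_univ_three fun i => x i] at h
    rw [← Fin.prod_univ_three fun i => permIso e x i]
    simp only [permIso_apply]
    exact (Equiv.prod_comp e fun i => x i).trans h

lemma signIso_mem_Td {s : Fin 3 → Bool} (hs : xor (s 0) (xor (s 1) (s 2)) = false) :
    signIso s ∈ Td := by
  refine mem_symmetryGroup_of_mapsTo finite_tetrahedron fun x hx => ⟨fun i => ?_, ?_⟩
  · rw [signIso_apply, apply_ite abs, abs_neg, ite_self]
    exact hx.1 i
  · rw [← hx.2]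
    simp only [signIso_apply]
    cases h0 : s 0 <;> cases h1 : s 1 <;> cases h2 : s 2 <;> simp_all

lemma halfTurn_mem_Td (i : Fin 3) : halfTurn i ∈ Td :=
  signIso_mem_Td (by fin_cases i <;> decide)

lemma halfTurn_mem_Oh (i : Fin 3) : halfTurn i ∈ Oh := signIso_mem_Oh _

/-- The points fixed by the cyclic permutation of the coordinates. -/
lemma eq_smul_of_finRotate {w : E3} (h : permIso (finRotate 3) w = w) :
    w = w 0 • !₂[1, 1, 1] := by
  have h0 : w 1 = w 0 := by simpa using congrArg (fun x : E3 => x 0) h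
  have h1 : w 2 = w 1 := by simpa using congrArg (fun x : E3 => x 1) h
  apply E3.ext3 <;> simp [h0, h1]

lemma isLinearOrbit_tetrahedron : IsLinearOrbit Td tetrahedron := by
  have hmem : (!₂[1, 1, 1] : E3) ∈ tetrahedron :=
    ⟨fun i => by fin_cases i <;> simp, by simp⟩
  refine ⟨!₂[1, 1, 1], fun h => by simpa using congrArg (fun x : E3 => x 0) h,
    eq_orbit_of_forall (fun g hg => apply_mem_of_mem_symmetryGroup hg hmem) ?_, fun w hw => ?_⟩
  · intro x hx
    obtain ⟨s, hs⟩ := exists_signIso_of_abs (hx.1 0) (hx.1 1) (hx.1 2)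
    refine ⟨signIso s, signIso_mem_Td ?_, hs⟩
    have := hx.2
    rw [← hs] at this
    simp only [signIso_apply] at this
    cases h0 : s 0 <;> cases h1 : s 1 <;> cases h2 : s 2 <;>
      simp [h0, h1, h2] at this ⊢ <;> norm_num at this
  · exact ⟨_, eq_smul_of_finRotate (hw _ (permIso_mem_Td _) (by apply E3.ext3 <;> simp))⟩

lemma isLinearOrbit_cube : IsLinearOrbit Oh cube := by
  have hmem : (!₂[1, 1, 1] : E3) ∈ cube := fun i => by fin_cases i <;> simp
  refine ⟨!₂[1, 1, 1], fun h => by simpa using congrArg (fun x : E3 => x 0) h,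
    eq_orbit_of_forall (fun g hg => apply_mem_of_mem_symmetryGroup hg hmem) ?_, fun w hw => ?_⟩
  · intro x hx
    obtain ⟨s, hs⟩ := exists_signIso_of_abs (hx 0) (hx 1) (hx 2)
    exact ⟨signIso s, signIso_mem_Oh s, hs⟩
  · exact ⟨_, eq_smul_of_finRotate (hw _ (permIso_mem_Oh _) (by apply E3.ext3 <;> simp))⟩

lemma dualTetrahedron_eq : dualTetrahedron = (-1 : ℝ) • tetrahedron := by
  ext x
  rw [Set.mem_smul_set_iff_inv_smul_mem₀ (by norm_num)]
  simp only [dualTetrahedron, tetrahedron, Set.mem_ofPred_eq, PiLp.smul_apply]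
  norm_num
  intro _
  constructor <;> intro h <;> linarith

lemma isLinearOrbit_dualTetrahedron : IsLinearOrbit Td dualTetrahedron := by
  rw [dualTetrahedron_eq]
  exact isLinearOrbit_tetrahedron.smul (by norm_num)

lemma mem_octahedron_iff {x : E3} : x ∈ octahedron ↔
    (|x 0| = 1 ∧ x 1 = 0 ∧ x 2 = 0) ∨ (|x 1| = 1 ∧ x 2 = 0 ∧ x 0 = 0) ∨
      (|x 2| = 1 ∧ x 0 = 0 ∧ x 1 = 0) := by
  simp only [octahedron, Set.mem_ofPred_eq]
  constructor
  · rintro ⟨i, hi, h⟩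
    fin_cases i
    · exact Or.inl ⟨hi, h 1 (by decide), h 2 (by decide)⟩
    · exact Or.inr (Or.inl ⟨hi, h 2 (by decide), h 0 (by decide)⟩)
    · exact Or.inr (Or.inr ⟨hi, h 0 (by decide), h 1 (by decide)⟩)
  · rintro (⟨h, h1, h2⟩ | ⟨h, h1, h2⟩ | ⟨h, h1, h2⟩)
    · exact ⟨0, h, fun j hj => by fin_cases j <;> simp_all⟩
    · exact ⟨1, h, fun j hj => by fin_cases j <;> simp_all⟩
    · exact ⟨2, h, fun j hj => by fin_cases j <;> simp_all⟩

/-- The coordinates of two vertices of the cube agree up to sign. -/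
lemma eq_or_eq_neg_of_mem_cube {x y : E3} (hx : x ∈ cube) (hy : y ∈ cube) (i : Fin 3) :
    x i = y i ∨ (x i = -y i ∧ (x i - y i) ^ 2 = 4) := by
  have hx' : x i ^ 2 = 1 := by rw [← sq_abs, hx i, one_pow]
  rcases abs_eq_abs.1 ((hx i).trans (hy i).symm) with h | h
  · exact Or.inl h
  · refine Or.inr ⟨h, ?_⟩
    have : y i = -x i := by linarith
    rw [this]
    linarith

lemma midpoint_mem_octahedron {x y : E3} (hx : x ∈ cube) (hy : y ∈ cube)
    (h : dist x y = 2 * √2) : midpoint ℝ x y ∈ octahedron := by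
  rw [E3.dist_eq_iff (by positivity), mul_pow, Real.sq_sqrt (by norm_num)] at h
  rw [mem_octahedron_iff]
  simp only [E3.midpoint_apply]
  rcases eq_or_eq_neg_of_mem_cube hx hy 0 with h0 | ⟨h0, h0'⟩ <;>
  rcases eq_or_eq_neg_of_mem_cube hx hy 1 with h1 | ⟨h1, h1'⟩ <;>
  rcases eq_or_eq_neg_of_mem_cube hx hy 2 with h2 | ⟨h2, h2'⟩
  · norm_num [h0, h1, h2] at h
  · norm_num [h0, h1, h2'] at h
  · norm_num [h0, h1', h2] at h
  · left; simpa [h0, h1, h2] using hy 0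
  · norm_num [h0', h1, h2] at h
  · right; left; simpa [h0, h1, h2] using hy 1
  · right; right; simpa [h0, h1, h2] using hy 2
  · norm_num [h0', h1', h2'] at h

lemma octahedron_subset_edgeMidpoints :
    octahedron ⊆ edgeMidpoints tetrahedron (2 * √2) := by
  intro z hz
  have key : ∀ a b c : Fin 3, (∀ f : Fin 3 → ℝ, f 0 * f 1 * f 2 = f a * f b * f c) →
      (∀ i, i = a ∨ i = b ∨ i = c) → a ≠ b → a ≠ c → b ≠ c → |z a| = 1 → z b = 0 → z c = 0 →
      z ∈ edgeMidpoints tetrahedron (2 * √2) := by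
    intro a b c habc hall hab hac hbc ha hb hc
    have haa : z a * z a = 1 := by rw [← abs_mul_abs_self, ha, one_mul]
    -- the edge with midpoint `z` joins the vertices with coordinates `(z a, ±1, ± z a)`
    let x : ℝ → E3 := fun t => WithLp.toLp 2 fun i => if i = a then z a else if i = b then t
      else t * z a
    have hxa : ∀ t, x t a = z a := fun t => by simp [x]
    have hxb : ∀ t, x t b = t := fun t => by simp [x, hab.symm]
    have hxc : ∀ t, x t c = t * z a := fun t => by simp [x, hac.symm, hbc.symm]
    have hx : ∀ t, |t| = 1 → x t ∈ tetrahedron := by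
      intro t ht
      refine ⟨fun i => ?_, ?_⟩
      · rcases hall i with rfl | rfl | rfl
        · rw [hxa, ha]
        · rw [hxb, ht]
        · rw [hxc, abs_mul, ha, ht, one_mul]
      · have htt : t * t = 1 := by rw [← abs_mul_abs_self, ht, one_mul]
        rw [habc fun i => x t i, hxa, hxb, hxc]
        linear_combination t * t * haa + htt
    refine ⟨x 1, hx 1 (by simp), x (-1), hx (-1) (by simp), ?_, ?_⟩
    · rw [E3.dist_eq_iff (by positivity), mul_pow, Real.sq_sqrt (by norm_num)]
      have hsum : ∀ f : Fin 3 → ℝ, f 0 + f 1 + f 2 = f a + f b + f c := by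
        intro f
        fin_cases a <;> fin_cases b <;> simp at hab <;> fin_cases c <;> simp at hac hbc <;>
          simp <;> ring
      rw [hsum fun i => (x 1 i - x (-1) i) ^ 2, hxa, hxa, hxb, hxb, hxc, hxc]
      linear_combination 4 * haa
    · ext i
      rw [E3.midpoint_apply]
      rcases hall i with rfl | rfl | rfl
      · rw [hxa, hxa]
        ring
      · rw [hxb, hxb, hb]
        ring
      · rw [hxc, hxc, hc]
        ring
  rcases mem_octahedron_iff.1 hz with ⟨h, h1, h2⟩ | ⟨h, h1, h2⟩ | ⟨h, h1, h2⟩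
  · exact key 0 1 2 (fun f => by ring) (by decide) (by decide) (by decide) (by decide) h h1 h2
  · exact key 1 2 0 (fun f => by ring) (by decide) (by decide) (by decide) (by decide) h h1 h2
  · exact key 2 0 1 (fun f => by ring) (by decide) (by decide) (by decide) (by decide) h h1 h2

lemma edgeMidpoints_tetrahedron : edgeMidpoints tetrahedron (2 * √2) = octahedron := by
  refine subset_antisymm ?_ octahedron_subset_edgeMidpoints
  rintro _ ⟨x, hx, y, hy, h, rfl⟩
  exact midpoint_mem_octahedron hx.1 hy.1 h

/-- The octahedron is also formed by the centres of the faces of the cube, which are the midpoints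
of their diagonals. -/
lemma edgeMidpoints_cube_diagonals : edgeMidpoints cube (2 * √2) = octahedron := by
  refine subset_antisymm ?_ (octahedron_subset_edgeMidpoints.trans ?_)
  · rintro _ ⟨x, hx, y, hy, h, rfl⟩
    exact midpoint_mem_octahedron hx hy h
  · rintro _ ⟨x, hx, y, hy, h, rfl⟩
    exact ⟨x, hx.1, y, hy.1, h, rfl⟩

lemma isLinearOrbit_octahedron {G : Subgroup O3} (h1 : ∀ i, halfTurn i ∈ G)
    (h2 : ∀ e, permIso e ∈ G) (h3 : ∀ g ∈ G, ∀ x ∈ octahedron, g x ∈ octahedron) :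
    IsLinearOrbit G octahedron := by
  have hmem : (!₂[1, 0, 0] : E3) ∈ octahedron := mem_octahedron_iff.2 (by simp)
  refine ⟨!₂[1, 0, 0], fun h => by simpa using congrArg (fun x : E3 => x 0) h,
    eq_orbit_of_forall (fun g hg => h3 g hg _ hmem) ?_, fun w hw => ?_⟩
  · intro x hx
    rcases mem_octahedron_iff.1 hx with ⟨h, h', h''⟩ | ⟨h, h', h''⟩ | ⟨h, h', h''⟩
    · rcases eq_or_eq_neg_of_abs_eq h with h | h
      · exact ⟨1, G.one_mem, by apply E3.ext3 <;> simp [h, h', h'']⟩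
      · exact ⟨halfTurn 1, h1 1, by apply E3.ext3 <;> simp [h, h', h'', halfTurn]⟩
    · rcases eq_or_eq_neg_of_abs_eq h with h | h
      · exact ⟨permIso (Equiv.swap 0 1), h2 _, by apply E3.ext3 <;> simp [h, h', h'']; rfl⟩
      · exact ⟨halfTurn 0 * permIso (Equiv.swap 0 1), G.mul_mem (h1 _) (h2 _), by
          apply E3.ext3 <;> simp [h, h', h'', halfTurn]; rfl⟩
    · rcases eq_or_eq_neg_of_abs_eq h with h | h
      · exact ⟨permIso (Equiv.swap 0 2), h2 _, by apply E3.ext3 <;> simp [h, h', h'']; rfl⟩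
      · exact ⟨halfTurn 0 * permIso (Equiv.swap 0 2), G.mul_mem (h1 _) (h2 _), by
          apply E3.ext3 <;> simp [h, h', h'', halfTurn]; rfl⟩
  · have h := hw _ (h1 0) (by apply E3.ext3 <;> simp [halfTurn])
    have hw1 := congrArg (fun x : E3 => x 1) h
    have hw2 := congrArg (fun x : E3 => x 2) h
    simp [halfTurn] at hw1 hw2
    refine ⟨w 0, ?_⟩
    apply E3.ext3 <;> simp <;> linarith

lemma isLinearOrbit_octahedron_Td : IsLinearOrbit Td octahedron := by
  refine isLinearOrbit_octahedron halfTurn_mem_Td permIso_mem_Td fun g hg x hx => ?_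
  rw [← edgeMidpoints_tetrahedron] at hx ⊢
  exact apply_mem_edgeMidpoints hg hx

lemma isLinearOrbit_octahedron_Oh : IsLinearOrbit Oh octahedron := by
  refine isLinearOrbit_octahedron halfTurn_mem_Oh permIso_mem_Oh fun g hg x hx => ?_
  rw [← edgeMidpoints_cube_diagonals] at hx ⊢
  exact apply_mem_edgeMidpoints hg hx

/-! ### The cuboctahedron -/

lemma mem_cuboctahedron_iff {x : E3} : x ∈ cuboctahedron ↔
    (x 0 = 0 ∧ |x 1| = 1 ∧ |x 2| = 1) ∨ (x 1 = 0 ∧ |x 2| = 1 ∧ |x 0| = 1) ∨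
      (x 2 = 0 ∧ |x 0| = 1 ∧ |x 1| = 1) := by
  constructor
  · rintro ⟨x, hx, y, hy, h, rfl⟩
    rw [E3.dist_eq_iff (by norm_num)] at h
    simp only [E3.midpoint_apply]
    rcases eq_or_eq_neg_of_mem_cube hx hy 0 with h0 | ⟨h0, h0'⟩ <;>
    rcases eq_or_eq_neg_of_mem_cube hx hy 1 with h1 | ⟨h1, h1'⟩ <;>
    rcases eq_or_eq_neg_of_mem_cube hx hy 2 with h2 | ⟨h2, h2'⟩
    · norm_num [h0, h1, h2] at h
    · right; right; simpa [h0, h1, h2] using ⟨hy 0, hy 1⟩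
    · right; left; simpa [h0, h1, h2] using ⟨hy 2, hy 0⟩
    · norm_num [h0, h1', h2'] at h
    · left; simpa [h0, h1, h2] using ⟨hy 1, hy 2⟩
    · norm_num [h0', h1, h2'] at h
    · norm_num [h0', h1', h2] at h
    · norm_num [h0', h1', h2'] at h
  · rintro (⟨h, h1, h2⟩ | ⟨h, h1, h2⟩ | ⟨h, h1, h2⟩)
    · refine ⟨!₂[1, x 1, x 2], fun i => ?_, !₂[-1, x 1, x 2], fun i => ?_, ?_, ?_⟩
      · fin_cases i <;> simp [h1, h2]
      · fin_cases i <;> simp [h1, h2]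
      · rw [E3.dist_eq_iff (by norm_num)]
        simp
        norm_num
      · apply E3.ext3 <;> simp [E3.midpoint_apply, h]
    · refine ⟨!₂[x 0, 1, x 2], fun i => ?_, !₂[x 0, -1, x 2], fun i => ?_, ?_, ?_⟩
      · fin_cases i <;> simp [h1, h2]
      · fin_cases i <;> simp [h1, h2]
      · rw [E3.dist_eq_iff (by norm_num)]
        simp
        norm_num
      · apply E3.ext3 <;> simp [E3.midpoint_apply, h]
    · refine ⟨!₂[x 0, x 1, 1], fun i => ?_, !₂[x 0, x 1, -1], fun i => ?_, ?_, ?_⟩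
      · fin_cases i <;> simp [h1, h2]
      · fin_cases i <;> simp [h1, h2]
      · rw [E3.dist_eq_iff (by norm_num)]
        simp
        norm_num
      · apply E3.ext3 <;> simp [E3.midpoint_apply, h]

lemma cuboctahedron_eq_orbit : cuboctahedron = MulAction.orbit Oh (!₂[0, 1, 1] : E3) := by
  have hmem : (!₂[0, 1, 1] : E3) ∈ cuboctahedron := mem_cuboctahedron_iff.2 (by simp)
  refine eq_orbit_of_forall (fun g hg => apply_mem_edgeMidpoints hg hmem) fun x hx => ?_
  rcases mem_cuboctahedron_iff.1 hx with ⟨h, h1, h2⟩ | ⟨h, h1, h2⟩ | ⟨h, h1, h2⟩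
  · obtain ⟨s, hs⟩ := exists_signIso_of_abs (abs_eq_zero.2 h) h1 h2
    exact ⟨_, signIso_mem_Oh s, hs⟩
  · obtain ⟨s, hs⟩ := exists_signIso_of_abs h2 (abs_eq_zero.2 h) h1
    refine ⟨_, Oh.mul_mem (signIso_mem_Oh s) (permIso_mem_Oh (Equiv.swap 0 1)), ?_⟩
    rw [← hs]
    change signIso s (permIso (Equiv.swap 0 1) _) = _
    congr 1
    apply E3.ext3 <;> simp; rfl
  · obtain ⟨s, hs⟩ := exists_signIso_of_abs h1 h2 (abs_eq_zero.2 h)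
    refine ⟨_, Oh.mul_mem (signIso_mem_Oh s) (permIso_mem_Oh (Equiv.swap 0 2)), ?_⟩
    rw [← hs]
    change signIso s (permIso (Equiv.swap 0 2) _) = _
    congr 1
    apply E3.ext3 <;> simp; rfl

lemma isLinearOrbit_cuboctahedron : IsLinearOrbit Oh cuboctahedron := by
  refine ⟨!₂[0, 1, 1], fun h => by simpa using congrArg (fun x : E3 => x 1) h,
    cuboctahedron_eq_orbit, fun w hw => ?_⟩
  have h1 := hw (permIso (Equiv.swap 1 2)) (permIso_mem_Oh _)
    (by apply E3.ext3 <;> simp; rfl)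
  have h2 := hw (signIso fun i => decide (i = 0)) (signIso_mem_Oh _)
    (by apply E3.ext3 <;> simp)
  have e1 := congrArg (fun x : E3 => x 1) h1
  have e2 := congrArg (fun x : E3 => x 0) h2
  simp at e1 e2
  refine ⟨w 1, ?_⟩
  apply E3.ext3 <;> simp <;> linarith

/-! ### The icosahedron and its dual -/

local notation "φ" => Real.goldenRatio

lemma mem_icosahedron_iff {x : E3} : x ∈ icosahedron ↔
    (x 0 = 0 ∧ |x 1| = 1 ∧ |x 2| = φ) ∨ (x 1 = 0 ∧ |x 2| = 1 ∧ |x 0| = φ) ∨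
      (x 2 = 0 ∧ |x 0| = 1 ∧ |x 1| = φ) := by
  simp only [icosahedron, Set.mem_ofPred_eq]
  constructor
  · rintro ⟨k, h⟩
    fin_cases k
    exacts [Or.inl h, Or.inr (Or.inl h), Or.inr (Or.inr h)]
  · rintro (h | h | h)
    exacts [⟨0, h⟩, ⟨1, h⟩, ⟨2, h⟩]

lemma mem_dodecahedron_iff {x : E3} : x ∈ dodecahedron ↔
    (|x 0| = 1 ∧ |x 1| = 1 ∧ |x 2| = 1) ∨
    (x 0 = 0 ∧ |x 1| = φ ∧ |x 2| = φ⁻¹) ∨ (x 1 = 0 ∧ |x 2| = φ ∧ |x 0| = φ⁻¹) ∨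
      (x 2 = 0 ∧ |x 0| = φ ∧ |x 1| = φ⁻¹) := by
  simp only [dodecahedron, Set.mem_ofPred_eq]
  constructor
  · rintro (h | ⟨k, h⟩)
    · exact Or.inl ⟨h 0, h 1, h 2⟩
    · fin_cases k
      exacts [Or.inr (Or.inl h), Or.inr (Or.inr (Or.inl h)), Or.inr (Or.inr (Or.inr h))]
  · rintro (⟨h0, h1, h2⟩ | h | h | h)
    · exact Or.inl fun i => by fin_cases i <;> assumption
    exacts [Or.inr ⟨0, h⟩, Or.inr ⟨1, h⟩, Or.inr ⟨2, h⟩]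

lemma finite_icosahedron : icosahedron.Finite := by
  refine finite_of_abs_mem (S := {0, 1, φ}) (Set.toFinite _) fun x hx i => ?_
  rcases mem_icosahedron_iff.1 hx with ⟨h, h1, h2⟩ | ⟨h, h1, h2⟩ | ⟨h, h1, h2⟩ <;>
    fin_cases i <;> simp [h, h1, h2]

lemma finite_dodecahedron : dodecahedron.Finite := by
  refine finite_of_abs_mem (S := {0, 1, φ, φ⁻¹}) (Set.toFinite _) fun x hx i => ?_
  rcases mem_dodecahedron_iff.1 hx with
    ⟨h, h1, h2⟩ | ⟨h, h1, h2⟩ | ⟨h, h1, h2⟩ | ⟨h, h1, h2⟩ <;>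
    fin_cases i <;> simp [h, h1, h2]

lemma abs_signIso_apply (s : Fin 3 → Bool) (x : E3) (i : Fin 3) :
    |signIso s x i| = |x i| := by
  rw [signIso_apply, apply_ite abs, abs_neg, ite_self]

lemma signIso_apply_eq_zero {s : Fin 3 → Bool} {x : E3} {i : Fin 3} :
    signIso s x i = 0 ↔ x i = 0 := by
  rw [← abs_eq_zero, abs_signIso_apply, abs_eq_zero]

lemma cyc_apply_zero (x : E3) : permIso (finRotate 3) x 0 = x 1 := rfl

lemma cyc_apply_one (x : E3) : permIso (finRotate 3) x 1 = x 2 := rfl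

lemma cyc_apply_two (x : E3) : permIso (finRotate 3) x 2 = x 0 := rfl

lemma signIso_mem_Ih (s : Fin 3 → Bool) : signIso s ∈ Ih := by
  refine mem_symmetryGroup_of_mapsTo finite_icosahedron fun x hx => ?_
  simpa only [mem_icosahedron_iff, abs_signIso_apply, signIso_apply_eq_zero] using hx

lemma signIso_mem_dodecahedron (s : Fin 3 → Bool) : signIso s ∈ symmetryGroup dodecahedron := by
  refine mem_symmetryGroup_of_mapsTo finite_dodecahedron fun x hx => ?_
  simpa only [mem_dodecahedron_iff, abs_signIso_apply, signIso_apply_eq_zero] using hx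

lemma cyc_mem_Ih : permIso (finRotate 3) ∈ Ih := by
  refine mem_symmetryGroup_of_mapsTo finite_icosahedron fun x hx => ?_
  rw [mem_icosahedron_iff] at hx ⊢
  rw [cyc_apply_zero, cyc_apply_one, cyc_apply_two]
  tauto

lemma cyc_mem_dodecahedron : permIso (finRotate 3) ∈ symmetryGroup dodecahedron := by
  refine mem_symmetryGroup_of_mapsTo finite_dodecahedron fun x hx => ?_
  rw [mem_dodecahedron_iff] at hx ⊢
  rw [cyc_apply_zero, cyc_apply_one, cyc_apply_two]
  tauto

/-- Up to sign changes, the coordinates of `x` are a cyclic permutation of `a, b, c`. -/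
def IsCyclicAbs (x : E3) (a b c : ℝ) : Prop :=
  (|x 0| = a ∧ |x 1| = b ∧ |x 2| = c) ∨ (|x 1| = a ∧ |x 2| = b ∧ |x 0| = c) ∨
    (|x 2| = a ∧ |x 0| = b ∧ |x 1| = c)

/-- Orbits of a group that contains the sign changes and the cyclic permutations. -/
lemma IsCyclicAbs.exists_apply_eq {G : Subgroup O3} (hs : ∀ s, signIso s ∈ G)
    (hc : permIso (finRotate 3) ∈ G) {x : E3} {a b c : ℝ} (h : IsCyclicAbs x a b c) :
    ∃ g ∈ G, g !₂[a, b, c] = x := by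
  rcases h with ⟨h0, h1, h2⟩ | ⟨h0, h1, h2⟩ | ⟨h0, h1, h2⟩
  · obtain ⟨s, hsx⟩ := exists_signIso_of_abs h0 h1 h2
    exact ⟨_, hs s, hsx⟩
  · obtain ⟨s, hsx⟩ := exists_signIso_of_abs (x := permIso (finRotate 3) x) h0 h1 h2
    refine ⟨_, G.mul_mem (G.inv_mem hc) (hs s), ?_⟩
    change (permIso (finRotate 3)).symm (signIso s _) = x
    rw [hsx, LinearIsometryEquiv.symm_apply_apply]
  · obtain ⟨s, hsx⟩ := exists_signIso_of_abs (x := (permIso (finRotate 3)).symm x) h0 h1 h2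
    refine ⟨_, G.mul_mem hc (hs s), ?_⟩
    change permIso (finRotate 3) (signIso s _) = x
    rw [hsx, LinearIsometryEquiv.apply_symm_apply]

lemma inv_goldenRatio_eq : φ⁻¹ = φ - 1 := by
  rw [Real.inv_goldenRatio]
  linarith [Real.goldenRatio_add_goldenConj]

instance finite_Ih : Finite Ih := by
  have h := abs_of_pos Real.goldenRatio_pos
  refine finite_symmetryGroup finite_icosahedron
    ⟨!₂[1, φ, 0], ?_, !₂[1, -φ, 0], ?_, ?_⟩ ⟨!₂[0, 1, φ], ?_, !₂[0, 1, -φ], ?_, ?_⟩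
    ⟨!₂[φ, 0, 1], ?_, !₂[-φ, 0, 1], ?_, ?_⟩
  all_goals first
    | (apply E3.ext3 <;> simp <;> norm_num)
    | simp [mem_icosahedron_iff, h]

lemma halfTurn_mem_Ih (i : Fin 3) : halfTurn i ∈ Ih := signIso_mem_Ih _

/-- A reflection of the icosahedron which does not preserve the coordinate axes. Its axis passes
through the midpoint of the edge that joins `(1, φ, 0)` and `(0, 1, -φ)`. -/
noncomputable def icoReflection : O3 := (ℝ ∙ (!₂[1, φ ^ 2, -φ] : E3))ᗮ.reflection

lemma icoReflection_apply (x : E3) : icoReflection x =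
    !₂[(φ * x 0 - x 1 + (φ - 1) * x 2) / 2, (-x 0 + (1 - φ) * x 1 + φ * x 2) / 2,
      ((φ - 1) * x 0 + φ * x 1 + x 2) / 2] := by
  have hsq := Real.goldenRatio_sq
  have hpos := Real.goldenRatio_pos
  have h1 : 2 * inner ℝ (!₂[1, φ ^ 2, -φ] : E3) x / ‖(!₂[1, φ ^ 2, -φ] : E3)‖ ^ 2
      = ((2 - φ) * x 0 + x 1 - (φ - 1) * x 2) / 2 := by
    rw [E3.inner_eq, E3.norm_sq_eq]
    simp only [Matrix.cons_val]
    have h4 : (1 : ℝ) ^ 2 + (φ ^ 2) ^ 2 + (-φ) ^ 2 = 4 * (φ + 1) := by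
      linear_combination (φ ^ 2 + φ + 3) * hsq
    rw [h4, div_eq_div_iff (by positivity) (by norm_num)]
    linear_combination (4 * x 0 - 4 * x 2 * (-1) + 4 * x 1) * hsq
  rw [icoReflection, reflection_orthogonal_singleton_apply, h1]
  apply E3.ext3
  · simp
    ring
  · simp
    linear_combination (x 0 / 2 + x 2 / 2) * hsq
  · simp
    linear_combination (-x 0 / 2 - x 2 / 2) * hsq

lemma icoReflection_mem_Ih : icoReflection ∈ Ih := by
  have hsq := Real.goldenRatio_sq
  have hpos := abs_of_pos Real.goldenRatio_pos
  refine mem_symmetryGroup_of_mapsTo finite_icosahedron fun x hx => ?_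
  have key : ∀ a b c a' b' c' : ℝ, (φ * a - b + (φ - 1) * c) / 2 = a' →
      (-a + (1 - φ) * b + φ * c) / 2 = b' → ((φ - 1) * a + φ * b + c) / 2 = c' →
      (!₂[a', b', c'] : E3) ∈ icosahedron → x 0 = a → x 1 = b → x 2 = c →
      icoReflection x ∈ icosahedron := by
    rintro a b c a' b' c' rfl rfl rfl h rfl rfl rfl
    rwa [icoReflection_apply]
  rcases mem_icosahedron_iff.1 hx with ⟨h, h1, h2⟩ | ⟨h, h1, h2⟩ | ⟨h, h1, h2⟩ <;>
    rcases eq_or_eq_neg_of_abs_eq h1 with h1 | h1 <;>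
    rcases eq_or_eq_neg_of_abs_eq h2 with h2 | h2
  · refine key 0 1 φ 0 1 φ ?_ ?_ ?_ (by simp [mem_icosahedron_iff, hpos]) h h1 h2
    · linear_combination hsq / 2
    · linear_combination hsq / 2
    · ring
  · refine key 0 1 (-φ) (-1) (-φ) 0 ?_ ?_ ?_ (by simp [mem_icosahedron_iff, hpos]) h h1 h2
    · linear_combination -hsq / 2
    · linear_combination -hsq / 2
    · ring
  · refine key 0 (-1) φ 1 φ 0 ?_ ?_ ?_ (by simp [mem_icosahedron_iff, hpos]) h h1 h2
    · linear_combination hsq / 2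
    · linear_combination hsq / 2
    · ring
  · refine key 0 (-1) (-φ) 0 (-1) (-φ) ?_ ?_ ?_ (by simp [mem_icosahedron_iff, hpos]) h h1 h2
    · linear_combination -hsq / 2
    · linear_combination -hsq / 2
    · ring
  · refine key φ 0 1 φ 0 1 ?_ ?_ ?_ (by simp [mem_icosahedron_iff, hpos]) h2 h h1
    · linear_combination hsq / 2
    · ring
    · linear_combination hsq / 2
  · refine key (-φ) 0 1 (-1) φ 0 ?_ ?_ ?_ (by simp [mem_icosahedron_iff, hpos]) h2 h h1
    · linear_combination -hsq / 2
    · ring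
    · linear_combination -hsq / 2
  · refine key φ 0 (-1) 1 (-φ) 0 ?_ ?_ ?_ (by simp [mem_icosahedron_iff, hpos]) h2 h h1
    · linear_combination hsq / 2
    · ring
    · linear_combination hsq / 2
  · refine key (-φ) 0 (-1) (-φ) 0 (-1) ?_ ?_ ?_ (by simp [mem_icosahedron_iff, hpos]) h2 h h1
    · linear_combination -hsq / 2
    · ring
    · linear_combination -hsq / 2
  · refine key 1 φ 0 0 (-1) φ ?_ ?_ ?_ (by simp [mem_icosahedron_iff, hpos]) h1 h2 h
    · ring
    · linear_combination -hsq / 2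
    · linear_combination hsq / 2
  · refine key 1 (-φ) 0 φ 0 (-1) ?_ ?_ ?_ (by simp [mem_icosahedron_iff, hpos]) h1 h2 h
    · ring
    · linear_combination hsq / 2
    · linear_combination -hsq / 2
  · refine key (-1) φ 0 (-φ) 0 1 ?_ ?_ ?_ (by simp [mem_icosahedron_iff, hpos]) h1 h2 h
    · ring
    · linear_combination -hsq / 2
    · linear_combination hsq / 2
  · refine key (-1) (-φ) 0 0 1 (-φ) ?_ ?_ ?_ (by simp [mem_icosahedron_iff, hpos]) h1 h2 h
    · ring
    · linear_combination hsq / 2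
    · linear_combination -hsq / 2

lemma isCyclicAbs_of_mem_icosahedron {x : E3} (hx : x ∈ icosahedron) : IsCyclicAbs x 0 1 φ := by
  simpa only [mem_icosahedron_iff, IsCyclicAbs, abs_eq_zero] using hx

lemma vertex_mem_icosahedron : (!₂[0, 1, φ] : E3) ∈ icosahedron := by
  simp [mem_icosahedron_iff, abs_of_pos Real.goldenRatio_pos]

lemma isLinearOrbit_icosahedron : IsLinearOrbit Ih icosahedron := by
  have hsq := Real.goldenRatio_sq
  refine ⟨!₂[0, 1, φ], fun h => by simpa using congrArg (fun x : E3 => x 1) h,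
    eq_orbit_of_forall (fun g hg => apply_mem_of_mem_symmetryGroup hg vertex_mem_icosahedron)
      fun x hx => (isCyclicAbs_of_mem_icosahedron hx).exists_apply_eq signIso_mem_Ih cyc_mem_Ih,
    fun w hw => ?_⟩
  have h1 := hw (signIso fun i => decide (i = 0)) (signIso_mem_Ih _)
    (by apply E3.ext3 <;> simp)
  have h2 := hw icoReflection icoReflection_mem_Ih (by
    rw [icoReflection_apply]
    apply E3.ext3 <;> simp
    · linear_combination hsq
    · linear_combination hsq / 2)
  rw [icoReflection_apply] at h2
  have e1 := congrArg (fun x : E3 => x 0) h1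
  have e2 := congrArg (fun x : E3 => x 0) h2
  simp at e1 e2
  have e0 : w 0 = 0 := by linarith
  rw [e0] at e2
  refine ⟨w 1, ?_⟩
  apply E3.ext3
  · simp [e0]
  · simp
  · simp
    linear_combination φ * (2 * e2) - w 2 * hsq

/-- The coordinates of the vertices of the icosahedron adjacent to `(0, 1, φ)`. -/
lemma icosahedron_neighbours {y : E3} (hy : y ∈ icosahedron) (h : dist !₂[0, 1, φ] y = 2) :
    (y 0 = 0 ∧ y 1 = -1 ∧ y 2 = φ) ∨ (|y 0| = φ ∧ y 1 = 0 ∧ y 2 = 1) ∨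
      (|y 0| = 1 ∧ y 1 = φ ∧ y 2 = 0) := by
  have hsq := Real.goldenRatio_sq
  have hpos := Real.one_lt_goldenRatio
  rw [E3.dist_eq_iff (by norm_num)] at h
  simp at h
  rcases mem_icosahedron_iff.1 hy with ⟨h0, h1, h2⟩ | ⟨h1, h2, h0⟩ | ⟨h2, h0, h1⟩
  · left
    rcases eq_or_eq_neg_of_abs_eq h1 with h1 | h1 <;>
      rcases eq_or_eq_neg_of_abs_eq h2 with h2 | h2 <;> rw [h0, h1, h2] at h
    · norm_num at h
    · nlinarith
    · exact ⟨h0, h1, h2⟩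
    · nlinarith
  · right; left
    have h0' : y 0 ^ 2 = φ ^ 2 := by rw [← sq_abs, h0]
    rcases eq_or_eq_neg_of_abs_eq h2 with h2 | h2 <;> rw [h0', h1, h2] at h
    · exact ⟨h0, h1, h2⟩
    · nlinarith
  · right; right
    have h0' : y 0 ^ 2 = 1 := by rw [← sq_abs, h0, one_pow]
    rcases eq_or_eq_neg_of_abs_eq h1 with h1 | h1 <;> rw [h0', h1, h2] at h
    · exact ⟨h0, h1, h2⟩
    · nlinarith

/-! ### The dodecahedron -/

/-- The sum of three pairwise adjacent vertices of the icosahedron points to the centre of a face. -/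
lemma smul_add_add_mem_dodecahedron {y z : E3} (hy : y ∈ icosahedron) (hz : z ∈ icosahedron)
    (hay : dist !₂[0, 1, φ] y = 2) (haz : dist !₂[0, 1, φ] z = 2) (hbc : dist y z = 2) :
    (2 - φ) • (!₂[0, 1, φ] + y + z) ∈ dodecahedron := by
  have hsq := Real.goldenRatio_sq
  have hpos := Real.goldenRatio_pos
  have hinv := inv_goldenRatio_eq
  have habs := abs_of_pos hpos
  have habs' := abs_of_pos (inv_pos.2 hpos)
  have hlt := Real.one_lt_goldenRatio
  rw [E3.dist_eq_iff (by norm_num)] at hbc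
  have key : ∀ p q r, (2 - φ) * (0 + y 0 + z 0) = p → (2 - φ) * (1 + y 1 + z 1) = q →
      (2 - φ) * (φ + y 2 + z 2) = r → (!₂[p, q, r] : E3) ∈ dodecahedron →
      (2 - φ) • (!₂[0, 1, φ] + y + z) ∈ dodecahedron := by
    rintro _ _ _ rfl rfl rfl hmem
    convert hmem using 1
    apply E3.ext3 <;> simp <;> ring
  rcases icosahedron_neighbours hy hay with ⟨hy0, hy1, hy2⟩ | ⟨hy0, hy1, hy2⟩ | ⟨hy0, hy1, hy2⟩ <;>
    rcases icosahedron_neighbours hz haz with ⟨hz0, hz1, hz2⟩ | ⟨hz0, hz1, hz2⟩ | ⟨hz0, hz1, hz2⟩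
  · exfalso
    rw [hy0, hy1, hy2, hz0, hz1, hz2] at hbc
    norm_num at hbc
  · rcases eq_or_eq_neg_of_abs_eq hz0 with hz0 | hz0
    · refine key (φ⁻¹) (0) (φ) ?_ ?_ ?_
        (mem_dodecahedron_iff.2 (Or.inr (Or.inr (Or.inl ⟨rfl, habs, habs'⟩))))
      · rw [hy0, hz0, hinv]; linear_combination (-1) * hsq
      · rw [hy1, hz1]; ring
      · rw [hy2, hz2]; linear_combination (-2) * hsq
    · refine key (-φ⁻¹) (0) (φ) ?_ ?_ ?_
        (mem_dodecahedron_iff.2 (Or.inr (Or.inr (Or.inl ⟨rfl, habs, (abs_neg _).trans habs'⟩))))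
      · rw [hy0, hz0, hinv]; linear_combination (1) * hsq
      · rw [hy1, hz1]; ring
      · rw [hy2, hz2]; linear_combination (-2) * hsq
  · rcases eq_or_eq_neg_of_abs_eq hz0 with hz0 | hz0
    · exfalso
      rw [hy0, hy1, hy2, hz0, hz1, hz2] at hbc
      linarith
    · exfalso
      rw [hy0, hy1, hy2, hz0, hz1, hz2] at hbc
      linarith
  · rcases eq_or_eq_neg_of_abs_eq hy0 with hy0 | hy0
    · refine key (φ⁻¹) (0) (φ) ?_ ?_ ?_
        (mem_dodecahedron_iff.2 (Or.inr (Or.inr (Or.inl ⟨rfl, habs, habs'⟩))))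
      · rw [hy0, hz0, hinv]; linear_combination (-1) * hsq
      · rw [hy1, hz1]; ring
      · rw [hy2, hz2]; linear_combination (-2) * hsq
    · refine key (-φ⁻¹) (0) (φ) ?_ ?_ ?_
        (mem_dodecahedron_iff.2 (Or.inr (Or.inr (Or.inl ⟨rfl, habs, (abs_neg _).trans habs'⟩))))
      · rw [hy0, hz0, hinv]; linear_combination (1) * hsq
      · rw [hy1, hz1]; ring
      · rw [hy2, hz2]; linear_combination (-2) * hsq
  · rcases eq_or_eq_neg_of_abs_eq hy0 with hy0 | hy0 <;>
      rcases eq_or_eq_neg_of_abs_eq hz0 with hz0 | hz0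
    · exfalso
      rw [hy0, hy1, hy2, hz0, hz1, hz2] at hbc
      linarith
    · exfalso
      rw [hy0, hy1, hy2, hz0, hz1, hz2] at hbc
      linarith
    · exfalso
      rw [hy0, hy1, hy2, hz0, hz1, hz2] at hbc
      linarith
    · exfalso
      rw [hy0, hy1, hy2, hz0, hz1, hz2] at hbc
      linarith
  · rcases eq_or_eq_neg_of_abs_eq hy0 with hy0 | hy0 <;>
      rcases eq_or_eq_neg_of_abs_eq hz0 with hz0 | hz0
    · refine key (1) (1) (1) ?_ ?_ ?_ (by simp [mem_dodecahedron_iff])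
      · rw [hy0, hz0]; linear_combination (-1) * hsq
      · rw [hy1, hz1]; linear_combination (-1) * hsq
      · rw [hy2, hz2]; linear_combination (-1) * hsq
    · exfalso
      rw [hy0, hy1, hy2, hz0, hz1, hz2] at hbc
      linarith
    · exfalso
      rw [hy0, hy1, hy2, hz0, hz1, hz2] at hbc
      linarith
    · refine key (-1) (1) (1) ?_ ?_ ?_ (by simp [mem_dodecahedron_iff])
      · rw [hy0, hz0]; linear_combination (1) * hsq
      · rw [hy1, hz1]; linear_combination (-1) * hsq
      · rw [hy2, hz2]; linear_combination (-1) * hsq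
  · rcases eq_or_eq_neg_of_abs_eq hy0 with hy0 | hy0
    · exfalso
      rw [hy0, hy1, hy2, hz0, hz1, hz2] at hbc
      linarith
    · exfalso
      rw [hy0, hy1, hy2, hz0, hz1, hz2] at hbc
      linarith
  · rcases eq_or_eq_neg_of_abs_eq hy0 with hy0 | hy0 <;>
      rcases eq_or_eq_neg_of_abs_eq hz0 with hz0 | hz0
    · refine key (1) (1) (1) ?_ ?_ ?_ (by simp [mem_dodecahedron_iff])
      · rw [hy0, hz0]; linear_combination (-1) * hsq
      · rw [hy1, hz1]; linear_combination (-1) * hsq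
      · rw [hy2, hz2]; linear_combination (-1) * hsq
    · exfalso
      rw [hy0, hy1, hy2, hz0, hz1, hz2] at hbc
      linarith
    · exfalso
      rw [hy0, hy1, hy2, hz0, hz1, hz2] at hbc
      linarith
    · refine key (-1) (1) (1) ?_ ?_ ?_ (by simp [mem_dodecahedron_iff])
      · rw [hy0, hz0]; linear_combination (1) * hsq
      · rw [hy1, hz1]; linear_combination (-1) * hsq
      · rw [hy2, hz2]; linear_combination (-1) * hsq
  · rcases eq_or_eq_neg_of_abs_eq hy0 with hy0 | hy0 <;>
      rcases eq_or_eq_neg_of_abs_eq hz0 with hz0 | hz0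
    · exfalso
      rw [hy0, hy1, hy2, hz0, hz1, hz2] at hbc
      linarith
    · refine key (0) (φ) (φ⁻¹) ?_ ?_ ?_
        (mem_dodecahedron_iff.2 (Or.inr (Or.inl ⟨rfl, habs, habs'⟩)))
      · rw [hy0, hz0]; ring
      · rw [hy1, hz1]; linear_combination (-2) * hsq
      · rw [hy2, hz2, hinv]; linear_combination (-1) * hsq
    · refine key (0) (φ) (φ⁻¹) ?_ ?_ ?_
        (mem_dodecahedron_iff.2 (Or.inr (Or.inl ⟨rfl, habs, habs'⟩)))
      · rw [hy0, hz0]; ring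
      · rw [hy1, hz1]; linear_combination (-2) * hsq
      · rw [hy2, hz2, hinv]; linear_combination (-1) * hsq
    · exfalso
      rw [hy0, hy1, hy2, hz0, hz1, hz2] at hbc
      linarith

lemma dodecahedron_eq_orbit : dodecahedron = MulAction.orbit Ih (!₂[1, 1, 1] : E3) := by
  have hsq := Real.goldenRatio_sq
  have hinv := inv_goldenRatio_eq
  refine eq_orbit_of_forall (fun g hg => ?_) fun x hx => ?_
  · -- `(1, 1, 1)` is a multiple of the sum of three pairwise adjacent vertices of the icosahedron
    set a : E3 := !₂[0, 1, φ] with ha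
    set b : E3 := !₂[φ, 0, 1] with hb
    set c : E3 := !₂[1, φ, 0] with hc
    have habs := abs_of_pos Real.goldenRatio_pos
    have hbm : b ∈ icosahedron := by simp [hb, mem_icosahedron_iff, habs]
    have hcm : c ∈ icosahedron := by simp [hc, mem_icosahedron_iff, habs]
    have hab : dist a b = 2 := by
      rw [E3.dist_eq_iff (by norm_num)]
      simp [ha, hb]
      linear_combination hsq
    have hac : dist a c = 2 := by
      rw [E3.dist_eq_iff (by norm_num)]
      simp [ha, hc]
      linear_combination hsq
    have hbc : dist b c = 2 := by
      rw [E3.dist_eq_iff (by norm_num)]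
      simp [hb, hc]
      linear_combination hsq
    have hsum : (!₂[1, 1, 1] : E3) = (2 - φ) • (a + b + c) := by
      apply E3.ext3 <;> simp [ha, hb, hc] <;> linear_combination hsq
    -- a symmetry `h` of both solids moves the first of these vertices to its image under `g`
    obtain ⟨h, hh, hha⟩ := (isCyclicAbs_of_mem_icosahedron (apply_mem_of_mem_symmetryGroup hg
      vertex_mem_icosahedron)).exists_apply_eq (G := Ih ⊓ symmetryGroup dodecahedron)
      (fun s => ⟨signIso_mem_Ih s, signIso_mem_dodecahedron s⟩) ⟨cyc_mem_Ih, cyc_mem_dodecahedron⟩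
    obtain ⟨k, rfl⟩ : ∃ k, g = h * k := ⟨h⁻¹ * g, by group⟩
    have hk : k ∈ Ih := by simpa using Ih.mul_mem (Ih.inv_mem hh.1) hg
    have hka : k a = a := h.injective hha.symm
    change h (k _) ∈ _
    refine apply_mem_of_mem_symmetryGroup hh.2 ?_
    rw [hsum, map_smul, map_add, map_add, hka]
    refine smul_add_add_mem_dodecahedron (apply_mem_of_mem_symmetryGroup hk hbm)
      (apply_mem_of_mem_symmetryGroup hk hcm) ?_ ?_ ((k.dist_map b c).trans hbc)
    · rw [← ha, ← hka, k.dist_map, hab]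
    · rw [← ha, ← hka, k.dist_map, hac]
  · have hcyc : IsCyclicAbs x 1 1 1 ∨ IsCyclicAbs x 0 φ φ⁻¹ := by
      simp only [IsCyclicAbs, abs_eq_zero]
      have := mem_dodecahedron_iff.1 hx
      tauto
    rcases hcyc with h | h
    · exact h.exists_apply_eq signIso_mem_Ih cyc_mem_Ih
    · obtain ⟨g, hg, rfl⟩ := h.exists_apply_eq signIso_mem_Ih cyc_mem_Ih
      refine ⟨g * (permIso (finRotate 3) * icoReflection), Ih.mul_mem hg
        (Ih.mul_mem cyc_mem_Ih icoReflection_mem_Ih), ?_⟩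
      change g (permIso (finRotate 3) (icoReflection _)) = _
      congr 1
      rw [icoReflection_apply]
      apply E3.ext3
      · rw [cyc_apply_zero]
        simp
        ring
      · rw [cyc_apply_one]
        simp
        ring
      · rw [cyc_apply_two]
        simp [hinv]

lemma isLinearOrbit_dodecahedron : IsLinearOrbit Ih dodecahedron :=
  ⟨!₂[1, 1, 1], fun h => by simpa using congrArg (fun x : E3 => x 0) h, dodecahedron_eq_orbit,
    fun _ hw => ⟨_, eq_smul_of_finRotate (hw _ cyc_mem_Ih (by apply E3.ext3 <;> simp))⟩⟩

/-! ### The icosidodecahedron -/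

/-- Points with the coordinates of a vertex of the icosidodecahedron. -/
def IsIcosidodecahedral (x : E3) : Prop :=
  IsCyclicAbs x 0 0 φ ∨ IsCyclicAbs x (1 / 2) (φ ^ 2 / 2) (φ / 2)

lemma IsIcosidodecahedral.exists_apply_eq {x : E3} (h : IsIcosidodecahedral x) :
    ∃ g ∈ Ih, g !₂[0, 0, φ] = x := by
  rcases h with h | h
  · exact h.exists_apply_eq signIso_mem_Ih cyc_mem_Ih
  · obtain ⟨g, hg, rfl⟩ := h.exists_apply_eq signIso_mem_Ih cyc_mem_Ih
    refine ⟨g * icoReflection, Ih.mul_mem hg icoReflection_mem_Ih, ?_⟩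
    change g (icoReflection _) = _
    congr 1
    rw [icoReflection_apply]
    apply E3.ext3 <;> simp
    · linear_combination Real.goldenRatio_sq / 2
    · linear_combination Real.goldenRatio_sq

lemma isIcosidodecahedral_midpoint {y : E3} (hy : y ∈ icosahedron)
    (h : dist !₂[0, 1, φ] y = 2) : IsIcosidodecahedral (midpoint ℝ !₂[0, 1, φ] y) := by
  have hsq := Real.goldenRatio_sq
  have hpos := Real.goldenRatio_pos
  have hφ2 : (1 + φ) / 2 = φ ^ 2 / 2 := by rw [hsq]; ring
  have h1 : |(1 / 2 : ℝ)| = 1 / 2 := abs_of_pos (by norm_num)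
  have h2 : |φ / 2| = φ / 2 := abs_of_pos (by positivity)
  have h3 : |φ ^ 2 / 2| = φ ^ 2 / 2 := abs_of_pos (by positivity)
  have hm := E3.midpoint_apply !₂[0, 1, φ] y
  have m0 : midpoint ℝ !₂[0, 1, φ] y 0 = (0 + y 0) / 2 := hm 0
  have m1 : midpoint ℝ !₂[0, 1, φ] y 1 = (1 + y 1) / 2 := hm 1
  have m2 : midpoint ℝ !₂[0, 1, φ] y 2 = (φ + y 2) / 2 := hm 2
  have habs0 : |(0 + y 0) / 2| = |y 0| / 2 := by rw [zero_add, abs_div, abs_two]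
  unfold IsIcosidodecahedral IsCyclicAbs
  rw [m0, m1, m2, habs0]
  rcases icosahedron_neighbours hy h with ⟨h0, h1', h2'⟩ | ⟨h0, h1', h2'⟩ | ⟨h0, h1', h2'⟩ <;>
    rw [h0, h1', h2']
  · left; left
    simp [abs_of_pos hpos]
  · right; right; left
    rw [add_zero, add_comm, hφ2]
    exact ⟨h1, h3, rfl⟩
  · right; left
    rw [add_zero, hφ2]
    exact ⟨rfl, h3, h2⟩

lemma icosidodecahedron_vertex_mem : (!₂[0, 0, φ] : E3) ∈ icosidodecahedron := by
  have h := abs_of_pos Real.goldenRatio_pos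
  refine ⟨!₂[0, 1, φ], vertex_mem_icosahedron, !₂[0, -1, φ], by simp [mem_icosahedron_iff, h],
    ?_, ?_⟩
  · rw [E3.dist_eq_iff (by norm_num)]
    simp
    norm_num
  · apply E3.ext3 <;> simp [E3.midpoint_apply]

lemma icosidodecahedron_eq_orbit :
    icosidodecahedron = MulAction.orbit Ih (!₂[0, 0, φ] : E3) := by
  refine eq_orbit_of_forall
    (fun g hg => apply_mem_edgeMidpoints hg icosidodecahedron_vertex_mem) ?_
  rintro _ ⟨x, hx, y, hy, hxy, rfl⟩
  obtain ⟨g, hg, rfl⟩ :=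
    (isCyclicAbs_of_mem_icosahedron hx).exists_apply_eq signIso_mem_Ih cyc_mem_Ih
  obtain ⟨z, rfl⟩ := g.surjective y
  have hz : z ∈ icosahedron := by
    have := apply_mem_of_mem_symmetryGroup (Ih.inv_mem hg) hy
    rwa [show g⁻¹ (g z) = z from g.symm_apply_apply z] at this
  rw [g.dist_map] at hxy
  obtain ⟨k, hk, hkz⟩ := (isIcosidodecahedral_midpoint hz hxy).exists_apply_eq
  refine ⟨g * k, Ih.mul_mem hg hk, ?_⟩
  change g (k _) = _
  rw [hkz]
  simp [midpoint_eq_smul_add]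

lemma isLinearOrbit_icosidodecahedron : IsLinearOrbit Ih icosidodecahedron := by
  have hpos := Real.goldenRatio_pos
  refine ⟨!₂[0, 0, φ], fun h => hpos.ne' (congrArg (fun x : E3 => x 2) h),
    icosidodecahedron_eq_orbit, fun w hw => ?_⟩
  have h := hw _ (halfTurn_mem_Ih 2) (by apply E3.ext3 <;> simp [halfTurn])
  have h0 := congrArg (fun x : E3 => x 0) h
  have h1 := congrArg (fun x : E3 => x 1) h
  simp [halfTurn] at h0 h1
  refine ⟨w 2 / φ, ?_⟩
  apply E3.ext3
  · simp
    linarith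
  · simp
    linarith
  · simp
    field_simp

/-! ### Reflections in the octahedral and the icosahedral group -/

/-- The axis of a reflection points along each nonzero difference between a point and its image. -/
lemma sub_reflection (w x : E3) :
    x - (ℝ ∙ w)ᗮ.reflection x = (2 * inner ℝ w x / ‖w‖ ^ 2) • w := by
  rw [reflection_orthogonal_singleton_apply]
  abel

lemma reflection_smul {c : ℝ} (hc : c ≠ 0) (w : E3) :
    (ℝ ∙ (c • w))ᗮ.reflection = (ℝ ∙ w)ᗮ.reflection := by
  ext1 x
  rw [reflection_orthogonal_singleton_apply, reflection_orthogonal_singleton_apply, smul_smul,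
    real_inner_smul_left, norm_smul, mul_pow, Real.norm_eq_abs, sq_abs]
  congr 2
  rcases eq_or_ne w 0 with rfl | hw
  · simp
  · have : ‖w‖ ≠ 0 := norm_ne_zero_iff.2 hw
    field_simp

/-- A reflection moves some point of any set whose points are fixed by no isometry but the identity,
and its axis points along the difference between that point and its image. -/
lemma exists_smul_eq_sub_reflection {P : Set E3}
    (hP : ∀ g : O3, (∀ x ∈ P, g x = x) → ∀ x, g x = x) {w : E3} (hw : w ≠ 0) :
    ∃ x ∈ P, ∃ k : ℝ, k ≠ 0 ∧ k • w = x - (ℝ ∙ w)ᗮ.reflection x := by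
  by_contra hcon
  push Not at hcon
  have h1 : ∀ x ∈ P, (ℝ ∙ w)ᗮ.reflection x = x := by
    intro x hx
    by_contra hne
    refine hcon x hx (2 * inner ℝ w x / ‖w‖ ^ 2) (fun h0 => hne ?_) (sub_reflection w x).symm
    have := sub_reflection w x
    rw [h0, zero_smul, sub_eq_zero] at this
    exact this.symm
  have h2 := hP _ h1 w
  rw [Submodule.reflection_orthogonalComplement_singleton_eq_neg] at h2
  have h3 : (2 : ℝ) • w = 0 := by
    rw [two_smul]
    nth_rewrite 1 [← h2]
    exact neg_add_cancel w
  exact hw ((smul_eq_zero.1 h3).resolve_left two_ne_zero)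

lemma eq_self_of_icosahedron (g : O3) (hg : ∀ x ∈ icosahedron, g x = x) (x : E3) : g x = x := by
  have h := abs_of_pos Real.goldenRatio_pos
  have h1 := hg !₂[1, φ, 0] (by simp [mem_icosahedron_iff, h])
  have h2 := hg !₂[1, -φ, 0] (by simp [mem_icosahedron_iff, h])
  have h3 := hg !₂[0, 1, φ] (by simp [mem_icosahedron_iff, h])
  have h4 := hg !₂[0, 1, -φ] (by simp [mem_icosahedron_iff, h])
  have h5 := hg !₂[φ, 0, 1] (by simp [mem_icosahedron_iff, h])
  have h6 := hg !₂[-φ, 0, 1] (by simp [mem_icosahedron_iff, h])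
  have hx : x = (x 0 / 2) • (!₂[1, φ, 0] + !₂[1, -φ, 0]) +
      (x 1 / 2) • (!₂[0, 1, φ] + !₂[0, 1, -φ]) + (x 2 / 2) • (!₂[φ, 0, 1] + !₂[-φ, 0, 1]) := by
    apply E3.ext3 <;> simp
  rw [hx]
  simp only [map_add, map_smul, h1, h2, h3, h4, h5, h6]

lemma eq_self_of_cube (g : O3) (hg : ∀ x ∈ cube, g x = x) (x : E3) : g x = x := by
  have hm : ∀ a b c : ℝ, |a| = 1 → |b| = 1 → |c| = 1 → (!₂[a, b, c] : E3) ∈ cube := by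
    intro a b c ha hb hc i
    fin_cases i <;> assumption
  have h1 := hg !₂[1, 1, 1] (hm _ _ _ (by simp) (by simp) (by simp))
  have h2 := hg !₂[1, -1, -1] (hm _ _ _ (by simp) (by simp) (by simp))
  have h3 := hg !₂[-1, 1, -1] (hm _ _ _ (by simp) (by simp) (by simp))
  have h4 := hg !₂[-1, -1, 1] (hm _ _ _ (by simp) (by simp) (by simp))
  have hx : x = (x 0 / 2) • (!₂[1, 1, 1] + !₂[1, -1, -1]) +
      (x 1 / 2) • (!₂[1, 1, 1] + !₂[-1, 1, -1]) + (x 2 / 2) • (!₂[1, 1, 1] + !₂[-1, -1, 1]) := by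
    apply E3.ext3 <;> simp
  rw [hx]
  simp only [map_add, map_smul, h1, h2, h3, h4]

/-- The difference of two distinct vertices of the icosahedron which are not opposite is a multiple of
a vertex of the icosidodecahedron. -/
lemma isIcosidodecahedral_sub {u : E3} (hu : u ∈ icosahedron) (h1 : u ≠ !₂[0, 1, φ])
    (h2 : u ≠ -!₂[0, 1, φ]) : ∃ c : ℝ, c ≠ 0 ∧
      IsIcosidodecahedral (c • (!₂[0, 1, φ] - u)) := by
  have hsq := Real.goldenRatio_sq
  have hpos := Real.goldenRatio_pos
  have habs := abs_of_pos hpos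
  have hh : |(1 / 2 : ℝ)| = 1 / 2 := abs_of_pos (by norm_num)
  have hh' : |-(1 / 2 : ℝ)| = 1 / 2 := (abs_neg _).trans hh
  have hφ : |φ / 2| = φ / 2 := abs_of_pos (by positivity)
  have hφ2 : |φ ^ 2 / 2| = φ ^ 2 / 2 := abs_of_pos (by positivity)
  have key : ∀ c d0 d1 d2 : ℝ, 0 < c → c * |u 0| = d0 → c * (1 - u 1) = d1 → c * (φ - u 2) = d2 →
      IsIcosidodecahedral !₂[d0, d1, d2] →
      ∃ c : ℝ, c ≠ 0 ∧ IsIcosidodecahedral (c • (!₂[0, 1, φ] - u)) := by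
    rintro c _ _ _ hc rfl rfl rfl h
    refine ⟨c, hc.ne', ?_⟩
    have h0 : |(!₂[c * |u 0|, c * (1 - u 1), c * (φ - u 2)] : E3) 0| = |c * (0 - u 0)| := by
      change abs (c * |u 0|) = _
      rw [zero_sub, abs_mul, abs_mul, abs_abs, abs_neg]
    unfold IsIcosidodecahedral IsCyclicAbs at h ⊢
    rw [h0] at h
    exact h
  rcases mem_icosahedron_iff.1 hu with ⟨e0, e1, e2⟩ | ⟨e1, e2, e0⟩ | ⟨e2, e0, e1⟩
  · rcases eq_or_eq_neg_of_abs_eq e1 with e1 | e1 <;> rcases eq_or_eq_neg_of_abs_eq e2 with e2 | e2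
    · exact absurd (E3.ext3 e0 e1 e2) h1
    · refine key (1 / 2) 0 0 φ (by norm_num) ?_ ?_ ?_ (Or.inl (Or.inl ⟨abs_zero, abs_zero, habs⟩))
      · rw [e0, abs_zero, mul_zero]
      · rw [e1]; ring
      · rw [e2]; ring
    · refine key (φ / 2) 0 φ 0 (by positivity) ?_ ?_ ?_
        (Or.inl (Or.inr (Or.inr ⟨abs_zero, abs_zero, habs⟩)))
      · rw [e0, abs_zero, mul_zero]
      · rw [e1]; ring
      · rw [e2]; ring
    · refine absurd (E3.ext3 ?_ e1 e2) h2
      rw [e0]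
      simp
  · rcases eq_or_eq_neg_of_abs_eq e2 with e2 | e2
    · refine key (φ / 2) (φ ^ 2 / 2) (φ / 2) (1 / 2) (by positivity) ?_ ?_ ?_
        (Or.inr (Or.inr (Or.inr ⟨hh, hφ2, hφ⟩)))
      · rw [e0]; ring
      · rw [e1]; ring
      · rw [e2]; linear_combination hsq / 2
    · refine key (1 / 2) (φ / 2) (1 / 2) (φ ^ 2 / 2) (by norm_num) ?_ ?_ ?_
        (Or.inr (Or.inr (Or.inl ⟨hh, hφ2, hφ⟩)))
      · rw [e0]; ring
      · rw [e1]; ring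
      · rw [e2]; linear_combination -hsq / 2
  · rcases eq_or_eq_neg_of_abs_eq e1 with e1 | e1
    · refine key (φ / 2) (φ / 2) (-(1 / 2)) (φ ^ 2 / 2) (by positivity) ?_ ?_ ?_
        (Or.inr (Or.inr (Or.inl ⟨hh', hφ2, hφ⟩)))
      · rw [e0]; ring
      · rw [e1]; linear_combination -hsq / 2
      · rw [e2]; ring
    · refine key (1 / 2) (1 / 2) (φ ^ 2 / 2) (φ / 2) (by norm_num) ?_ ?_ ?_
        (Or.inr (Or.inl ⟨hh, hφ2, hφ⟩))
      · rw [e0]; ring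
      · rw [e1]; linear_combination -hsq / 2
      · rw [e2]; ring

/-- The axes of the reflections in the icosahedral group are those through the vertices of the
icosidodecahedron. -/
lemma exists_smul_of_reflection_mem_Ih {w : E3} (hw : w ≠ 0) (h : (ℝ ∙ w)ᗮ.reflection ∈ Ih) :
    ∃ c : ℝ, c ≠ 0 ∧ ∃ g ∈ Ih, w = c • g !₂[0, 0, φ] := by
  have hsq := Real.goldenRatio_sq
  have hpos := Real.goldenRatio_pos
  obtain ⟨x, hx, k, hk, hkw⟩ := exists_smul_eq_sub_reflection eq_self_of_icosahedron hw
  obtain ⟨g, hg, rfl⟩ :=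
    (isCyclicAbs_of_mem_icosahedron hx).exists_apply_eq signIso_mem_Ih cyc_mem_Ih
  have hinv : ∀ y ∈ icosahedron, ∃ z ∈ icosahedron, g z = y := by
    intro y hy
    exact ⟨g⁻¹ y, apply_mem_of_mem_symmetryGroup (Ih.inv_mem hg) hy, g.apply_symm_apply y⟩
  obtain ⟨u, hu, hgu⟩ := hinv _ (apply_mem_of_mem_symmetryGroup h hx)
  rw [← hgu, ← map_sub] at hkw
  have hw' : w = k⁻¹ • g (!₂[0, 1, φ] - u) := by rw [← hkw, smul_smul, inv_mul_cancel₀ hk, one_smul]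
  have hu1 : u ≠ !₂[0, 1, φ] := by
    rintro rfl
    rw [sub_self, map_zero, smul_zero] at hw'
    exact hw hw'
  have hu2 : u ≠ -!₂[0, 1, φ] := by
    -- otherwise the axis passes through a vertex, and another vertex is not preserved
    rintro rfl
    rw [sub_neg_eq_add, ← two_smul ℝ, map_smul, smul_smul] at hw'
    have hb : (!₂[0, -1, φ] : E3) ∈ icosahedron := by
      simp [mem_icosahedron_iff, abs_of_pos hpos]
    obtain ⟨z, hz, hgz⟩ := hinv _ (apply_mem_of_mem_symmetryGroup h
      (apply_mem_of_mem_symmetryGroup hg hb))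
    rw [hw', reflection_smul (by positivity), reflection_orthogonal_singleton_apply,
      g.inner_map_map, g.norm_map, ← map_smul, ← map_sub] at hgz
    have hz' := g.injective hgz
    rw [E3.inner_eq, E3.norm_sq_eq] at hz'
    have z0 : z 0 = 0 := by simp [hz']
    have z1 : z 1 = -1 - 2 * (-1 + φ * φ) / (1 + φ ^ 2) := by
      rw [hz']
      change -1 - (2 * (0 * 0 + 1 * (-1) + φ * φ) / (0 ^ 2 + 1 ^ 2 + φ ^ 2)) * 1 = _
      ring
    have z1' : z 1 < -1 := by
      rw [z1]
      have : 0 < 2 * (-1 + φ * φ) / (1 + φ ^ 2) := by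
        have : 0 < -1 + φ * φ := by nlinarith
        positivity
      linarith
    rcases mem_icosahedron_iff.1 hz with ⟨-, e, -⟩ | ⟨-, -, e⟩ | ⟨-, e, -⟩
    · rw [abs_of_neg (by linarith)] at e
      linarith
    · rw [z0, abs_zero] at e
      exact hpos.ne e
    · rw [z0, abs_zero] at e
      norm_num at e
  obtain ⟨c, hc, hcu⟩ := isIcosidodecahedral_sub hu hu1 hu2
  obtain ⟨f, hf, hfz⟩ := hcu.exists_apply_eq
  refine ⟨k⁻¹ * c⁻¹, by positivity, g * f, Ih.mul_mem hg hf, ?_⟩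
  change w = (k⁻¹ * c⁻¹) • g (f _)
  rw [hfz, map_smul, smul_smul, mul_assoc, inv_mul_cancel₀ hc, mul_one, hw']

/-- The axes of the reflections in the octahedral group are the coordinate axes and those through
the vertices of the cuboctahedron. -/
lemma exists_smul_of_reflection_mem_Oh {w : E3} (hw : w ≠ 0) (h : (ℝ ∙ w)ᗮ.reflection ∈ Oh) :
    (∃ i, ∀ j, j ≠ i → w j = 0) ∨ ∃ c : ℝ, c ≠ 0 ∧ ∃ g ∈ Oh, w = c • g !₂[0, 1, 1] := by
  obtain ⟨x, hx, k, hk, hkw⟩ := exists_smul_eq_sub_reflection eq_self_of_cube hw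
  have hsx := apply_mem_of_mem_symmetryGroup h hx
  have hi : ∀ i, w i = 0 ∨ (ℝ ∙ w)ᗮ.reflection x i = - x i ∧ w i = 2 * k⁻¹ * x i := by
    intro i
    have hwi : k * w i = x i - (ℝ ∙ w)ᗮ.reflection x i := congrArg (fun z : E3 => z i) hkw
    rcases abs_eq_abs.1 ((hsx i).trans (hx i).symm) with h' | h'
    · left
      rw [h', sub_self] at hwi
      exact (mul_eq_zero.1 hwi).resolve_left hk
    · right
      refine ⟨h', ?_⟩
      rw [h'] at hwi
      field_simp
      linarith
  have hcub : IsCyclicAbs ((k / 2) • w) 0 1 1 → ∃ c : ℝ, c ≠ 0 ∧ ∃ g ∈ Oh, w = c • g !₂[0, 1, 1] := by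
    intro hc
    obtain ⟨g, hg, hgw⟩ := hc.exists_apply_eq signIso_mem_Oh (permIso_mem_Oh _)
    refine ⟨2 / k, by positivity, g, hg, ?_⟩
    rw [hgw, smul_smul]
    field_simp
    simp
  have hzero : ∀ i, w i = 0 → |((k / 2) • w) i| = 0 := by
    intro i h0
    simp [h0]
  have hone : ∀ i, w i = 2 * k⁻¹ * x i → |((k / 2) • w) i| = 1 := by
    intro i h1
    rw [← hx i]
    congr 1
    simp [h1]
    field_simp
  rcases hi 0 with h0 | ⟨h0, h0'⟩ <;> rcases hi 1 with h1 | ⟨h1, h1'⟩ <;>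
    rcases hi 2 with h2 | ⟨h2, h2'⟩
  · exact absurd (E3.ext3 h0 h1 h2) hw
  · exact Or.inl ⟨2, fun j hj => by fin_cases j <;> simp_all⟩
  · exact Or.inl ⟨1, fun j hj => by fin_cases j <;> simp_all⟩
  · exact Or.inr (hcub (Or.inl ⟨hzero 0 h0, hone 1 h1', hone 2 h2'⟩))
  · exact Or.inl ⟨0, fun j hj => by fin_cases j <;> simp_all⟩
  · exact Or.inr (hcub (Or.inr (Or.inl ⟨hzero 1 h1, hone 2 h2', hone 0 h0'⟩)))
  · exact Or.inr (hcub (Or.inr (Or.inr ⟨hzero 2 h2, hone 0 h0', hone 1 h1'⟩)))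
  · -- here the axis passes through the vertex `x`, and the adjacent vertex `y` is not preserved
    exfalso
    have hwx : w = (2 * k⁻¹) • x := by apply E3.ext3 <;> assumption
    set y := signIso (fun i => decide (i = 0)) x with hy
    have hyc : y ∈ cube := fun i => by rw [hy, abs_signIso_apply, hx i]
    have hsy := apply_mem_of_mem_symmetryGroup h hyc 1
    have hsq : ∀ i, x i ^ 2 = 1 := fun i => by rw [← sq_abs, hx i, one_pow]
    have hc : 2 * inner ℝ x y / ‖x‖ ^ 2 = 2 / 3 := by
      rw [E3.inner_eq, E3.norm_sq_eq, hsq, hsq, hsq]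
      simp [hy]
      linear_combination (-2 / 3) * hsq 0 + 2 / 3 * hsq 1 + 2 / 3 * hsq 2
    rw [hwx, reflection_smul (by positivity), reflection_orthogonal_singleton_apply, hc] at hsy
    simp [hy] at hsy
    have h13 : x 1 - 2 / 3 * x 1 = 1 / 3 * x 1 := by ring
    rw [h13, abs_mul, hx 1] at hsy
    norm_num at hsy

/-! ### Isotropy groups generated by two orthogonal reflections -/

lemma reflection_self (u : E3) : (ℝ ∙ u)ᗮ.reflection u = -u :=
  Submodule.reflection_orthogonalComplement_singleton_eq_neg u

lemma reflection_of_inner_eq_zero {u x : E3} (h : inner ℝ u x = 0) :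
    (ℝ ∙ u)ᗮ.reflection x = x := by
  rw [reflection_orthogonal_singleton_apply, h]
  simp

lemma inner_eq_zero_of_reflection {u x : E3} (hu : u ≠ 0) (h : (ℝ ∙ u)ᗮ.reflection x = x) :
    inner ℝ u x = 0 := by
  have h1 := sub_reflection u x
  rw [h, sub_self, eq_comm, smul_eq_zero] at h1
  have : ‖u‖ ≠ 0 := norm_ne_zero_iff.2 hu
  simpa [hu] using h1

lemma reflection_apply_isometry (g : O3) (u : E3) :
    (ℝ ∙ g u)ᗮ.reflection = g * (ℝ ∙ u)ᗮ.reflection * g⁻¹ := by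
  ext1 x
  obtain ⟨y, rfl⟩ := g.surjective x
  change _ = g ((ℝ ∙ u)ᗮ.reflection (g⁻¹ (g y)))
  rw [show g⁻¹ (g y) = y from g.symm_apply_apply y, reflection_orthogonal_singleton_apply,
    reflection_orthogonal_singleton_apply, g.inner_map_map, g.norm_map, map_sub, map_smul]

lemma eq_zero_of_inner_eq_zero {u v w x : E3} (hu : u ≠ 0) (hv : v ≠ 0) (hw : w ≠ 0)
    (huv : inner ℝ u v = 0) (huw : inner ℝ u w = 0) (hvw : inner ℝ v w = 0)
    (hux : inner ℝ u x = 0) (hvx : inner ℝ v x = 0) (hwx : inner ℝ w x = 0) : x = 0 := by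
  by_contra hx
  have h : LinearIndependent ℝ ![u, v, w, x] := by
    refine linearIndependent_of_ne_zero_of_inner_eq_zero ?_ ?_
    · intro i
      fin_cases i <;> assumption
    · intro i j hij
      fin_cases i <;> fin_cases j <;> first | exact absurd rfl hij | assumption |
        (rw [real_inner_comm]; assumption)
  have := h.fintype_card_le_finrank
  simp at this

lemma eq_sum_of_orthogonal {u v w : E3} (hu : u ≠ 0) (hv : v ≠ 0) (hw : w ≠ 0)
    (huv : inner ℝ u v = 0) (huw : inner ℝ u w = 0) (hvw : inner ℝ v w = 0) (x : E3) :
    x = (inner ℝ u x / ‖u‖ ^ 2) • u + (inner ℝ v x / ‖v‖ ^ 2) • v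
      + (inner ℝ w x / ‖w‖ ^ 2) • w := by
  have hu' : ‖u‖ ≠ 0 := norm_ne_zero_iff.2 hu
  have hv' : ‖v‖ ≠ 0 := norm_ne_zero_iff.2 hv
  have hw' : ‖w‖ ≠ 0 := norm_ne_zero_iff.2 hw
  have hvu : inner ℝ v u = 0 := by rw [real_inner_comm, huv]
  have hwu : inner ℝ w u = 0 := by rw [real_inner_comm, huw]
  have hwv : inner ℝ w v = 0 := by rw [real_inner_comm, hvw]
  rw [← sub_eq_zero]
  refine eq_zero_of_inner_eq_zero hu hv hw huv huw hvw ?_ ?_ ?_ <;>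
    simp only [inner_sub_right, inner_add_right, real_inner_smul_right, huv, huw, hvw, hvu, hwu,
      hwv, real_inner_self_eq_norm_sq] <;> field_simp <;> ring

lemma isometry_ext_of_orthogonal {u v w : E3} (hu : u ≠ 0) (hv : v ≠ 0) (hw : w ≠ 0)
    (huv : inner ℝ u v = 0) (huw : inner ℝ u w = 0) (hvw : inner ℝ v w = 0) {g k : O3}
    (h1 : g u = k u) (h2 : g v = k v) (h3 : g w = k w) : g = k := by
  ext1 x
  rw [eq_sum_of_orthogonal hu hv hw huv huw hvw x]
  simp only [map_add, map_smul, h1, h2, h3]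

/-- If all elements of `G` that fix `w` preserve the line spanned by the normal vector `u` of one of
two orthogonal mirrors through `w`, the two reflections generate the isotropy group of `w`: such an
element also preserves the line spanned by the other normal vector `v`, and is determined by its
signs on `u` and `v`. -/
lemma isotropyIsTwoOrthogonalMirrors_of_forall {G : Subgroup O3} {u v w : E3} (hu : u ≠ 0)
    (hv : v ≠ 0) (hw : w ≠ 0) (huv : inner ℝ u v = 0) (huw : inner ℝ u w = 0)
    (hvw : inner ℝ v w = 0) (hsu : (ℝ ∙ u)ᗮ.reflection ∈ G) (hsv : (ℝ ∙ v)ᗮ.reflection ∈ G)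
    (h : ∀ g ∈ G, g w = w → g u = u ∨ g u = -u) : IsotropyIsTwoOrthogonalMirrors G w := by
  have hvu : inner ℝ v u = 0 := by rw [real_inner_comm, huv]
  refine ⟨u, v, hu, hv, huv, le_antisymm ?_ ?_⟩
  · rintro _ ⟨g, hg, rfl⟩
    have hgw : (g : O3) w = w := hg
    change (g : O3) ∈ _
    have hgu := h g g.2 hgw
    have h1 : inner ℝ u ((g : O3) v) = 0 := by
      rcases hgu with h' | h'
      · rw [← h', (g : O3).inner_map_map, huv]
      · rw [← neg_eq_zero, ← inner_neg_left, ← h', (g : O3).inner_map_map, huv]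
    have h2 : inner ℝ w ((g : O3) v) = 0 := by
      rw [← hgw, (g : O3).inner_map_map, real_inner_comm, hvw]
    have h3 := eq_sum_of_orthogonal hu hv hw huv huw hvw ((g : O3) v)
    rw [h1, h2, zero_div, zero_div, zero_smul, zero_smul, zero_add, add_zero] at h3
    have hgv : (g : O3) v = v ∨ (g : O3) v = -v := by
      have h4 := congrArg norm h3
      rw [(g : O3).norm_map, norm_smul, Real.norm_eq_abs, eq_comm,
        mul_eq_right₀ (norm_ne_zero_iff.2 hv)] at h4
      rcases eq_or_eq_neg_of_abs_eq h4 with h4 | h4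
      · left; rw [h3, h4, one_smul]
      · right; rw [h3, h4, neg_one_smul]
    have hsumem := Subgroup.subset_closure (k := {(ℝ ∙ u)ᗮ.reflection, (ℝ ∙ v)ᗮ.reflection})
      (Set.mem_insert _ _)
    have hsvmem := Subgroup.subset_closure (k := {(ℝ ∙ u)ᗮ.reflection, (ℝ ∙ v)ᗮ.reflection})
      (Set.mem_insert_of_mem _ (Set.mem_singleton _))
    have hext : ∀ k : O3, (g : O3) u = k u → (g : O3) v = k v → k w = w → (g : O3) = k :=
      fun k e1 e2 e3 => isometry_ext_of_orthogonal hu hv hw huv huw hvw e1 e2 (hgw.trans e3.symm)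
    have e1 := reflection_self u
    have e2 := reflection_self v
    have e3 := reflection_of_inner_eq_zero huv
    have e4 := reflection_of_inner_eq_zero hvu
    have e5 := reflection_of_inner_eq_zero huw
    have e6 := reflection_of_inner_eq_zero hvw
    rcases hgu with hgu | hgu <;> rcases hgv with hgv | hgv
    · rw [hext 1 hgu hgv rfl]
      exact Subgroup.one_mem _
    · rw [hext _ (hgu.trans e4.symm) (hgv.trans e2.symm) e6]
      exact hsvmem
    · rw [hext _ (hgu.trans e1.symm) (hgv.trans e3.symm) e5]
      exact hsumem
    · rw [hext ((ℝ ∙ u)ᗮ.reflection * (ℝ ∙ v)ᗮ.reflection) ?_ ?_ ?_]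
      · exact Subgroup.mul_mem _ hsumem hsvmem
      · change _ = (ℝ ∙ u)ᗮ.reflection ((ℝ ∙ v)ᗮ.reflection u)
        rw [hgu, e4, e1]
      · change _ = (ℝ ∙ u)ᗮ.reflection ((ℝ ∙ v)ᗮ.reflection v)
        rw [hgv, e2, map_neg, e3]
      · change (ℝ ∙ u)ᗮ.reflection ((ℝ ∙ v)ᗮ.reflection w) = w
        rw [e6, e5]
  · rw [Subgroup.closure_le]
    rintro _ (rfl | rfl)
    · exact ⟨⟨_, hsu⟩, reflection_of_inner_eq_zero huw, rfl⟩
    · exact ⟨⟨_, hsv⟩, reflection_of_inner_eq_zero hvw, rfl⟩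

/-- The same criterion for all points whose orbit is a positive multiple of the orbit of `p`. -/
lemma isotropyIsTwoOrthogonalMirrors_of_orbit {G : Subgroup O3} {u v p x : E3} {r : ℝ}
    (hu : u ≠ 0) (hv : v ≠ 0) (hp : p ≠ 0) (huv : inner ℝ u v = 0) (hup : inner ℝ u p = 0)
    (hvp : inner ℝ v p = 0) (hsu : (ℝ ∙ u)ᗮ.reflection ∈ G) (hsv : (ℝ ∙ v)ᗮ.reflection ∈ G)
    (h : ∀ g ∈ G, g p = p → g u = u ∨ g u = -u) (hr : 0 < r)
    (hx : MulAction.orbit G x = r • MulAction.orbit G p) :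
    IsotropyIsTwoOrthogonalMirrors G x := by
  have hmem : x ∈ MulAction.orbit G (r • p) := by
    rw [orbit_smul, ← hx]
    exact MulAction.mem_orbit_self x
  obtain ⟨g, hg, rfl⟩ := mem_orbit_iff_apply.1 hmem
  have hne : ∀ z, z ≠ 0 → g z ≠ 0 := fun z hz => by rwa [Ne, LinearIsometryEquiv.map_eq_zero_iff]
  refine isotropyIsTwoOrthogonalMirrors_of_forall (u := g u) (v := g v) (hne u hu) (hne v hv)
    (hne _ (smul_ne_zero hr.ne' hp)) ?_ ?_ ?_ ?_ ?_ ?_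
  · rw [g.inner_map_map, huv]
  · rw [g.inner_map_map, real_inner_smul_right, hup, mul_zero]
  · rw [g.inner_map_map, real_inner_smul_right, hvp, mul_zero]
  · rw [reflection_apply_isometry]
    exact G.mul_mem (G.mul_mem hg hsu) (G.inv_mem hg)
  · rw [reflection_apply_isometry]
    exact G.mul_mem (G.mul_mem hg hsv) (G.inv_mem hg)
  · intro k hk hkw
    have h1 : (g⁻¹ * k * g) p = p := by
      change g.symm (k (g p)) = p
      rw [map_smul, map_smul] at hkw
      rw [smul_right_injective E3 hr.ne' hkw, g.symm_apply_apply]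
    have h2 : k (g u) = g ((g⁻¹ * k * g) u) := (g.apply_symm_apply _).symm
    rw [h2, ← map_neg]
    exact (h _ (G.mul_mem (G.mul_mem (G.inv_mem hg) hk) hg) h1).imp (congrArg g) (congrArg g)

/-- If `G` contains the sign changes and the cyclic permutations of the coordinates, a point whose
isotropy group is generated by two orthogonal reflections is a normal vector of a third mirror: the
reflection in it is the negative of the product of the other two. Moreover the isotropy group
preserves the lines normal to the first two mirrors. -/
lemma IsotropyIsTwoOrthogonalMirrors.reflection_mem {G : Subgroup O3}
    (hs : ∀ s, signIso s ∈ G) (hc : permIso (finRotate 3) ∈ G) {x : E3}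
    (h : IsotropyIsTwoOrthogonalMirrors G x) :
    x ≠ 0 ∧ (ℝ ∙ x)ᗮ.reflection ∈ G ∧
      ∃ u : E3, u ≠ 0 ∧ inner ℝ u x = 0 ∧ ∀ g ∈ G, g x = x → g u = u ∨ g u = -u := by
  obtain ⟨u, v, hu, hv, huv, hstab⟩ := h
  have hvu : inner ℝ v u = 0 := by rw [real_inner_comm, huv]
  have hmem : ∀ k ∈ Subgroup.closure {(ℝ ∙ u)ᗮ.reflection, (ℝ ∙ v)ᗮ.reflection},
      k ∈ G ∧ k x = x := by
    intro k hk
    rw [← hstab] at hk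
    obtain ⟨g, hg, rfl⟩ := hk
    exact ⟨g.2, hg⟩
  obtain ⟨hsu, hux⟩ := hmem _ (Subgroup.subset_closure (Set.mem_insert _ _))
  obtain ⟨hsv, hvx⟩ := hmem _ (Subgroup.subset_closure
    (Set.mem_insert_of_mem _ (Set.mem_singleton _)))
  have hux' := inner_eq_zero_of_reflection hu hux
  have hvx' := inner_eq_zero_of_reflection hv hvx
  have hpm : ∀ g ∈ G, g x = x → g u = u ∨ g u = -u := by
    intro g hg hgx
    have hgmem : g ∈ Subgroup.closure {(ℝ ∙ u)ᗮ.reflection, (ℝ ∙ v)ᗮ.reflection} := by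
      rw [← hstab]
      exact ⟨⟨g, hg⟩, hgx, rfl⟩
    refine Subgroup.closure_induction (p := fun g _ => g u = u ∨ g u = -u) ?_ (Or.inl rfl) ?_ ?_
      hgmem
    · rintro _ (rfl | rfl)
      · exact Or.inr (reflection_self u)
      · exact Or.inl (reflection_of_inner_eq_zero hvu)
    · rintro a b - - ha hb
      change a (b u) = u ∨ a (b u) = -u
      rcases hb with hb | hb <;> rcases ha with ha | ha <;> simp [ha, hb]
    · rintro a - ha
      change a.symm u = u ∨ a.symm u = -u
      rcases ha with ha | ha
      · left
        rw [a.symm_apply_eq, ha]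
      · right
        rw [a.symm_apply_eq, map_neg, ha, neg_neg]
  have hx : x ≠ 0 := by
    rintro rfl
    have h1 := hpm _ hc (map_zero _)
    have h2 := hpm _ (hs fun i => decide (i = 0)) (map_zero _)
    have c0 : u 1 = u 0 ∨ u 1 = -u 0 := h1.imp (congrArg fun z : E3 => z 0)
      (congrArg fun z : E3 => z 0)
    have c1 : u 2 = u 1 ∨ u 2 = -u 1 := h1.imp (congrArg fun z : E3 => z 1)
      (congrArg fun z : E3 => z 1)
    have s0 : u 0 = 0 ∨ u 1 = 0 := by
      rcases h2 with h2 | h2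
      · left
        have := congrArg (fun z : E3 => z 0) h2
        simp at this
        linarith
      · right
        have := congrArg (fun z : E3 => z 1) h2
        simp at this
        linarith
    have u1 : u 1 = 0 := by
      rcases s0 with s0 | s0
      · rcases c0 with c0 | c0 <;> simp [c0, s0]
      · exact s0
    have u0 : u 0 = 0 := by rcases c0 with c0 | c0 <;> rw [u1] at c0 <;> linarith
    have u2 : u 2 = 0 := by rcases c1 with c1 | c1 <;> rw [c1, u1]; simp
    exact hu (E3.ext3 u0 u1 u2)
  refine ⟨hx, ?_, u, hu, hux', hpm⟩
  have hneg : ∀ z, signIso (fun _ => true) z = -z := fun z => by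
    ext i
    simp
  have : (ℝ ∙ x)ᗮ.reflection =
      signIso (fun _ => true) * ((ℝ ∙ u)ᗮ.reflection * (ℝ ∙ v)ᗮ.reflection) := by
    refine isometry_ext_of_orthogonal hu hv hx huv hux' hvx' ?_ ?_ ?_
    · change _ = signIso (fun _ => true) ((ℝ ∙ u)ᗮ.reflection ((ℝ ∙ v)ᗮ.reflection u))
      rw [reflection_of_inner_eq_zero hvu, reflection_self, hneg, neg_neg,
        reflection_of_inner_eq_zero (by rw [real_inner_comm, hux'])]
    · change _ = signIso (fun _ => true) ((ℝ ∙ u)ᗮ.reflection ((ℝ ∙ v)ᗮ.reflection v))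
      rw [reflection_self, map_neg, reflection_of_inner_eq_zero huv, hneg, neg_neg,
        reflection_of_inner_eq_zero (by rw [real_inner_comm, hvx'])]
    · change _ = signIso (fun _ => true) ((ℝ ∙ u)ᗮ.reflection ((ℝ ∙ v)ᗮ.reflection x))
      rw [hvx, hux, hneg, reflection_self]
  rw [this]
  exact G.mul_mem (hs _) (G.mul_mem hsu hsv)

/-- If `-1` belongs to `G`, the sign of a multiple does not matter for its orbit. -/
lemma orbit_eq_smul_of_eq_smul {G : Subgroup O3} (hs : ∀ s, signIso s ∈ G) {x p : E3} {c : ℝ}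
    (hc : c ≠ 0) (h : ∃ g ∈ G, x = c • g p) :
    ∃ r : ℝ, 0 < r ∧ MulAction.orbit G x = r • MulAction.orbit G p := by
  obtain ⟨g, hg, rfl⟩ := h
  refine ⟨|c|, abs_pos.2 hc, ?_⟩
  rw [← orbit_smul, MulAction.orbit_eq_iff, mem_orbit_iff_apply]
  rcases abs_choice c with h | h <;> rw [h]
  · exact ⟨g, hg, map_smul _ _ _⟩
  · refine ⟨signIso (fun _ => true) * g, G.mul_mem (hs _) hg, ?_⟩
    change signIso (fun _ => true) (g (-c • p)) = _
    ext i
    simp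

theorem isotropyIsTwoOrthogonalMirrors_Ih_iff (x : E3) :
    IsotropyIsTwoOrthogonalMirrors Ih x ↔
      ∃ r : ℝ, 0 < r ∧ MulAction.orbit Ih x = r • icosidodecahedron := by
  rw [icosidodecahedron_eq_orbit]
  have hpos := Real.goldenRatio_pos
  constructor
  · intro h
    obtain ⟨hx, hsx, -⟩ := h.reflection_mem signIso_mem_Ih cyc_mem_Ih
    obtain ⟨c, hc, hcx⟩ := exists_smul_of_reflection_mem_Ih hx hsx
    exact orbit_eq_smul_of_eq_smul signIso_mem_Ih hc hcx
  · rintro ⟨r, hr, hrx⟩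
    have hs : ∀ e : E3, ∀ s, (∀ x, (ℝ ∙ e)ᗮ.reflection x = signIso s x) →
        (ℝ ∙ e)ᗮ.reflection ∈ Ih := by
      intro e s h
      rw [LinearIsometryEquiv.ext h]
      exact signIso_mem_Ih s
    refine isotropyIsTwoOrthogonalMirrors_of_orbit (u := !₂[0, 1, 0]) (v := !₂[1, 0, 0])
      (p := !₂[0, 0, φ]) ?_ ?_ ?_ ?_ ?_ ?_ (hs _ (fun i => decide (i = 1)) fun x => ?_)
      (hs _ (fun i => decide (i = 0)) fun x => ?_) ?_ hr hrx
    · exact fun h => one_ne_zero (congrArg (fun z : E3 => z 1) h)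
    · exact fun h => one_ne_zero (congrArg (fun z : E3 => z 0) h)
    · exact fun h => hpos.ne' (congrArg (fun z : E3 => z 2) h)
    · rw [E3.inner_eq]; simp
    · rw [E3.inner_eq]; simp
    · rw [E3.inner_eq]; simp
    · rw [reflection_orthogonal_singleton_apply, E3.inner_eq, E3.norm_sq_eq]
      apply E3.ext3 <;> simp
      ring
    · rw [reflection_orthogonal_singleton_apply, E3.inner_eq, E3.norm_sq_eq]
      apply E3.ext3 <;> simp
      ring
    · -- the vertices `(0, ±1, φ)` are those closest to the third axis
      intro g hg hgp
      have habs := abs_of_pos hpos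
      have hsq := Real.goldenRatio_sq
      have hlt := Real.one_lt_goldenRatio
      have hz : ∀ y ∈ icosahedron, y 2 = φ → g y 0 = 0 ∧ |g y 1| = 1 ∧ g y 2 = φ := by
        intro y hy hy2
        have h1 : inner ℝ (g !₂[0, 0, φ]) (g y) = inner ℝ !₂[0, 0, φ] y := g.inner_map_map _ _
        rw [hgp, E3.inner_eq, E3.inner_eq, hy2] at h1
        have h2 : g y 2 = φ := by
          change 0 * _ + 0 * _ + φ * _ = 0 * _ + 0 * _ + φ * φ at h1
          exact mul_left_cancel₀ hpos.ne' (by linear_combination h1)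
        rcases mem_icosahedron_iff.1 (apply_mem_of_mem_symmetryGroup hg hy) with
          ⟨e0, e1, -⟩ | ⟨-, e, -⟩ | ⟨e, -, -⟩
        · exact ⟨e0, e1, h2⟩
        · rw [h2, habs] at e
          exact absurd e hlt.ne'
        · rw [h2] at e
          exact absurd e hpos.ne'
      obtain ⟨a0, a1, a2⟩ := hz !₂[0, 1, φ] vertex_mem_icosahedron rfl
      have hdiff : (!₂[0, 1, 0] : E3) = !₂[0, 1, φ] - !₂[0, 0, φ] := by
        apply E3.ext3 <;> simp
      have hg1 : g !₂[0, 1, 0] = g !₂[0, 1, φ] - !₂[0, 0, φ] := by rw [hdiff, map_sub, hgp]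
      rw [hg1]
      rcases eq_or_eq_neg_of_abs_eq a1 with a1 | a1
      · left
        apply E3.ext3 <;> simp [a0, a1, a2]
      · right
        apply E3.ext3 <;> simp [a0, a1, a2]

theorem isotropyIsTwoOrthogonalMirrors_Oh_iff (x : E3) :
    IsotropyIsTwoOrthogonalMirrors Oh x ↔
      ∃ r : ℝ, 0 < r ∧ MulAction.orbit Oh x = r • cuboctahedron := by
  rw [cuboctahedron_eq_orbit]
  constructor
  · intro h
    obtain ⟨hx, hsx, u, hu, hux, hpm⟩ := h.reflection_mem signIso_mem_Oh (permIso_mem_Oh _)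
    rcases exists_smul_of_reflection_mem_Oh hx hsx with ⟨i, hi⟩ | ⟨c, hc, hcx⟩
    · -- the isotropy group of a point on a coordinate axis does not preserve any other line
      exfalso
      obtain ⟨j, k, hji, hki, hjk, hall⟩ : ∃ j k : Fin 3, j ≠ i ∧ k ≠ i ∧ j ≠ k ∧
          ∀ l, l = i ∨ l = j ∨ l = k := by
        clear hi
        revert i
        decide
      have hxi : x i ≠ 0 := by
        intro h0
        refine hx ?_
        ext l
        by_cases hl : l = i
        · rw [hl, h0]; rfl
        · rw [hi l hl]; rfl
      have hui : u i = 0 := by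
        have h1 : inner ℝ u x = u i * x i := by
          rw [PiLp.inner_apply, Finset.sum_eq_single i]
          · simp [mul_comm]
          · intro l _ hl
            simp [hi l hl]
          · simp
        rw [h1] at hux
        exact (mul_eq_zero.1 hux).resolve_right hxi
      have h1 := hpm _ (signIso_mem_Oh fun l => decide (l = j)) (by
        ext l
        rw [signIso_apply]
        by_cases hl : l = j
        · simp [hl, hi j hji]
        · simp [hl])
      have h2 := hpm _ (permIso_mem_Oh (Equiv.swap j k)) (by
        ext l
        rw [permIso_apply]
        rcases hall l with rfl | rfl | rfl
        · rw [Equiv.swap_apply_of_ne_of_ne hji.symm hki.symm]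
        · rw [Equiv.swap_apply_left, hi _ hji, hi _ hki]
        · rw [Equiv.swap_apply_right, hi _ hji, hi _ hki])
      have s0 : u j = 0 ∨ u k = 0 := by
        rcases h1 with h1 | h1
        · left
          have := congrArg (fun z : E3 => z j) h1
          simp at this
          linarith
        · right
          have := congrArg (fun z : E3 => z k) h1
          simp [hjk.symm] at this
          linarith
      have p0 : u k = u j ∨ u k = -u j := by
        refine h2.imp (fun h => ?_) fun h => ?_
        · simpa using congrArg (fun z : E3 => z j) h
        · simpa using congrArg (fun z : E3 => z j) h
      have huj : u j = 0 := by
        rcases s0 with s0 | s0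
        · exact s0
        · rcases p0 with p0 | p0 <;> linarith
      have huk : u k = 0 := by rcases p0 with p0 | p0 <;> linarith
      refine hu ?_
      ext l
      rcases hall l with rfl | rfl | rfl <;> assumption
    · exact orbit_eq_smul_of_eq_smul signIso_mem_Oh hc hcx
  · rintro ⟨r, hr, hrx⟩
    refine isotropyIsTwoOrthogonalMirrors_of_orbit (u := !₂[1, 0, 0]) (v := !₂[0, 1, -1])
      (p := !₂[0, 1, 1]) ?_ ?_ ?_ ?_ ?_ ?_ ?_ ?_ ?_ hr hrx
    · exact fun h => one_ne_zero (congrArg (fun z : E3 => z 0) h)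
    · exact fun h => one_ne_zero (congrArg (fun z : E3 => z 1) h)
    · exact fun h => one_ne_zero (congrArg (fun z : E3 => z 1) h)
    · rw [E3.inner_eq]; simp
    · rw [E3.inner_eq]; simp
    · rw [E3.inner_eq]; simp
    · have : (ℝ ∙ (!₂[1, 0, 0] : E3))ᗮ.reflection = signIso fun i => decide (i = 0) := by
        ext1 x
        rw [reflection_orthogonal_singleton_apply, E3.inner_eq, E3.norm_sq_eq]
        apply E3.ext3 <;> simp
        ring
      rw [this]
      exact signIso_mem_Oh _
    · have : (ℝ ∙ (!₂[0, 1, -1] : E3))ᗮ.reflection = permIso (Equiv.swap 1 2) := by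
        ext1 x
        rw [reflection_orthogonal_singleton_apply, E3.inner_eq, E3.norm_sq_eq]
        apply E3.ext3 <;> simp
        · rfl
        · ring
        · ring
      rw [this]
      exact permIso_mem_Oh _
    · -- the vertices `(±1, 1, 1)` are those closest to `(0, 1, 1)`
      intro g hg hgp
      have hmem : (!₂[1, 1, 1] : E3) ∈ cube := fun i => by fin_cases i <;> simp
      have hg1 := apply_mem_of_mem_symmetryGroup hg hmem
      have h1 : inner ℝ (g !₂[0, 1, 1]) (g !₂[1, 1, 1]) = inner ℝ (!₂[0, 1, 1] : E3) !₂[1, 1, 1] :=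
        g.inner_map_map _ _
      rw [hgp, E3.inner_eq, E3.inner_eq] at h1
      simp at h1
      have hle : ∀ i, g !₂[1, 1, 1] i ≤ 1 := fun i => (le_abs_self _).trans (hg1 i).le
      have e1 : g !₂[1, 1, 1] 1 = 1 := by linarith [hle 1, hle 2]
      have e2 : g !₂[1, 1, 1] 2 = 1 := by linarith [hle 1, hle 2]
      have hdiff : (!₂[1, 0, 0] : E3) = !₂[1, 1, 1] - !₂[0, 1, 1] := by
        apply E3.ext3 <;> simp
      have hg2 : g !₂[1, 0, 0] = g !₂[1, 1, 1] - !₂[0, 1, 1] := by rw [hdiff, map_sub, hgp]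
      rw [hg2]
      rcases eq_or_eq_neg_of_abs_eq (hg1 0) with a | a
      · left
        apply E3.ext3 <;> simp [a, e1, e2]
      · right
        apply E3.ext3 <;> simp [a, e1, e2]

/-! ### Equality patterns of four real numbers -/

/-- The five ways in which four numbers can be equal or distinct, up to permutation. -/
def valuePattern : Fin 5 → Fin 4 → Fin 4 :=
  ![![0, 0, 0, 0], ![1, 0, 0, 0], ![0, 0, 1, 1], ![0, 0, 1, 2], ![0, 1, 2, 3]]

/-- The permutations that preserve the function `c`. -/
def patternStabilizer (c : Fin 4 → Fin 4) : Subgroup (Equiv.Perm (Fin 4)) where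
  carrier := {σ | ∀ i, c (σ i) = c i}
  one_mem' _ := rfl
  mul_mem' {_ τ} hσ hτ i := (hσ (τ i)).trans (hτ i)
  inv_mem' {σ} hσ i := by simpa using (hσ (σ⁻¹ i)).symm

/-- The orders of the stabilizers of the five patterns. -/
def patternOrder : Fin 5 → ℕ := ![24, 6, 4, 2, 1]

lemma patternOrder_injective : Function.Injective patternOrder := by decide

lemma card_patternStabilizer (k : Fin 5) :
    Nat.card (patternStabilizer (valuePattern k)) = patternOrder k := by
  have : ∀ k, Fintype.card {σ : Equiv.Perm (Fin 4) // ∀ i, valuePattern k (σ i) = valuePattern k i}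
      = patternOrder k := by decide
  rw [← this, ← Nat.card_eq_fintype_card]
  rfl

lemma exists_valuePattern_of_le {b : Fin 4 → ℝ} (h01 : b 0 ≤ b 1) (h12 : b 1 ≤ b 2)
    (h23 : b 2 ≤ b 3) : ∃ (k : Fin 5) (σ : Equiv.Perm (Fin 4)), ∀ i j,
      b (σ i) = b (σ j) ↔ valuePattern k i = valuePattern k j := by
  -- `v` lists the distinct values, followed by further numbers
  have key : ∀ (k : Fin 5) (σ : Equiv.Perm (Fin 4)) (v : Fin 4 → ℝ),
      (v 0 ≠ v 1 ∧ v 0 ≠ v 2 ∧ v 0 ≠ v 3 ∧ v 1 ≠ v 2 ∧ v 1 ≠ v 3 ∧ v 2 ≠ v 3) →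
      (∀ i, b (σ i) = v (valuePattern k i)) → ∃ (k : Fin 5) (σ : Equiv.Perm (Fin 4)), ∀ i j,
        b (σ i) = b (σ j) ↔ valuePattern k i = valuePattern k j := by
    rintro k σ v ⟨n01, n02, n03, n12, n13, n23⟩ hb
    have hv : Function.Injective v := by
      intro i j h
      by_contra hij
      fin_cases i <;> fin_cases j <;> first | exact hij rfl | exact absurd h (by assumption) |
        exact absurd h.symm (by assumption)
    exact ⟨k, σ, fun i j => by rw [hb, hb, hv.eq_iff]⟩
  rcases h01.eq_or_lt with h01 | h01 <;> rcases h12.eq_or_lt with h12 | h12 <;>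
    rcases h23.eq_or_lt with h23 | h23
  · refine key 0 1 ![b 0, b 0 + 1, b 0 + 2, b 0 + 3] ?_ fun i => ?_
    · refine ⟨?_, ?_, ?_, ?_, ?_, ?_⟩ <;> simp
    · fin_cases i
      exacts [rfl, h01.symm, (h01.trans h12).symm, ((h01.trans h12).trans h23).symm]
  · refine key 1 (Equiv.swap 0 3) ![b 0, b 3, b 3 + 1, b 3 + 2] ?_ fun i => ?_
    · refine ⟨?_, ?_, ?_, ?_, ?_, ?_⟩ <;> refine ne_of_lt ?_ <;> simp <;> linarith
    · fin_cases i
      exacts [rfl, h01.symm, (h01.trans h12).symm, rfl]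
  · refine key 2 1 ![b 0, b 2, b 2 + 1, b 2 + 2] ?_ fun i => ?_
    · refine ⟨?_, ?_, ?_, ?_, ?_, ?_⟩ <;> refine ne_of_lt ?_ <;> simp <;> linarith
    · fin_cases i
      exacts [rfl, h01.symm, rfl, h23.symm]
  · refine key 3 1 ![b 0, b 2, b 3, b 3 + 1] ?_ fun i => ?_
    · refine ⟨?_, ?_, ?_, ?_, ?_, ?_⟩ <;> refine ne_of_lt ?_ <;> simp <;> linarith
    · fin_cases i
      exacts [rfl, h01.symm, rfl, rfl]
  · refine key 1 1 ![b 1, b 0, b 1 + 1, b 1 + 2] ?_ fun i => ?_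
    · refine ⟨h01.ne', ?_, ?_, ?_, ?_, ?_⟩ <;> refine ne_of_lt ?_ <;> simp <;> linarith
    · fin_cases i
      exacts [rfl, rfl, h12.symm, (h12.trans h23).symm]
  · refine key 3 (Equiv.swap 0 2) ![b 1, b 0, b 3, b 3 + 1] ?_ fun i => ?_
    · refine ⟨h01.ne', ?_, ?_, ?_, ?_, ?_⟩ <;> refine ne_of_lt ?_ <;> simp <;> linarith
    · fin_cases i
      exacts [h12.symm, rfl, rfl, rfl]
  · refine key 3 (Equiv.swap 0 2 * Equiv.swap 1 3) ![b 2, b 0, b 1, b 3 + 1] ?_ fun i => ?_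
    · refine ⟨(h01.trans h12).ne', h12.ne', ?_, ?_, ?_, ?_⟩ <;> refine ne_of_lt ?_ <;> simp <;>
        linarith
    · fin_cases i
      exacts [rfl, h23.symm, rfl, rfl]
  · refine key 4 1 ![b 0, b 1, b 2, b 3] ?_ fun i => ?_
    · refine ⟨?_, ?_, ?_, ?_, ?_, ?_⟩ <;> refine ne_of_lt ?_ <;> simp <;> linarith
    · fin_cases i
      exacts [rfl, rfl, rfl, rfl]

lemma exists_valuePattern (a : Fin 4 → ℝ) : ∃ (k : Fin 5) (σ : Equiv.Perm (Fin 4)), ∀ i j,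
    a (σ i) = a (σ j) ↔ valuePattern k i = valuePattern k j := by
  have hmono := Tuple.monotone_sort a
  obtain ⟨k, σ, h⟩ := exists_valuePattern_of_le (hmono (by decide : (0 : Fin 4) ≤ 1))
    (hmono (by decide : (1 : Fin 4) ≤ 2)) (hmono (by decide : (2 : Fin 4) ≤ 3))
  exact ⟨k, Tuple.sort a * σ, h⟩

/-! ### The tetrahedral group as the symmetric group on the vertices -/

/-- The vertices of the tetrahedron. -/
noncomputable def tetraVertex : Fin 4 → E3 :=
  ![!₂[1, 1, 1], !₂[1, -1, -1], !₂[-1, 1, -1], !₂[-1, -1, 1]]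

/-- The inner products with the four vertices of the tetrahedron, which serve as coordinates with
sum `0`. The tetrahedral group permutes them. -/
noncomputable def tetraCoord (x : E3) : Fin 4 → ℝ :=
  ![x 0 + x 1 + x 2, x 0 - x 1 - x 2, -x 0 + x 1 - x 2, -x 0 - x 1 + x 2]

lemma tetraCoord_eq_inner (x : E3) (i : Fin 4) : tetraCoord x i = inner ℝ (tetraVertex i) x := by
  rw [E3.inner_eq]
  fin_cases i <;> simp [tetraCoord, tetraVertex] <;> ring

lemma tetraCoord_injective : Function.Injective tetraCoord := by
  intro x y h
  have h0 : x 0 + x 1 + x 2 = y 0 + y 1 + y 2 := congrFun h 0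
  have h1 : x 0 - x 1 - x 2 = y 0 - y 1 - y 2 := congrFun h 1
  have h2 : -x 0 + x 1 - x 2 = -y 0 + y 1 - y 2 := congrFun h 2
  exact E3.ext3 (by linarith) (by linarith) (by linarith)

lemma tetraCoord_tetraVertex (i j : Fin 4) :
    tetraCoord (tetraVertex i) j = if i = j then 3 else -1 := by
  fin_cases i <;> fin_cases j <;> simp [tetraCoord, tetraVertex] <;> norm_num

lemma sum_tetraCoord (x : E3) : ∑ i, tetraCoord x i = 0 := by
  rw [Fin.sum_univ_four]
  simp [tetraCoord]
  ring

lemma norm_sq_eq_sum_tetraCoord (x : E3) : ‖x‖ ^ 2 = (∑ i, tetraCoord x i ^ 2) / 4 := by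
  rw [E3.norm_sq_eq, Fin.sum_univ_four]
  simp [tetraCoord]
  ring

/-- `tetraCoord` as a linear map. -/
noncomputable def tetraCoordLinear : E3 →ₗ[ℝ] Fin 4 → ℝ where
  toFun := tetraCoord
  map_add' x y := by
    ext i
    simp only [tetraCoord_eq_inner, inner_add_right, Pi.add_apply]
  map_smul' c x := by
    ext i
    simp only [tetraCoord_eq_inner, real_inner_smul_right, RingHom.id_apply, Pi.smul_apply,
      smul_eq_mul]

lemma tetraCoord_sum_smul (σ : Equiv.Perm (Fin 4)) (x : E3) (i : Fin 4) :
    tetraCoord ((1 / 4 : ℝ) • ∑ j, tetraCoord x j • tetraVertex (σ j)) (σ i) = tetraCoord x i := by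
  have h1 : tetraCoord ((1 / 4 : ℝ) • ∑ j, tetraCoord x j • tetraVertex (σ j)) =
      (1 / 4 : ℝ) • ∑ j, tetraCoord x j • tetraCoord (tetraVertex (σ j)) := by
    change tetraCoordLinear _ = (1 / 4 : ℝ) • ∑ j, tetraCoord x j • tetraCoordLinear _
    simp
  rw [h1]
  simp only [Pi.smul_apply, Finset.sum_apply, tetraCoord_tetraVertex, smul_eq_mul,
    σ.injective.eq_iff]
  have h2 : ∀ j, tetraCoord x j * (if j = i then (3 : ℝ) else -1) =
      (if j = i then 4 * tetraCoord x j else 0) - tetraCoord x j := by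
    intro j
    split_ifs <;> ring
  simp only [h2, Finset.sum_sub_distrib, sum_tetraCoord, Finset.sum_ite_eq', Finset.mem_univ,
    if_true]
  ring

/-- The isometry that permutes the vertices `v j` of the tetrahedron by `σ`. Its formula comes from
the expansion of `x` as `1 / 4` times the sum of the vectors `⟪v j, x⟫ • v j`. -/
noncomputable def tetraIso (σ : Equiv.Perm (Fin 4)) : O3 :=
  LinearIsometry.toLinearIsometryEquiv
    { toFun := fun x => (1 / 4 : ℝ) • ∑ j, tetraCoord x j • tetraVertex (σ j)
      map_add' := fun x y => by
        change (1 / 4 : ℝ) • ∑ j, tetraCoordLinear (x + y) j • _ =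
          (1 / 4 : ℝ) • ∑ j, tetraCoordLinear x j • _ + (1 / 4 : ℝ) • ∑ j, tetraCoordLinear y j • _
        simp [add_smul, Finset.sum_add_distrib]
      map_smul' := fun c x => by
        change (1 / 4 : ℝ) • ∑ j, tetraCoordLinear (c • x) j • _ =
          c • ((1 / 4 : ℝ) • ∑ j, tetraCoordLinear x j • _)
        simp [mul_smul, Finset.smul_sum, smul_comm c]
      norm_map' := fun x => by
        refine (sq_eq_sq₀ (norm_nonneg _) (norm_nonneg _)).1 ?_
        rw [norm_sq_eq_sum_tetraCoord, norm_sq_eq_sum_tetraCoord x, ← Equiv.sum_comp σ]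
        congr 1
        refine Finset.sum_congr rfl fun i _ => congrArg (· ^ 2) ?_
        exact tetraCoord_sum_smul σ x i } rfl

lemma tetraCoord_tetraIso (σ : Equiv.Perm (Fin 4)) (x : E3) (i : Fin 4) :
    tetraCoord (tetraIso σ x) (σ i) = tetraCoord x i := tetraCoord_sum_smul σ x i

lemma tetraIso_eq_iff {σ : Equiv.Perm (Fin 4)} {x y : E3} :
    tetraIso σ x = y ↔ ∀ i, tetraCoord y (σ i) = tetraCoord x i := by
  refine ⟨fun h i => by rw [← h, tetraCoord_tetraIso], fun h => tetraCoord_injective ?_⟩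
  ext i
  obtain ⟨j, rfl⟩ := σ.surjective i
  rw [tetraCoord_tetraIso, h]

lemma tetraIso_tetraVertex (σ : Equiv.Perm (Fin 4)) (i : Fin 4) :
    tetraIso σ (tetraVertex i) = tetraVertex (σ i) := by
  refine tetraIso_eq_iff.2 fun j => ?_
  simp only [tetraCoord_tetraVertex, σ.injective.eq_iff]

lemma tetraVertex_mem (i : Fin 4) : tetraVertex i ∈ tetrahedron := by
  refine ⟨fun j => ?_, ?_⟩
  · fin_cases i <;> fin_cases j <;> simp [tetraVertex]
  · fin_cases i <;> simp [tetraVertex]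

lemma exists_tetraVertex_eq {x : E3} (hx : x ∈ tetrahedron) : ∃ i, tetraVertex i = x := by
  obtain ⟨h, hprod⟩ := hx
  rcases eq_or_eq_neg_of_abs_eq (h 0) with h0 | h0 <;>
    rcases eq_or_eq_neg_of_abs_eq (h 1) with h1 | h1 <;>
    rcases eq_or_eq_neg_of_abs_eq (h 2) with h2 | h2 <;> rw [h0, h1, h2] at hprod
  · exact ⟨0, E3.ext3 h0.symm h1.symm h2.symm⟩
  · norm_num at hprod
  · norm_num at hprod
  · exact ⟨1, E3.ext3 h0.symm h1.symm h2.symm⟩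
  · norm_num at hprod
  · exact ⟨2, E3.ext3 h0.symm h1.symm h2.symm⟩
  · exact ⟨3, E3.ext3 h0.symm h1.symm h2.symm⟩
  · norm_num at hprod

lemma tetraVertex_injective : Function.Injective tetraVertex := by
  intro i j h
  have h1 := tetraCoord_tetraVertex i j
  rw [h, tetraCoord_tetraVertex, if_pos rfl] at h1
  by_contra hij
  rw [if_neg hij] at h1
  norm_num at h1

lemma tetraIso_mem_Td (σ : Equiv.Perm (Fin 4)) : tetraIso σ ∈ Td := by
  refine mem_symmetryGroup_of_mapsTo finite_tetrahedron fun x hx => ?_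
  obtain ⟨i, rfl⟩ := exists_tetraVertex_eq hx
  rw [tetraIso_tetraVertex]
  exact tetraVertex_mem _

lemma tetraIso_mul (σ τ : Equiv.Perm (Fin 4)) : tetraIso (σ * τ) = tetraIso σ * tetraIso τ := by
  ext1 x
  refine tetraIso_eq_iff.2 fun i => ?_
  change tetraCoord (tetraIso σ (tetraIso τ x)) (σ (τ i)) = _
  rw [tetraCoord_tetraIso, tetraCoord_tetraIso]

lemma exists_tetraIso_eq {g : O3} (hg : g ∈ Td) : ∃ σ, tetraIso σ = g := by
  choose f hf using fun i => exists_tetraVertex_eq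
    (apply_mem_of_mem_symmetryGroup hg (tetraVertex_mem i))
  have hinj : Function.Injective f := fun i j hij => tetraVertex_injective (g.injective (by
    rw [← hf, ← hf, hij]))
  refine ⟨Equiv.ofBijective f (Finite.injective_iff_bijective.1 hinj), ?_⟩
  ext1 x
  refine tetraIso_eq_iff.2 fun i => ?_
  rw [Equiv.ofBijective_apply, tetraCoord_eq_inner, hf, g.inner_map_map, tetraCoord_eq_inner]

/-- The isomorphism of the symmetric group on the vertices with the tetrahedral group. -/
noncomputable def tetraEquiv : Equiv.Perm (Fin 4) ≃* Td :=
  MulEquiv.ofBijective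
    (MonoidHom.mk' (fun σ => (⟨tetraIso σ, tetraIso_mem_Td σ⟩ : Td))
      fun σ τ => Subtype.ext (tetraIso_mul σ τ))
    ⟨fun σ τ h => Equiv.ext fun i => tetraVertex_injective (by
      have h' : tetraIso σ = tetraIso τ := Subtype.ext_iff.1 h
      rw [← tetraIso_tetraVertex, h', tetraIso_tetraVertex]),
    fun g => by
      obtain ⟨σ, hσ⟩ := exists_tetraIso_eq g.2
      exact ⟨σ, Subtype.ext hσ⟩⟩

lemma coe_tetraEquiv (σ : Equiv.Perm (Fin 4)) : (tetraEquiv σ : O3) = tetraIso σ := rfl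

lemma card_Td : Nat.card Td = 24 := by
  rw [← Nat.card_congr tetraEquiv.toEquiv, Nat.card_eq_fintype_card, Fintype.card_perm]
  rfl

/-! ### Orbit types of the tetrahedral group -/

/-- The isotropy group of the points whose coordinates have the `k`-th pattern. -/
noncomputable def tetraIsotropy (k : Fin 5) : Subgroup Td :=
  (patternStabilizer (valuePattern k)).map (tetraEquiv : Equiv.Perm (Fin 4) →* Td)

lemma card_tetraIsotropy (k : Fin 5) : Nat.card (tetraIsotropy k) = patternOrder k := by
  rw [← card_patternStabilizer]
  exact (Nat.card_congr (tetraEquiv.subgroupMap _).toEquiv).symm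

/-- As the tetrahedral group permutes the four coordinates, the isotropy group of a point depends
only on which of its coordinates are equal. -/
lemma stabilizer_eq_tetraIsotropy {x : E3} {k : Fin 5}
    (h : ∀ i j, tetraCoord x i = tetraCoord x j ↔ valuePattern k i = valuePattern k j) :
    MulAction.stabilizer Td x = tetraIsotropy k := by
  ext g
  obtain ⟨σ, rfl⟩ := tetraEquiv.surjective g
  rw [mem_stabilizer_iff_apply, coe_tetraEquiv, tetraIso_eq_iff, tetraIsotropy,
    Subgroup.mem_map]
  simp only [h]
  constructor
  · intro hσ
    exact ⟨σ, hσ, rfl⟩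
  · rintro ⟨τ, hτ, hτσ⟩
    rw [← tetraEquiv.injective hτσ]
    exact hτ

lemma exists_stabilizer_eq (x : E3) :
    ∃ k, ∃ g ∈ Td, MulAction.stabilizer Td (g x) = tetraIsotropy k := by
  obtain ⟨k, σ, h⟩ := exists_valuePattern (tetraCoord x)
  refine ⟨k, tetraIso σ⁻¹, tetraIso_mem_Td _, stabilizer_eq_tetraIsotropy fun i j => ?_⟩
  have h1 : ∀ i, tetraCoord (tetraIso σ⁻¹ x) i = tetraCoord x (σ i) := fun i => by
    rw [← tetraCoord_tetraIso σ⁻¹ x (σ i),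
      show σ⁻¹ (σ i) = i from σ.symm_apply_apply i]
  rw [h1, h1, h]

/-- A point of each orbit type. -/
noncomputable def tetraPoint : Fin 5 → E3 :=
  ![0, !₂[1, 1, 1], !₂[1, 0, 0], !₂[0, 1, -1], !₂[0, 1, 2]]

lemma stabilizer_tetraPoint (k : Fin 5) :
    MulAction.stabilizer Td (tetraPoint k) = tetraIsotropy k := by
  refine stabilizer_eq_tetraIsotropy fun i j => ?_
  have h : ∀ i, tetraCoord (tetraPoint k) i = (((![![0, 0, 0, 0], ![3, -1, -1, -1], ![1, 1, -1, -1],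
      ![0, 0, 2, -2], ![3, -3, -1, 1]] : Fin 5 → Fin 4 → ℤ) k i : ℤ) : ℝ) := by
    intro i
    fin_cases k <;> fin_cases i <;> simp [tetraCoord, tetraPoint] <;> norm_num
  rw [h, h, Int.cast_inj]
  clear h
  revert k i j
  decide

lemma exists_stabilizer_eq_map_conj {G : Subgroup O3} {x y : E3}
    (h : orbitType G x = orbitType G y) :
    ∃ g : G, MulAction.stabilizer G x =
      (MulAction.stabilizer G y).map (MulAut.conj g).toMonoidHom := by
  have := stabilizer_mem_orbitType (G := G) x
  rw [h] at this
  exact this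

/-- Points of the same orbit type have isomorphic isotropy groups. -/
lemma nonempty_mulEquiv_stabilizer {G : Subgroup O3} {x y : E3}
    (h : orbitType G x = orbitType G y) :
    Nonempty (MulAction.stabilizer G x ≃* MulAction.stabilizer G y) := by
  obtain ⟨g, hg⟩ := exists_stabilizer_eq_map_conj h
  rw [hg]
  exact ⟨((MulAut.conj g).subgroupMap _).symm⟩

/-- The orbit types are distinguished by the orders of the isotropy groups. -/
lemma exists_stabilizer_eq_of_card {x : E3} {k : Fin 5}
    (h : Nat.card (MulAction.stabilizer Td x) = patternOrder k) :
    ∃ g ∈ Td, MulAction.stabilizer Td (g x) = tetraIsotropy k := by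
  obtain ⟨l, g, hg, hl⟩ := exists_stabilizer_eq x
  have h1 : orbitType Td (g x) = orbitType Td x :=
    orbitType_eq_of_mem_orbit (mem_orbit_iff_apply.2 ⟨g, hg, rfl⟩)
  obtain ⟨e⟩ := nonempty_mulEquiv_stabilizer h1
  have h2 := Nat.card_congr e.toEquiv
  rw [hl, card_tetraIsotropy, h] at h2
  rw [← patternOrder_injective h2]
  exact ⟨g, hg, hl⟩

lemma orbitType_eq_tetraPoint_iff {x : E3} {k : Fin 5} :
    orbitType Td x = orbitType Td (tetraPoint k) ↔
      Nat.card (MulAction.stabilizer Td x) = patternOrder k := by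
  constructor
  · intro h
    obtain ⟨e⟩ := nonempty_mulEquiv_stabilizer h
    rw [Nat.card_congr e.toEquiv, stabilizer_tetraPoint, card_tetraIsotropy]
  · intro h
    obtain ⟨g, hg, hgx⟩ := exists_stabilizer_eq_of_card h
    rw [← orbitType_eq_of_mem_orbit (mem_orbit_iff_apply.2 ⟨g, hg, rfl⟩ : g x ∈ _)]
    exact orbitType_eq_of_stabilizer_eq (hgx.trans (stabilizer_tetraPoint k).symm)

lemma exists_card_stabilizer_eq (x : E3) :
    ∃ k, Nat.card (MulAction.stabilizer Td x) = patternOrder k := by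
  obtain ⟨k, g, hg, hk⟩ := exists_stabilizer_eq x
  obtain ⟨e⟩ := nonempty_mulEquiv_stabilizer (orbitType_eq_of_mem_orbit
    (mem_orbit_iff_apply.2 ⟨g, hg, rfl⟩) : orbitType Td (g x) = orbitType Td x)
  exact ⟨k, by rw [← Nat.card_congr e.toEquiv, hk, card_tetraIsotropy]⟩

lemma ncard_range_orbitType_Td : (Set.range (orbitType Td)).ncard = 5 := by
  have h1 : Set.range (orbitType Td) = Set.range fun k => orbitType Td (tetraPoint k) := by
    refine subset_antisymm ?_ ?_
    · rintro _ ⟨x, rfl⟩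
      obtain ⟨k, hk⟩ := exists_card_stabilizer_eq x
      exact ⟨k, (orbitType_eq_tetraPoint_iff.2 hk).symm⟩
    · rintro _ ⟨k, rfl⟩
      exact ⟨_, rfl⟩
  have h2 : Function.Injective fun k => orbitType Td (tetraPoint k) := by
    intro k l hkl
    have h3 := orbitType_eq_tetraPoint_iff.1 hkl
    rw [stabilizer_tetraPoint, card_tetraIsotropy] at h3
    exact patternOrder_injective h3
  rw [h1, ← Set.image_univ, Set.ncard_image_of_injective _ h2, Set.ncard_univ, Nat.card_fin]

lemma orbitType_Td_eq_of_mulEquiv {x y : E3}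
    (h : Nonempty (MulAction.stabilizer Td x ≃* MulAction.stabilizer Td y)) :
    orbitType Td x = orbitType Td y := by
  obtain ⟨e⟩ := h
  obtain ⟨k, hk⟩ := exists_card_stabilizer_eq y
  rw [orbitType_eq_tetraPoint_iff.2 hk, orbitType_eq_tetraPoint_iff, Nat.card_congr e.toEquiv, hk]

lemma stabilizer_Td_eq_top_iff {x : E3} : MulAction.stabilizer Td x = ⊤ ↔ x = 0 := by
  constructor
  · intro h
    refine eq_zero_of_halfTurn halfTurn_mem_Td x fun g hg => ?_
    have : (⟨g, hg⟩ : Td) ∈ MulAction.stabilizer Td x := by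
      rw [h]
      exact Subgroup.mem_top _
    exact this
  · rintro rfl
    refine (Subgroup.eq_top_iff' _).2 fun g => ?_
    exact map_zero (g : O3)

lemma ne_zero_of_card_stabilizer {x : E3} (h : Nat.card (MulAction.stabilizer Td x) ≠ 24) :
    x ≠ 0 := by
  rintro rfl
  rw [stabilizer_Td_eq_top_iff.2 rfl, Subgroup.card_top, card_Td] at h
  exact h rfl

lemma fixed_of_stabilizer_eq {x : E3} {k : Fin 5}
    (h : MulAction.stabilizer Td x = tetraIsotropy k) {g : O3} (hg : g ∈ Td)
    (hgk : g (tetraPoint k) = tetraPoint k) : g x = x := by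
  have : (⟨g, hg⟩ : Td) ∈ MulAction.stabilizer Td x := by
    rw [h, ← stabilizer_tetraPoint]
    exact hgk
  exact this

/-- The points with isotropy group of order `6` lie on the lines through the vertices. -/
lemma exists_smul_of_card_six {x : E3} (h : Nat.card (MulAction.stabilizer Td x) = 6) :
    ∃ g ∈ Td, ∃ c : ℝ, c ≠ 0 ∧ g x = c • !₂[1, 1, 1] := by
  have hx := ne_zero_of_card_stabilizer (x := x) (by rw [h]; norm_num)
  obtain ⟨g, hg, hgx⟩ := exists_stabilizer_eq_of_card (k := 1) h
  have h1 := eq_smul_of_finRotate (fixed_of_stabilizer_eq hgx (permIso_mem_Td (finRotate 3)) (by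
    apply E3.ext3 <;> simp [tetraPoint]))
  refine ⟨g, hg, _, fun h0 => hx ?_, h1⟩
  rwa [h0, zero_smul, LinearIsometryEquiv.map_eq_zero_iff] at h1

/-- The points with isotropy group of order `4` lie on the coordinate axes. -/
lemma exists_smul_of_card_four {x : E3} (h : Nat.card (MulAction.stabilizer Td x) = 4) :
    ∃ g ∈ Td, ∃ c : ℝ, c ≠ 0 ∧ g x = c • !₂[1, 0, 0] := by
  have hx := ne_zero_of_card_stabilizer (x := x) (by rw [h]; norm_num)
  obtain ⟨g, hg, hgx⟩ := exists_stabilizer_eq_of_card (k := 2) h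
  have h1 := fixed_of_stabilizer_eq hgx (halfTurn_mem_Td 0) (by
    apply E3.ext3 <;> simp [tetraPoint, halfTurn])
  have e1 := congrArg (fun z : E3 => z 1) h1
  have e2 := congrArg (fun z : E3 => z 2) h1
  simp [halfTurn] at e1 e2
  have h2 : g x = g x 0 • !₂[1, 0, 0] := by
    apply E3.ext3 <;> simp <;> linarith
  refine ⟨g, hg, _, fun h0 => hx ?_, h2⟩
  rwa [h0, zero_smul, LinearIsometryEquiv.map_eq_zero_iff] at h2

/-! ### The kinds of orbits of the tetrahedral group -/

/-- The sum of the cubes of the four coordinates, a cubic invariant which distinguishes the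
tetrahedron from its dual. -/
noncomputable def tetraCubic (x : E3) : ℝ := ∑ i, tetraCoord x i ^ 3

lemma continuous_tetraCubic : Continuous tetraCubic := by
  unfold tetraCubic
  simp only [tetraCoord_eq_inner]
  fun_prop

lemma tetraCubic_apply {g : O3} (hg : g ∈ Td) (x : E3) : tetraCubic (g x) = tetraCubic x := by
  obtain ⟨σ, rfl⟩ := exists_tetraIso_eq hg
  rw [tetraCubic, ← Equiv.sum_comp σ]
  simp only [tetraCoord_tetraIso]
  rfl

lemma tetraCubic_smul (c : ℝ) : tetraCubic (c • !₂[1, 1, 1]) = 24 * c ^ 3 := by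
  rw [tetraCubic, Fin.sum_univ_four]
  simp [tetraCoord]
  ring

lemma tetraCubic_ne_zero {x : E3} (h : Nat.card (MulAction.stabilizer Td x) = 6) :
    tetraCubic x ≠ 0 := by
  obtain ⟨g, hg, c, hc, hgx⟩ := exists_smul_of_card_six h
  rw [← tetraCubic_apply hg, hgx, tetraCubic_smul]
  positivity

lemma tetrahedron_eq_orbit : tetrahedron = MulAction.orbit Td (!₂[1, 1, 1] : E3) := by
  obtain ⟨p, -, hp, -⟩ := isLinearOrbit_tetrahedron
  have : (!₂[1, 1, 1] : E3) ∈ MulAction.orbit Td p := by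
    rw [← hp]
    exact tetraVertex_mem 0
  rw [hp, MulAction.orbit_eq_iff.2 this]

lemma octahedron_eq_orbit : octahedron = MulAction.orbit Td (!₂[1, 0, 0] : E3) := by
  obtain ⟨p, -, hp, -⟩ := isLinearOrbit_octahedron_Td
  have : (!₂[1, 0, 0] : E3) ∈ MulAction.orbit Td p := by
    rw [← hp, mem_octahedron_iff]
    simp
  rw [hp, MulAction.orbit_eq_iff.2 this]

lemma card_stabilizer_smul {c : ℝ} (hc : c ≠ 0) :
    Nat.card (MulAction.stabilizer Td (c • !₂[1, 1, 1] : E3)) = 6 := by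
  rw [stabilizer_smul_eq hc, show (!₂[1, 1, 1] : E3) = tetraPoint 1 from rfl,
    stabilizer_tetraPoint, card_tetraIsotropy]
  rfl

/-- The topological orbit type of a nonzero multiple of a vertex of the tetrahedron consists of the
positive multiples of that point: the cubic invariant does not vanish on the orbit type. -/
lemma topOrbitType_Td_eq_smul_iff {s : ℝ} (hs : s ≠ 0) {x : E3} :
    topOrbitType Td x = topOrbitType Td (s • !₂[1, 1, 1]) ↔
      ∃ r : ℝ, 0 < r ∧ MulAction.orbit Td x = r • (s • tetrahedron) := by
  rw [tetrahedron_eq_orbit, ← orbit_smul]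
  constructor
  · intro h
    have hcard : ∀ z, orbitType Td z = orbitType Td (s • !₂[1, 1, 1] : E3) →
        Nat.card (MulAction.stabilizer Td z) = 6 := by
      intro z hz
      obtain ⟨e⟩ := nonempty_mulEquiv_stabilizer hz
      rw [Nat.card_congr e.toEquiv, card_stabilizer_smul hs]
    obtain ⟨g, hg, c, hc, hgx⟩ :=
      exists_smul_of_card_six (hcard x (orbitType_eq_of_topOrbitType_eq h))
    have hpos : 0 < s * tetraCubic x := by
      refine pos_of_topOrbitType_eq (F := fun z => s * tetraCubic z)
        (continuous_const.mul continuous_tetraCubic) (fun g hg z => by rw [tetraCubic_apply hg])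
        (fun z hz => mul_ne_zero hs (tetraCubic_ne_zero (hcard z hz))) h.symm ?_
      rw [tetraCubic_smul]
      have : 0 < s ^ 2 := by positivity
      nlinarith [mul_pos this this]
    rw [← tetraCubic_apply hg, hgx, tetraCubic_smul] at hpos
    have hcs : 0 < c / s := by
      have h1 : 0 < c ^ 2 * (c * s) := by nlinarith
      have h2 : 0 < c * s := pos_of_mul_pos_right h1 (sq_nonneg c)
      have h3 : c / s = c * s / s ^ 2 := by field_simp
      rw [h3]
      positivity
    refine ⟨c / s, hcs, ?_⟩
    rw [← orbit_smul, smul_smul, div_mul_cancel₀ _ hs, ← hgx, eq_comm, MulAction.orbit_eq_iff]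
    exact mem_orbit_iff_apply.2 ⟨g, hg, rfl⟩
  · rintro ⟨r, hr, hx⟩
    rw [← orbit_smul, MulAction.orbit_eq_iff] at hx
    rw [topOrbitType_eq_of_mem_orbit hx, topOrbitType_smul hr]

lemma tetrahedral_has_iff {x : E3} : TdKind.tetrahedral.Has x ↔
    ∃ r : ℝ, 0 < r ∧ MulAction.orbit Td x = r • tetrahedron := by
  have := topOrbitType_Td_eq_smul_iff one_ne_zero (x := x)
  rwa [one_smul, one_smul] at this

lemma neg_vertex_eq : (!₂[-1, -1, -1] : E3) = (-1 : ℝ) • !₂[1, 1, 1] := by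
  apply E3.ext3 <;> simp

lemma dualTetrahedral_has_iff {x : E3} : TdKind.dualTetrahedral.Has x ↔
    ∃ r : ℝ, 0 < r ∧ MulAction.orbit Td x = r • dualTetrahedron := by
  rw [dualTetrahedron_eq, ← topOrbitType_Td_eq_smul_iff (by norm_num), ← neg_vertex_eq]
  rfl

/-- The permutations of the coordinates form the isotropy group of `(1, 1, 1)`. -/
lemma nonempty_mulEquiv_perm {c : ℝ} (hc : c ≠ 0) :
    Nonempty (MulAction.stabilizer Td (c • !₂[1, 1, 1] : E3) ≃* Equiv.Perm (Fin 3)) := by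
  let f : Equiv.Perm (Fin 3) →* MulAction.stabilizer Td (c • !₂[1, 1, 1] : E3) :=
    MonoidHom.mk' (fun e => ⟨⟨permIso e⁻¹, permIso_mem_Td _⟩, by
      change permIso e⁻¹ (c • !₂[1, 1, 1]) = c • !₂[1, 1, 1]
      ext i
      rw [permIso_apply]
      have : ∀ j : Fin 3, (c • !₂[1, 1, 1] : E3) j = c := fun j => by
        fin_cases j <;> simp
      rw [this, this]⟩) fun e e' => by
        refine Subtype.ext (Subtype.ext (LinearIsometryEquiv.ext fun x => ?_))
        change permIso (e * e')⁻¹ x = permIso e⁻¹ (permIso e'⁻¹ x)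
        ext i
        simp [mul_inv_rev]
  have hf : Function.Injective f := by
    intro e e' h
    have h1 : permIso e⁻¹ = permIso e'⁻¹ := Subtype.ext_iff.1 (Subtype.ext_iff.1 h)
    refine inv_injective (Equiv.ext fun i => ?_)
    have h2 := congrArg (fun k : O3 => k (WithLp.toLp 2 fun j => ((j : ℕ) : ℝ)) i) h1
    simp only [permIso_apply] at h2
    exact Fin.ext (by exact_mod_cast h2)
  have hbij : Function.Bijective f := by
    have : Finite (MulAction.stabilizer Td (c • !₂[1, 1, 1] : E3)) := inferInstance
    refine (Nat.bijective_iff_injective_and_card f).2 ⟨hf, ?_⟩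
    rw [card_stabilizer_smul hc, Nat.card_eq_fintype_card, Fintype.card_perm]
    rfl
  exact ⟨(MulEquiv.ofBijective f hbij).symm⟩

lemma has_or_has_of_card_six {x : E3} (h : Nat.card (MulAction.stabilizer Td x) = 6) :
    TdKind.tetrahedral.Has x ∨ TdKind.dualTetrahedral.Has x := by
  obtain ⟨g, hg, c, hc, hgx⟩ := exists_smul_of_card_six h
  have h1 : topOrbitType Td x = topOrbitType Td (c • !₂[1, 1, 1] : E3) := by
    rw [← hgx]
    exact (topOrbitType_eq_of_mem_orbit (mem_orbit_iff_apply.2 ⟨g, hg, rfl⟩)).symm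
  rcases lt_or_gt_of_ne hc with hc | hc
  · right
    change _ = _
    have e : (c • !₂[1, 1, 1] : E3) = (-c) • ((-1 : ℝ) • !₂[1, 1, 1] : E3) := by
      rw [smul_smul, neg_mul_neg, mul_one]
    rw [h1, neg_vertex_eq, e, topOrbitType_smul (neg_pos.2 hc)]
  · left
    change _ = _
    rw [h1, topOrbitType_smul hc]

lemma perm_three_iff {x : E3} : Nonempty (MulAction.stabilizer Td x ≃* Equiv.Perm (Fin 3)) ↔
    TdKind.tetrahedral.Has x ∨ TdKind.dualTetrahedral.Has x := by
  constructor
  · rintro ⟨e⟩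
    refine has_or_has_of_card_six ?_
    rw [Nat.card_congr e.toEquiv, Nat.card_eq_fintype_card, Fintype.card_perm]
    rfl
  · have key : ∀ c : ℝ, c ≠ 0 → topOrbitType Td x = topOrbitType Td (c • !₂[1, 1, 1] : E3) →
        Nonempty (MulAction.stabilizer Td x ≃* Equiv.Perm (Fin 3)) := by
      intro c hc h
      obtain ⟨e⟩ := nonempty_mulEquiv_stabilizer (orbitType_eq_of_topOrbitType_eq h)
      obtain ⟨e'⟩ := nonempty_mulEquiv_perm hc
      exact ⟨e.trans e'⟩
    rintro (h | h)
    · refine key 1 one_ne_zero ?_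
      rw [one_smul]
      exact h
    · refine key (-1) (by norm_num) ?_
      rw [← neg_vertex_eq]
      exact h

lemma isKleinFour_patternStabilizer : IsKleinFour (patternStabilizer (valuePattern 2)) where
  card_four := card_patternStabilizer 2
  exponent_two := by
    have hdvd : Monoid.exponent (patternStabilizer (valuePattern 2)) ∣ 2 := by
      refine Monoid.exponent_dvd_of_forall_pow_eq_one fun σ => Subtype.ext ?_
      have : ∀ σ : Equiv.Perm (Fin 4), (∀ i, valuePattern 2 (σ i) = valuePattern 2 i) →
          σ ^ 2 = 1 := by decide
      exact this σ σ.2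
    refine (Nat.dvd_prime Nat.prime_two).1 hdvd |>.resolve_left fun h1 => ?_
    have h2 := Monoid.exp_eq_one_iff.1 h1
    have h3 := card_patternStabilizer 2
    rw [Nat.card_of_subsingleton (1 : patternStabilizer (valuePattern 2))] at h3
    exact absurd h3 (by decide)

lemma isKleinFour_zmod_prod :
    IsKleinFour (Multiplicative (ZMod 2) × Multiplicative (ZMod 2)) where
  card_four := by
    rw [Nat.card_eq_fintype_card]
    rfl
  exponent_two := by
    have hdvd : Monoid.exponent (Multiplicative (ZMod 2) × Multiplicative (ZMod 2)) ∣ 2 := by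
      refine Monoid.exponent_dvd_of_forall_pow_eq_one ?_
      decide
    refine (Nat.dvd_prime Nat.prime_two).1 hdvd |>.resolve_left fun h1 => ?_
    have h2 := Monoid.exp_eq_one_iff.1 h1
    exact absurd (h2.elim (Multiplicative.ofAdd 1, 1) 1) (by decide)

lemma octahedral_has_iff_card {x : E3} :
    TdKind.octahedral.Has x ↔ Nat.card (MulAction.stabilizer Td x) = 4 := by
  have := isKleinFour_zmod_prod
  have := isKleinFour_patternStabilizer
  constructor
  · rintro ⟨e⟩
    rw [Nat.card_congr e.toEquiv, IsKleinFour.card_four]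
  · intro h
    have h1 : orbitType Td x = orbitType Td (tetraPoint 2) := orbitType_eq_tetraPoint_iff.2 h
    obtain ⟨e⟩ := nonempty_mulEquiv_stabilizer h1
    rw [stabilizer_tetraPoint] at e
    obtain ⟨e'⟩ := IsKleinFour.nonempty_mulEquiv (G₁ := patternStabilizer (valuePattern 2))
      (G₂ := Multiplicative (ZMod 2) × Multiplicative (ZMod 2))
    exact ⟨e.trans ((tetraEquiv.subgroupMap _).symm.trans e')⟩

lemma octahedral_has_iff {x : E3} : TdKind.octahedral.Has x ↔
    ∃ r : ℝ, 0 < r ∧ MulAction.orbit Td x = r • octahedron := by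
  rw [octahedral_has_iff_card, octahedron_eq_orbit]
  constructor
  · intro h
    obtain ⟨g, hg, c, hc, hgx⟩ := exists_smul_of_card_four h
    refine ⟨|c|, abs_pos.2 hc, ?_⟩
    rw [← orbit_smul, MulAction.orbit_eq_iff, mem_orbit_iff_apply]
    have hgx' : g.symm (c • !₂[1, 0, 0]) = x := by rw [← hgx, g.symm_apply_apply]
    rcases abs_choice c with h | h <;> rw [h]
    · exact ⟨g⁻¹, Td.inv_mem hg, hgx'⟩
    · refine ⟨g⁻¹ * halfTurn 1, Td.mul_mem (Td.inv_mem hg) (halfTurn_mem_Td 1), ?_⟩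
      change g.symm (halfTurn 1 (-c • !₂[1, 0, 0])) = x
      rw [← hgx']
      congr 1
      apply E3.ext3 <;> simp [halfTurn]
  · rintro ⟨r, hr, hx⟩
    rw [← orbit_smul, MulAction.orbit_eq_iff] at hx
    have h1 : orbitType Td x = orbitType Td (tetraPoint 2) := by
      rw [orbitType_eq_of_mem_orbit hx]
      exact orbitType_eq_of_stabilizer_eq (stabilizer_smul_eq hr.ne' _)
    exact orbitType_eq_tetraPoint_iff.1 h1

lemma mirror_has_iff_card {x : E3} :
    TdKind.mirror.Has x ↔ Nat.card (MulAction.stabilizer Td x) = 2 := by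
  have h2 : Nat.card (Multiplicative (ZMod 2)) = 2 := by
    rw [Nat.card_eq_fintype_card]
    rfl
  constructor
  · rintro ⟨e⟩
    rw [Nat.card_congr e.toEquiv, h2]
  · intro h
    exact ⟨mulEquivOfPrimeCardEq (p := 2) h h2⟩

lemma generic_has_iff_card {x : E3} :
    TdKind.generic.Has x ↔ Nat.card (MulAction.stabilizer Td x) = 1 :=
  Subgroup.card_eq_one.symm

lemma exists_tdKind_has (x : E3) : ∃ k : TdKind, k.Has x := by
  obtain ⟨k, hk⟩ := exists_card_stabilizer_eq x
  fin_cases k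
  · refine ⟨.origin, Subgroup.eq_top_of_card_eq (MulAction.stabilizer Td x) ?_⟩
    rw [hk, card_Td]
    rfl
  · rcases has_or_has_of_card_six hk with h | h
    exacts [⟨_, h⟩, ⟨_, h⟩]
  · exact ⟨_, octahedral_has_iff_card.2 hk⟩
  · exact ⟨_, mirror_has_iff_card.2 hk⟩
  · exact ⟨_, generic_has_iff_card.2 hk⟩

lemma ncard_orbit_mul_card_stabilizer (x : E3) :
    (MulAction.orbit Td x).ncard * Nat.card (MulAction.stabilizer Td x) = 24 := by
  rw [← MulAction.index_stabilizer, mul_comm, Subgroup.card_mul_index, card_Td]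

lemma TdKind.Has.congr {k : TdKind} {x y : E3}
    (hs : MulAction.stabilizer Td x = MulAction.stabilizer Td y)
    (ht : topOrbitType Td x = topOrbitType Td y) (h : k.Has x) : k.Has y := by
  cases k <;> simp only [TdKind.Has] at h ⊢ <;> first | rwa [← hs] | rwa [← ht]

lemma TdKind.exists_has {k : TdKind} (hk : k ≠ .origin) :
    ∃ x ≠ 0, ∀ r : ℝ, 0 < r → k.Has (r • x) := by
  have key : ∀ x, x ≠ 0 → k.Has x → ∃ x ≠ 0, ∀ r : ℝ, 0 < r → k.Has (r • x) :=
    fun x hx h => ⟨x, hx, fun r hr => h.congr (stabilizer_smul_eq hr.ne' x).symm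
      (topOrbitType_smul hr x).symm⟩
  have hcard : ∀ l : Fin 5, Nat.card (MulAction.stabilizer Td (tetraPoint l)) = patternOrder l :=
    fun l => by rw [stabilizer_tetraPoint, card_tetraIsotropy]
  have hne : ∀ l : Fin 5, l ≠ 0 → tetraPoint l ≠ 0 := fun l hl =>
    ne_zero_of_card_stabilizer (by
      rw [hcard]
      revert l
      decide)
  cases k
  · exact absurd rfl hk
  · exact key _ (hne 1 (by decide)) rfl
  · refine key !₂[-1, -1, -1] ?_ rfl
    rw [neg_vertex_eq]
    exact smul_ne_zero (by norm_num) (hne 1 (by decide))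
  · exact key _ (hne 2 (by decide)) (octahedral_has_iff_card.2 (hcard 2))
  · exact key _ (hne 3 (by decide)) (mirror_has_iff_card.2 (hcard 3))
  · exact key _ (hne 4 (by decide)) (generic_has_iff_card.2 (hcard 4))

lemma eq_zero_of_Td (v : E3) : (∀ g ∈ Td, g v = v) → v = 0 := eq_zero_of_halfTurn halfTurn_mem_Td v

lemma eq_zero_of_Oh (v : E3) : (∀ g ∈ Oh, g v = v) → v = 0 := eq_zero_of_halfTurn halfTurn_mem_Oh v

lemma eq_zero_of_Ih (v : E3) : (∀ g ∈ Ih, g v = v) → v = 0 := eq_zero_of_halfTurn halfTurn_mem_Ih v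

theorem exists_isCentral_of_tdKinds (n : TdKind → ℕ) (μ : ∀ k, Fin (n k) → ℝ)
    (hn : n TdKind.origin ≤ 1) (hμ : ∀ k j, 0 < μ k j) :
    ∃ C : Configuration, C.IsSymmetric Td ∧ C.IsUnionOfOrbits Td TdKind.Has n μ ∧ C.IsCentral := by
  have hfin : Finite TdKind := by
    refine Finite.of_injective (β := Fin 6) (fun k => match k with
      | .origin => 0 | .tetrahedral => 1 | .dualTetrahedral => 2 | .octahedral => 3
      | .mirror => 4 | .generic => 5) fun k l h => ?_
    cases k <;> cases l <;> first | rfl | exact absurd h (by decide)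
  obtain ⟨C₀, hC₀, hu⟩ := Configuration.exists_isUnionOfOrbits (G := Td) (R := TdKind.Has) hμ hn
    (stabilizer_Td_eq_top_iff.2 rfl) fun k hk => TdKind.exists_has hk
  obtain ⟨C, ⟨hC, hCu⟩, hcentral, -⟩ := hC₀.exists_joinedThrough_isCentral eq_zero_of_Td hu
    fun k x y hs ht h => h.congr hs ht
  exact ⟨C, hC, hCu, hcentral⟩

/-! ### Nested polyhedra -/

lemma pos_of_continuous_of_ne_zero {c : unitInterval → ℝ} (hc : Continuous c)
    (h : ∀ t, c t ≠ 0) (h0 : 0 < c 0) (t : unitInterval) : 0 < c t := by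
  by_contra ht
  obtain ⟨s, hs⟩ := mem_range_of_exists_le_of_exists_ge hc ⟨t, not_lt.1 ht⟩ ⟨0, h0.le⟩
  exact h s hs

/-- The orbits of a symmetric configuration that are multiples of the orbit of a point whose
isotropy group fixes only a line stay so in an equivariant motion. The factors neither vanish nor
coincide for two such orbits, so that their signs and their order are preserved. -/
theorem exists_isCentral_nested {G : Subgroup O3} [Finite G]
    (hG : ∀ v : E3, (∀ g ∈ G, g v = v) → v = 0) {F : Set (Set E3)}
    (hF : ∀ P ∈ F, IsLinearOrbit G P) {n : ℕ} {P : Fin n → Set E3} {μ : Fin n → ℝ}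
    (hP : ∀ j, P j ∈ F) (hμ : ∀ j, 0 < μ j) :
    ∃ (r : Fin n → ℝ) (C : Configuration),
      (∀ j, 0 < r j) ∧ (∀ i j, i < j → P i = P j → r i < r j) ∧
      C.IsDisjointUnion (fun j => r j • P j) μ ∧ C.IsSymmetric G ∧ C.IsCentral := by
  choose! p hp0 hp hline using hF
  have hnorm : ∀ j, 0 < ‖p (P j)‖ := fun j => norm_pos_iff.2 (hp0 _ (hP j))
  -- the initial radii `j + 1` are distinct, hence so are the orbits
  let a : Fin n → ℝ := fun j => ((j : ℕ) + 1) / ‖p (P j)‖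
  have ha : ∀ j, 0 < a j := fun j => div_pos (by positivity) (hnorm j)
  let q : Fin n → E3 := fun j => a j • p (P j)
  have hq : ∀ j, ‖q j‖ = (j : ℕ) + 1 := fun j => by
    change ‖a j • p (P j)‖ = _
    rw [norm_smul, Real.norm_of_nonneg (ha j).le, div_mul_cancel₀ _ (hnorm j).ne']
  have hdisj : ∀ i j, q j ∈ MulAction.orbit G (q i) → i = j := fun i j h => by
    have := norm_eq_of_mem_orbit h
    rw [hq, hq] at this
    exact Fin.ext (by exact_mod_cast (add_right_cancel this).symm)
  obtain ⟨C, hC, hpts, hmass⟩ := Configuration.exists_isSymmetric q hμ hdisj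
  have hqC : ∀ j, q j ∈ C.points := fun j => by
    rw [← Finset.mem_coe, hpts]
    exact Set.mem_iUnion.2 ⟨j, MulAction.mem_orbit_self _⟩
  obtain ⟨ψ, hinj, hψ, hequi, h0, hcentral⟩ := hC.exists_motion_isCentral hG
  let c : Fin n → unitInterval → ℝ := fun j t =>
    inner ℝ (p (P j)) (ψ t ⟨q j, hqC j⟩) / ‖p (P j)‖ ^ 2
  have hc : ∀ j t, ψ t ⟨q j, hqC j⟩ = c j t • p (P j) := fun j t => by
    obtain ⟨b, hb⟩ := hline _ (hP j) (ψ t ⟨q j, hqC j⟩) fun g hg hgp =>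
      (hequi t g hg ⟨q j, hqC j⟩ ⟨q j, hqC j⟩ (by
        change a j • p (P j) = g (a j • p (P j))
        rw [map_smul, hgp])).symm
    change _ = (inner ℝ _ _ / _) • _
    rw [hb, inner_smul_right, real_inner_self_eq_norm_sq,
      mul_div_cancel_right₀ _ (pow_pos (hnorm j) 2).ne']
  have hcont : ∀ j, Continuous (c j) := fun j => by
    have : Continuous fun t => ψ t ⟨q j, hqC j⟩ := (continuous_apply _).comp hψ
    exact (continuous_const.inner this).div_const _
  have hstart : ∀ j, c j 0 = a j := fun j => by
    have h := hc j 0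
    rw [h0] at h
    exact (smul_left_injective ℝ (hp0 _ (hP j)) h).symm
  have hpos : ∀ j t, 0 < c j t := fun j => by
    refine pos_of_continuous_of_ne_zero (hcont j) (fun t ht => hp0 _ (hP j) ?_)
      (by rw [hstart]; exact ha j)
    -- a particle at the origin is fixed by all of `G`, hence was there from the start
    refine hG _ fun g hg => ?_
    have h1 := (hequi t).stabilizer_eq hC (hinj t) ⟨q j, hqC j⟩
    rw [hc, ht, zero_smul, stabilizer_smul_eq (ha j).ne'] at h1
    have h2 : (⟨g, hg⟩ : G) ∈ MulAction.stabilizer G (p (P j)) := by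
      rw [← h1]
      exact map_zero g
    exact h2
  have horder : ∀ i j, i < j → P i = P j → ∀ t, 0 < c j t - c i t := fun i j hij hPij => by
    refine pos_of_continuous_of_ne_zero ((hcont j).sub (hcont i)) (fun t ht => hij.ne ?_) ?_
    · have h1 : ψ t ⟨q i, hqC i⟩ = ψ t ⟨q j, hqC j⟩ := by
        rw [hc, hc, hPij, sub_eq_zero.1 ht]
      have h2 : q i = q j := Subtype.ext_iff.1 (hinj t h1)
      exact hdisj i j (h2 ▸ MulAction.mem_orbit_self _)
    · rw [hstart, hstart, sub_pos]
      change _ / ‖p (P i)‖ < _ / ‖p (P j)‖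
      rw [hPij]
      have : ((i : ℕ) : ℝ) < (j : ℕ) := by exact_mod_cast hij
      exact div_lt_div_of_pos_right (by linarith) (hnorm j)
  have horbit : ∀ j, c j 1 • P j =
      ψ 1 '' {y | (y : E3) ∈ MulAction.orbit G (q j)} := fun j => by
    rw [← (hequi 1).orbit_eq hC ⟨q j, hqC j⟩, hc, orbit_smul, ← hp _ (hP j)]
  refine ⟨fun j => c j 1, C.move (ψ 1) (hinj 1), fun j => hpos j 1,
    fun i j hij hPij => sub_pos.1 (horder i j hij hPij 1), ⟨?_, ?_, ?_⟩,
    (hequi 1).isSymmetric_move hC (hinj 1), hcentral⟩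
  · intro i j hij
    simp only [horbit]
    rw [Set.disjoint_image_iff (hinj 1), Set.disjoint_left]
    intro y hyi hyj
    refine hij (hdisj i j ?_)
    rw [← MulAction.orbit_eq_iff.2 hyi, MulAction.orbit_eq_iff.2 hyj]
    exact MulAction.mem_orbit_self _
  · rw [Configuration.coe_points_move]
    simp only [horbit]
    rw [← Set.image_iUnion, ← Set.image_univ]
    congr 1
    refine (Set.eq_univ_of_forall fun y => ?_).symm
    have hy : (y : E3) ∈ (C.points : Set E3) := y.2
    rw [hpts] at hy
    obtain ⟨j, hj⟩ := Set.mem_iUnion.1 hy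
    exact Set.mem_iUnion.2 ⟨j, hj⟩
  · intro j x hx
    simp only [horbit] at hx
    obtain ⟨y, hy, rfl⟩ := hx
    rw [Configuration.mass_move, hmass j y hy]

theorem IsLinearOrbit.isCentral {G : Subgroup O3} (hG : ∀ v : E3, (∀ g ∈ G, g v = v) → v = 0)
    {P : Set E3} (hP : IsLinearOrbit G P) {r μ : ℝ} {C : Configuration} (hr : 0 < r)
    (hC : (C.points : Set E3) = r • P) (hμ : ∀ x ∈ C.points, C.mass x = μ) : C.IsCentral := by
  obtain ⟨p, -, hp, hline⟩ := hP.smul hr.ne'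
  rw [hp] at hC
  have hmem : ∀ g ∈ G, ∀ x ∈ C.points, g x ∈ C.points := fun g hg x hx => by
    rw [← Finset.mem_coe, hC] at hx ⊢
    exact MulAction.mem_orbit_of_mem_orbit (⟨g, hg⟩ : G) hx
  refine Configuration.IsSymmetric.isCentral_of_orbit hG (fun g hg => ⟨?_, fun x hx => ?_⟩) hC hline
  · refine Set.Subset.antisymm ?_ fun x hx => ?_
    · rintro _ ⟨x, hx, rfl⟩
      exact hmem g hg x hx
    · exact ⟨g⁻¹ x, hmem _ (inv_mem hg) x hx, g.apply_symm_apply x⟩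
  · rw [hμ x hx, hμ _ (hmem g hg x hx)]

theorem mainTheorem6 :
    -- each of the three groups, every topological Burnside type, all positive orbit masses:
    -- configurations of that type exist, and each component contains a central one
    (∀ G : Subgroup O3, G = Td ∨ G = Oh ∨ G = Ih →
      ∀ (Γ : TopOrbitType G →₀ ℕ) (μ : ∀ t, Fin (Γ t) → ℝ),
        Γ (TopOrbitType.mk G 0) ≤ 1 → (∀ t j, 0 < μ t j) →
        (∃ C : Configuration, C.HasBurnsideType G Γ μ ∧ C.IsCentral) ∧
        ∀ C₀ : Configuration, C₀.HasBurnsideType G Γ μ →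
          ∃ C : Configuration, C.HasBurnsideType G Γ μ ∧ C.IsCentral ∧
            Configuration.JoinedThrough (fun D => D.HasBurnsideType G Γ μ) C₀ C) ∧
    -- the tetrahedral group: order, orbit types and shapes of the orbits
    (Nat.card Td = 24 ∧
      (Set.range (orbitType Td)).ncard = 5 ∧
      (∀ x y : E3, Nonempty (MulAction.stabilizer Td x ≃* MulAction.stabilizer Td y) →
        orbitType Td x = orbitType Td y) ∧
      (∀ x : E3, ∃ k : TdKind, k.Has x) ∧
      (∀ x : E3, TdKind.origin.Has x ↔ x = 0) ∧
      (∀ x : E3, Nonempty (MulAction.stabilizer Td x ≃* Equiv.Perm (Fin 3)) ↔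
        TdKind.tetrahedral.Has x ∨ TdKind.dualTetrahedral.Has x) ∧
      (∀ x : E3, TdKind.tetrahedral.Has x ↔
        ∃ r : ℝ, 0 < r ∧ MulAction.orbit Td x = r • tetrahedron) ∧
      (∀ x : E3, TdKind.dualTetrahedral.Has x ↔
        ∃ r : ℝ, 0 < r ∧ MulAction.orbit Td x = r • dualTetrahedron) ∧
      (∀ x : E3, TdKind.octahedral.Has x ↔
        ∃ r : ℝ, 0 < r ∧ MulAction.orbit Td x = r • octahedron) ∧
      edgeMidpoints tetrahedron (2 * √2) = octahedron ∧
      (∀ x : E3, TdKind.mirror.Has x → (MulAction.orbit Td x).ncard = 12) ∧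
      (∀ x : E3, TdKind.generic.Has x → (MulAction.orbit Td x).ncard = 24)) ∧
    -- the tetrahedral group: central configurations with prescribed numbers of orbits
    (∀ (n : TdKind → ℕ) (μ : ∀ k, Fin (n k) → ℝ),
      n TdKind.origin ≤ 1 → (∀ k j, 0 < μ k j) →
      ∃ C : Configuration, C.IsSymmetric Td ∧ C.IsUnionOfOrbits Td TdKind.Has n μ ∧
        C.IsCentral) ∧
    -- nested Platonic solids, cuboctahedra and icosidodecahedra, and their duals
    (∀ (G : Subgroup O3) (F : Set (Set E3)),
      (G = Td ∧ F = {tetrahedron, dualTetrahedron, octahedron}) ∨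
      (G = Oh ∧ F = {octahedron, cube, cuboctahedron}) ∨
      (G = Ih ∧ F = {icosahedron, dodecahedron, icosidodecahedron}) →
      ∀ (n : ℕ) (P : Fin n → Set E3) (μ : Fin n → ℝ), (∀ j, P j ∈ F) → (∀ j, 0 < μ j) →
        ∃ (r : Fin n → ℝ) (C : Configuration),
          (∀ j, 0 < r j) ∧ (∀ i j, i < j → P i = P j → r i < r j) ∧
          C.IsDisjointUnion (fun j => r j • P j) μ ∧ C.IsSymmetric G ∧ C.IsCentral) ∧
    -- each single one of these polyhedra, of any size, with equal masses
    (∀ P ∈ ({tetrahedron, dualTetrahedron, octahedron, cube, cuboctahedron,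
        icosahedron, dodecahedron, icosidodecahedron} : Set (Set E3)),
      ∀ (r μ : ℝ) (C : Configuration), 0 < r → (C.points : Set E3) = r • P →
        (∀ x ∈ C.points, C.mass x = μ) → C.IsCentral) ∧
    -- the orbit type determines the cuboctahedron and the icosidodecahedron
    (∀ x : E3, IsotropyIsTwoOrthogonalMirrors Oh x ↔
      ∃ r : ℝ, 0 < r ∧ MulAction.orbit Oh x = r • cuboctahedron) ∧
    (∀ x : E3, IsotropyIsTwoOrthogonalMirrors Ih x ↔
      ∃ r : ℝ, 0 < r ∧ MulAction.orbit Ih x = r • icosidodecahedron) := by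
  have hmirror : ∀ x : E3, TdKind.mirror.Has x → (MulAction.orbit Td x).ncard = 12 := by
    intro x hx
    have h := ncard_orbit_mul_card_stabilizer x
    rw [mirror_has_iff_card.1 hx] at h
    omega
  have hgeneric : ∀ x : E3, TdKind.generic.Has x → (MulAction.orbit Td x).ncard = 24 := by
    intro x hx
    have h := ncard_orbit_mul_card_stabilizer x
    rw [generic_has_iff_card.1 hx] at h
    omega
  refine ⟨?_, ⟨card_Td, ncard_range_orbitType_Td, fun x y => orbitType_Td_eq_of_mulEquiv,
    exists_tdKind_has, fun x => stabilizer_Td_eq_top_iff, fun x => perm_three_iff,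
    fun x => tetrahedral_has_iff, fun x => dualTetrahedral_has_iff, fun x => octahedral_has_iff,
    edgeMidpoints_tetrahedron, hmirror, hgeneric⟩, exists_isCentral_of_tdKinds, ?_, ?_,
    isotropyIsTwoOrthogonalMirrors_Oh_iff, isotropyIsTwoOrthogonalMirrors_Ih_iff⟩
  · rintro G (rfl | rfl | rfl)
    · exact exists_isCentral_of_burnsideType eq_zero_of_Td
    · exact exists_isCentral_of_burnsideType eq_zero_of_Oh
    · exact exists_isCentral_of_burnsideType eq_zero_of_Ih
  · rintro G F (⟨rfl, rfl⟩ | ⟨rfl, rfl⟩ | ⟨rfl, rfl⟩) n P μ hP hμ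
    · refine exists_isCentral_nested eq_zero_of_Td ?_ hP hμ
      rintro _ (rfl | rfl | rfl)
      exacts [isLinearOrbit_tetrahedron, isLinearOrbit_dualTetrahedron, isLinearOrbit_octahedron_Td]
    · refine exists_isCentral_nested eq_zero_of_Oh ?_ hP hμ
      rintro _ (rfl | rfl | rfl)
      exacts [isLinearOrbit_octahedron_Oh, isLinearOrbit_cube, isLinearOrbit_cuboctahedron]
    · refine exists_isCentral_nested eq_zero_of_Ih ?_ hP hμ
      rintro _ (rfl | rfl | rfl)
      exacts [isLinearOrbit_icosahedron, isLinearOrbit_dodecahedron,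
        isLinearOrbit_icosidodecahedron]
  · rintro _ (rfl | rfl | rfl | rfl | rfl | rfl | rfl | rfl) r μ C hr hC hμ
    exacts [isLinearOrbit_tetrahedron.isCentral eq_zero_of_Td hr hC hμ,
      isLinearOrbit_dualTetrahedron.isCentral eq_zero_of_Td hr hC hμ,
      isLinearOrbit_octahedron_Td.isCentral eq_zero_of_Td hr hC hμ,
      isLinearOrbit_cube.isCentral eq_zero_of_Oh hr hC hμ,
      isLinearOrbit_cuboctahedron.isCentral eq_zero_of_Oh hr hC hμ,
      isLinearOrbit_icosahedron.isCentral eq_zero_of_Ih hr hC hμ,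
      isLinearOrbit_dodecahedron.isCentral eq_zero_of_Ih hr hC hμ,
      isLinearOrbit_icosidodecahedron.isCentral eq_zero_of_Ih hr hC hμ]
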